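/- Let $E/\mathbf{Q}$ be a totally real quadratic field and let $p$ be a prime unramified in $E$. Write $E_p=\mathbf{Q}_p\otimes_{\mathbf{Q}}E$ and $\mathcal{O}_{E,p}=\mathbf{Z}_p\otimes_{\mathbf{Z}}\mathcal{O}_E$, and put $\mathscr{G}(\mathbf{Q}_p)=\mathrm{GL}_2(E_p)$, $\mathscr{G}(\mathbf{Z}_p)=\mathrm{GL}_2(\mathcal{O}_{E,p})$, $\mathscr{G}^*(\mathbf{Q}_p)=\{g\in\mathscr{G}(\mathbf{Q}_p):\det g\in\mathbf{Q}_p^\times\}$ and $\mathscr{G}^*(\mathbf{Z}_p)=\{g\in\mathscr{G}(\mathbf{Z}_p):\det g\in\mathbf{Z}_p^\times\}$. For $(\Gamma,K)=(\mathscr{G}(\mathbf{Q}_p),\mathscr{G}(\mathbf{Z}_p))$ or $(\mathscr{G}^*(\mathbf{Q}_p),\mathscr{G}^*(\mathbf{Z}_p))$ let $\mathcal{H}_\Gamma^\circ=C_c^\infty(K\backslash\Gamma/K)$ be the algebra of locally constant, compactly supported, $K$-bi-invariant functions $\Gamma\to\mathbf{C}$ under convolution for the Haar measure giving $K$ volume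 $1$, and let $$\mathcal{I}(\Gamma/K)=\left(\mathcal{S}(\mathbf{Q}_p^2)\otimes_{\mathbf{C}} C_c^\infty(\Gamma/K)\right)_{\mathrm{GL}_2(\mathbf{Q}_p)}$$ be the coinvariants for the action $\gamma\cdot(\phi\otimes\xi)=\phi((-)\gamma)\otimes\xi(\gamma^{-1}(-))$ of $\mathrm{GL}_2(\mathbf{Q}_p)\subseteq\Gamma$, where $\mathcal{S}(\mathbf{Q}_p^2)$ is the space of $\mathbf{C}$-valued Schwartz functions on row vectors; $\mathcal{H}_\Gamma^\circ$ acts on it through the second factor by $(\theta\cdot\xi)(x)=\int_\Gamma\theta(g)\xi(xg)\,dg$. Then the module $\mathcal{I}(\mathscr{G}^*(\mathbf{Q}_p)/\mathscr{G}^*(\mathbf{Z}_p))$ is cyclic and free over $\mathcal{H}_{\mathscr{G}^*(\mathbf{Q}_p)}^\circ$, generated by $e=\mathrm{ch}(\mathbf{Z}_p^2)\otimes\mathrm{ch}(\mathscr{G}^*(\mathbf{Z}_p))$; that is, every element of it is $\mathcal{P}\cdot e$ for exactly one $\mathcal{P}\in\mathcal{H}_{\mathscr{G}^*(\mathbf{Q}_p)}^\circ$.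 Moreover there is an injective homomorphism of $\mathbf{C}$-algebras $$\iota_p:\mathcal{H}_{\mathscr{G}^*(\mathbf{Q}_p)}^\circ\hookrightarrow\mathcal{H}_{\mathscr{G}(\mathbf{Q}_p)}^\circ,\quad \mathrm{ch}(\mathscr{G}^*(\mathbf{Z}_p)\,g\,\mathscr{G}^*(\mathbf{Z}_p))\mapsto\mathrm{ch}(\mathscr{G}(\mathbf{Z}_p)\,g\,\mathscr{G}(\mathbf{Z}_p))\quad(g\in\mathscr{G}^*(\mathbf{Q}_p)),$$ and an injective $\mathbf{C}$-linear map $$i_p:\mathcal{I}(\mathscr{G}^*(\mathbf{Q}_p)/\mathscr{G}^*(\mathbf{Z}_p))\hookrightarrow\mathcal{I}(\mathscr{G}(\mathbf{Q}_p)/\mathscr{G}(\mathbf{Z}_p)),\quad \phi\otimes\mathrm{ch}(g\,\mathscr{G}^*(\mathbf{Z}_p))\mapsto\phi\otimes\mathrm{ch}(g\,\mathscr{G}(\mathbf{Z}_p))\quad(\phi\in\mathcal{S}(\mathbf{Q}_p^2),\ g\in\mathscr{G}^*(\mathbf{Q}_p)),$$ such that $i_p(\theta\cdot x)=\iota_p(\theta)\cdot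 i_p(x)$ for all $\theta\in\mathcal{H}_{\mathscr{G}^*(\mathbf{Q}_p)}^\circ$ and $x\in\mathcal{I}(\mathscr{G}^*(\mathbf{Q}_p)/\mathscr{G}^*(\mathbf{Z}_p))$. -/

import Mathlib

open scoped TensorProduct
open MeasureTheory

namespace AsaiHecke

/-! ### Functions on a group relative to an open compact subgroup -/

/-- `K` is an open compact subgroup of the topological group `Γ`. -/
class IsOpenCompact {Γ : Type*} [Group Γ] [TopologicalSpace Γ] (K : Subgroup Γ) : Prop where
  isOpen : IsOpen (K : Set Γ)
  isCompact : IsCompact (K : Set Γ)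

section General

variable {Γ : Type*} [Group Γ] [TopologicalSpace Γ]

/-- The space of locally constant, compactly supported functions `Γ → ℂ` which are invariant under
right translation by `K`. -/
def ccRightSubmodule (K : Subgroup Γ) : Submodule ℂ (Γ → ℂ) where
  carrier := {f | IsLocallyConstant f ∧ HasCompactSupport f ∧ ∀ g, ∀ k ∈ K, f (g * k) = f g}
  zero_mem' := ⟨IsLocallyConstant.const 0, HasCompactSupport.zero, fun _ _ _ => rfl⟩
  add_mem' := fun {a b} ha hb =>
    ⟨ha.1.add hb.1, ha.2.1.add hb.2.1, fun g k hk => by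
      simp only [Pi.add_apply, ha.2.2 g k hk, hb.2.2 g k hk]⟩
  smul_mem' := fun c a ha =>
    ⟨ha.1.comp (fun z => c * z), ha.2.1.smul_left (f := fun _ => c), fun g k hk => by
      simp only [Pi.smul_apply, ha.2.2 g k hk]⟩

/-- The underlying space of the Hecke algebra `C_c^∞(K\Γ/K)`: the functions in `C_c^∞(Γ/K)` which
are also invariant under left translation by `K`. -/
def biInvariant (K : Subgroup Γ) : Submodule ℂ (Γ → ℂ) where
  carrier := {f | f ∈ ccRightSubmodule K ∧ ∀ k ∈ K, ∀ g, f (k * g) = f g}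
  zero_mem' := ⟨(ccRightSubmodule K).zero_mem, fun _ _ _ => rfl⟩
  add_mem' := fun {a b} ha hb =>
    ⟨(ccRightSubmodule K).add_mem ha.1 hb.1, fun k hk g => by
      simp only [Pi.add_apply, ha.2 k hk g, hb.2 k hk g]⟩
  smul_mem' := fun c a ha =>
    ⟨(ccRightSubmodule K).smul_mem c ha.1, fun k hk g => by
      simp only [Pi.smul_apply, ha.2 k hk g]⟩

/-- The Hecke algebra `C_c^∞(K\Γ/K)`, as a type. Its multiplication is the convolution product
defined below. -/
def Hecke (K : Subgroup Γ) : Type _ := biInvariant K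

instance (K : Subgroup Γ) : AddCommGroup (Hecke K) := inferInstanceAs (AddCommGroup (biInvariant K))

instance (K : Subgroup Γ) : Module ℂ (Hecke K) := inferInstanceAs (Module ℂ (biInvariant K))

/-- `C_c^∞(Γ/K)`: the locally constant, compactly supported functions `Γ → ℂ` which are invariant
under right translation by `K`, as a type. -/
def CcRight (K : Subgroup Γ) : Type _ := ccRightSubmodule K

instance (K : Subgroup Γ) : AddCommGroup (CcRight K) :=
  inferInstanceAs (AddCommGroup (ccRightSubmodule K))

instance (K : Subgroup Γ) : Module ℂ (CcRight K) := inferInstanceAs (Module ℂ (ccRightSubmodule K))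

variable {K : Subgroup Γ}

/-- The function on `Γ` underlying an element of `C_c^∞(Γ/K)`. -/
def CcRight.toFun (ξ : CcRight K) : Γ → ℂ := ξ.1

theorem CcRight.ext {ξ ξ' : CcRight K} (h : ξ.toFun = ξ'.toFun) : ξ = ξ' := Subtype.ext h

/-- The function on `Γ` underlying an element of the Hecke algebra. -/
def Hecke.toFun (θ : Hecke K) : Γ → ℂ := θ.1

theorem Hecke.ext {θ θ' : Hecke K} (h : θ.toFun = θ'.toFun) : θ = θ' := Subtype.ext h

theorem Hecke.toFun_add (θ θ' : Hecke K) : (θ + θ').toFun = θ.toFun + θ'.toFun := rfl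

theorem Hecke.toFun_zero : (0 : Hecke K).toFun = 0 := rfl

theorem Hecke.toFun_smul (c : ℂ) (θ : Hecke K) : (c • θ).toFun = c • θ.toFun := rfl

theorem Hecke.continuous (θ : Hecke K) : Continuous θ.toFun := θ.2.1.1.continuous

theorem Hecke.hasCompactSupport (θ : Hecke K) : HasCompactSupport θ.toFun := θ.2.1.2.1

theorem Hecke.mul_right (θ : Hecke K) (g : Γ) {k : Γ} (hk : k ∈ K) :
    θ.toFun (g * k) = θ.toFun g := θ.2.1.2.2 g k hk

theorem Hecke.mul_left (θ : Hecke K) {k : Γ} (hk : k ∈ K) (g : Γ) :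
    θ.toFun (k * g) = θ.toFun g := θ.2.2 k hk g

theorem CcRight.continuous (ξ : CcRight K) : Continuous ξ.toFun := ξ.2.1.continuous

theorem CcRight.hasCompactSupport (ξ : CcRight K) : HasCompactSupport ξ.toFun := ξ.2.2.1

theorem CcRight.mul_right (ξ : CcRight K) (g : Γ) {k : Γ} (hk : k ∈ K) :
    ξ.toFun (g * k) = ξ.toFun g := ξ.2.2.2 g k hk

variable [IsTopologicalGroup Γ]

/-- A function invariant under right translation by an open subgroup is locally constant. -/
theorem isLocallyConstant_of_right (hK : IsOpen (K : Set Γ)) {f : Γ → ℂ}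
    (hf : ∀ g, ∀ k ∈ K, f (g * k) = f g) : IsLocallyConstant f := by
  rw [IsLocallyConstant.iff_exists_open]
  intro x
  refine ⟨(fun y => x⁻¹ * y) ⁻¹' (K : Set Γ), hK.preimage (by fun_prop), by simp, ?_⟩
  intro y hy
  have := hf x _ hy
  simpa using this

variable (K) [hK : IsOpenCompact K]

/-- The characteristic function of a compact subset of `Γ` which is a union of cosets `gK`
lies in `C_c^∞(Γ/K)`. -/
theorem indicator_mem_ccRight {S : Set Γ} (hS : IsCompact S)
    (hSK : ∀ g, ∀ k ∈ K, g * k ∈ S ↔ g ∈ S) :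
    S.indicator (fun _ => (1 : ℂ)) ∈ ccRightSubmodule K := by
  classical
  have hinv : ∀ g, ∀ k ∈ K, S.indicator (fun _ => (1 : ℂ)) (g * k) =
      S.indicator (fun _ => (1 : ℂ)) g := by
    intro g k hk
    simp only [Set.indicator_apply, hSK g k hk]
  refine ⟨isLocallyConstant_of_right hK.isOpen hinv, ?_, hinv⟩
  exact HasCompactSupport.of_support_subset_isCompact hS Set.support_indicator_subset

theorem isCompact_leftCoset (g : Γ) : IsCompact {x : Γ | ∃ k ∈ K, x = g * k} := by
  have := hK.isCompact.image (f := fun k => g * k) (by fun_prop)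
  convert this using 1
  ext x
  constructor
  · rintro ⟨k, hk, rfl⟩
    exact ⟨k, hk, rfl⟩
  · rintro ⟨k, hk, rfl⟩
    exact ⟨k, hk, rfl⟩

theorem isCompact_doubleCoset (g : Γ) :
    IsCompact {x : Γ | ∃ k₁ ∈ K, ∃ k₂ ∈ K, x = k₁ * g * k₂} := by
  have := (hK.isCompact.prod hK.isCompact).image (f := fun k : Γ × Γ => k.1 * g * k.2)
    (by fun_prop)
  convert this using 1
  ext x
  simp only [Set.mem_image, Set.mem_prod, Prod.exists, SetLike.mem_coe, Set.mem_ofPred_eq]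
  constructor
  · rintro ⟨a, ha, b, hb, rfl⟩
    exact ⟨a, b, ⟨ha, hb⟩, rfl⟩
  · rintro ⟨a, b, ⟨ha, hb⟩, rfl⟩
    exact ⟨a, ha, b, hb, rfl⟩

/-- The characteristic function `ch(gK)`, as an element of `C_c^∞(Γ/K)`. -/
noncomputable def chCoset (g : Γ) : CcRight K :=
  ⟨{x : Γ | ∃ k ∈ K, x = g * k}.indicator (fun _ => 1),
    indicator_mem_ccRight K (isCompact_leftCoset K g) (by
      intro x k hk
      constructor
      · rintro ⟨k', hk', h⟩
        exact ⟨k' * k⁻¹, K.mul_mem hk' (K.inv_mem hk), by rw [← mul_assoc, ← h]; group⟩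
      · rintro ⟨k', hk', rfl⟩
        exact ⟨k' * k, K.mul_mem hk' hk, by group⟩)⟩

/-- The characteristic function `ch(KgK)`, as an element of the Hecke algebra. -/
noncomputable def chDoubleCoset (g : Γ) : Hecke K :=
  ⟨{x : Γ | ∃ k₁ ∈ K, ∃ k₂ ∈ K, x = k₁ * g * k₂}.indicator (fun _ => 1),
    indicator_mem_ccRight K (isCompact_doubleCoset K g) (by
      intro x k hk
      constructor
      · rintro ⟨a, ha, b, hb, h⟩
        exact ⟨a, ha, b * k⁻¹, K.mul_mem hb (K.inv_mem hk), by rw [← mul_assoc, ← h]; group⟩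
      · rintro ⟨a, ha, b, hb, rfl⟩
        exact ⟨a, ha, b * k, K.mul_mem hb hk, by group⟩), by
    classical
    intro k hk x
    simp only [Set.indicator_apply, Set.mem_ofPred_eq]
    congr 1
    apply propext
    constructor
    · rintro ⟨a, ha, b, hb, h⟩
      exact ⟨k⁻¹ * a, K.mul_mem (K.inv_mem hk) ha, b, hb, by
        rw [mul_assoc k⁻¹, mul_assoc k⁻¹, ← h]; group⟩
    · rintro ⟨a, ha, b, hb, rfl⟩
      exact ⟨k * a, K.mul_mem hk ha, b, hb, by group⟩⟩

/-- The Haar measure on `Γ` (with its Borel `σ`-algebra) for which `K` has volume `1`. -/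
noncomputable def normHaar : @Measure Γ (borel Γ) :=
  letI : MeasurableSpace Γ := borel Γ
  haveI : BorelSpace Γ := ⟨rfl⟩
  Measure.haarMeasure
    { carrier := K
      isCompact' := hK.isCompact
      interior_nonempty' := ⟨1, by rw [hK.isOpen.interior_eq]; exact K.one_mem⟩ }

/-- The integral of a function on `Γ` against the Haar measure giving `K` volume `1`. -/
noncomputable def haarInt (f : Γ → ℂ) : ℂ :=
  letI : MeasurableSpace Γ := borel Γ
  ∫ g, f g ∂(normHaar K)

theorem haarInt_zero : haarInt K (fun _ => 0) = 0 := by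
  simp [haarInt]

theorem haarInt_const_mul (c : ℂ) (f : Γ → ℂ) :
    haarInt K (fun g => c * f g) = c * haarInt K f := by
  let : MeasurableSpace Γ := borel Γ
  exact integral_const_mul c f

theorem haarInt_add {f f' : Γ → ℂ} (hf : Continuous f) (hfc : HasCompactSupport f)
    (hf' : Continuous f') (hfc' : HasCompactSupport f') :
    haarInt K (fun g => f g + f' g) = haarInt K f + haarInt K f' := by
  let : MeasurableSpace Γ := borel Γ
  have : BorelSpace Γ := ⟨rfl⟩
  have : (normHaar K).IsHaarMeasure := Measure.isHaarMeasure_haarMeasure _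
  exact integral_add (hf.integrable_of_hasCompactSupport hfc)
    (hf'.integrable_of_hasCompactSupport hfc')

theorem haarInt_mul_left (f : Γ → ℂ) (x : Γ) :
    haarInt K (fun g => f (x * g)) = haarInt K f := by
  let : MeasurableSpace Γ := borel Γ
  have : BorelSpace Γ := ⟨rfl⟩
  have : (normHaar K).IsHaarMeasure := Measure.isHaarMeasure_haarMeasure _
  exact integral_mul_left_eq_self f x

theorem haarInt_swap {f : Γ → Γ → ℂ} (hf : Continuous f.uncurry)
    (hfc : HasCompactSupport f.uncurry) :
    haarInt K (fun g => haarInt K (fun h => f g h)) =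
      haarInt K (fun h => haarInt K (fun g => f g h)) := by
  let : MeasurableSpace Γ := borel Γ
  have : BorelSpace Γ := ⟨rfl⟩
  have : (normHaar K).IsHaarMeasure := Measure.isHaarMeasure_haarMeasure _
  exact integral_integral_swap_of_hasCompactSupport hf hfc

theorem haarInt_indicator : haarInt K ((K : Set Γ).indicator (fun _ => 1)) = 1 := by
  let : MeasurableSpace Γ := borel Γ
  have : BorelSpace Γ := ⟨rfl⟩
  have h1 : normHaar K (K : Set Γ) = 1 := Measure.haarMeasure_self
  have h2 : haarInt K ((K : Set Γ).indicator (fun _ => 1)) = ((normHaar K).real (K : Set Γ) : ℂ) := by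
    simp [haarInt, integral_indicator hK.isOpen.measurableSet]
  rw [h2, Measure.real, h1]
  simp

theorem exists_of_haarInt_ne_zero {f : Γ → ℂ} (h : haarInt K f ≠ 0) : ∃ g, f g ≠ 0 := by
  by_contra hc
  push Not at hc
  exact h (by rw [show f = fun _ => 0 from funext hc, haarInt_zero])

/-! ### Convolution and the action by right translation -/

/-- Convolution `(θ₁ * θ₂)(x) = ∫ θ₁(g) θ₂(g⁻¹x) dg`. -/
noncomputable def conv (a b : Γ → ℂ) : Γ → ℂ := fun x => haarInt K (fun g => a g * b (g⁻¹ * x))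

/-- The right translation action `(θ · ξ)(x) = ∫ θ(g) ξ(xg) dg`. -/
noncomputable def rightAct (θ ξ : Γ → ℂ) : Γ → ℂ := fun x => haarInt K (fun g => θ g * ξ (x * g))

variable {K}

theorem conv_mem (a b : Hecke K) : conv K a.toFun b.toFun ∈ biInvariant K := by
  have hr : ∀ g, ∀ k ∈ K, conv K a.toFun b.toFun (g * k) = conv K a.toFun b.toFun g := by
    intro g k hk
    simp only [conv, ← mul_assoc, b.mul_right _ hk]
  refine ⟨⟨isLocallyConstant_of_right hK.isOpen hr, ?_, hr⟩, ?_⟩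
  · refine HasCompactSupport.of_support_subset_isCompact
      ((a.hasCompactSupport.isCompact.prod b.hasCompactSupport.isCompact).image
        (f := fun z : Γ × Γ => z.1 * z.2) (by fun_prop)) ?_
    intro x hx
    obtain ⟨g, hg⟩ := exists_of_haarInt_ne_zero K hx
    exact ⟨(g, g⁻¹ * x), ⟨subset_tsupport _ (left_ne_zero_of_mul hg),
      subset_tsupport _ (right_ne_zero_of_mul hg)⟩, by simp⟩
  · intro k hk x
    have := haarInt_mul_left K (fun g => a.toFun g * b.toFun (g⁻¹ * (k * x))) k
    simp only [conv]
    rw [← this]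
    congr 1
    ext g
    rw [a.mul_left hk]
    congr 2
    group

theorem rightAct_mem (θ : Hecke K) (ξ : CcRight K) : rightAct K θ.toFun ξ.toFun ∈ ccRightSubmodule K := by
  have hr : ∀ x, ∀ k ∈ K, rightAct K θ.toFun ξ.toFun (x * k) = rightAct K θ.toFun ξ.toFun x := by
    intro x k hk
    simp only [rightAct]
    rw [← haarInt_mul_left K (fun g => θ.toFun g * ξ.toFun (x * g)) k]
    congr 1
    ext g
    rw [θ.mul_left hk, mul_assoc]
  refine ⟨isLocallyConstant_of_right hK.isOpen hr, ?_, hr⟩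
  refine HasCompactSupport.of_support_subset_isCompact
    ((θ.hasCompactSupport.isCompact.prod ξ.hasCompactSupport.isCompact).image
      (f := fun z : Γ × Γ => z.2 * z.1⁻¹) (by fun_prop)) ?_
  intro x hx
  obtain ⟨g, hg⟩ := exists_of_haarInt_ne_zero K hx
  exact ⟨(g, x * g), ⟨subset_tsupport _ (left_ne_zero_of_mul hg),
    subset_tsupport _ (right_ne_zero_of_mul hg)⟩, by simp⟩

noncomputable instance : Mul (Hecke K) := ⟨fun a b => ⟨conv K a.toFun b.toFun, conv_mem a b⟩⟩

noncomputable instance : One (Hecke K) := ⟨chDoubleCoset K 1⟩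

theorem Hecke.toFun_mul (a b : Hecke K) : (a * b).toFun = conv K a.toFun b.toFun := rfl

theorem Hecke.toFun_one : (1 : Hecke K).toFun = (K : Set Γ).indicator (fun _ => 1) := by
  change Set.indicator {x : Γ | ∃ k₁ ∈ K, ∃ k₂ ∈ K, x = k₁ * 1 * k₂} (fun _ => 1) = _
  congr 1
  ext x
  simp only [mul_one, Set.mem_ofPred_eq, SetLike.mem_coe]
  constructor
  · rintro ⟨a, ha, b, hb, rfl⟩
    exact K.mul_mem ha hb
  · intro hx
    exact ⟨1, K.one_mem, x, hx, by simp⟩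

theorem haarInt_one_mul {f : Γ → ℂ} {c : ℂ} (hf : ∀ k ∈ K, f k = c) :
    haarInt K (fun g => (1 : Hecke K).toFun g * f g) = c := by
  classical
  have : (fun g => (1 : Hecke K).toFun g * f g) =
      fun g => c * (K : Set Γ).indicator (fun _ => (1 : ℂ)) g := by
    ext g
    rw [Hecke.toFun_one]
    by_cases hg : g ∈ K
    · simp [hg, hf g hg]
    · simp [hg]
  rw [this, haarInt_const_mul, haarInt_indicator, mul_one]

theorem hecke_one_mul (a : Hecke K) : 1 * a = a := by
  apply Hecke.ext
  ext x
  exact haarInt_one_mul (fun k hk => a.mul_left (K.inv_mem hk) x)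

theorem hecke_mul_one (a : Hecke K) : a * 1 = a := by
  classical
  apply Hecke.ext
  ext x
  change haarInt K (fun g => a.toFun g * (1 : Hecke K).toFun (g⁻¹ * x)) = _
  rw [← haarInt_mul_left K _ x]
  have : (fun g => a.toFun (x * g) * (1 : Hecke K).toFun ((x * g)⁻¹ * x)) =
      fun g => (1 : Hecke K).toFun g * a.toFun (x * g) := by
    ext g
    rw [mul_comm, Hecke.toFun_one]
    congr 1
    simp [Set.indicator_apply]
  rw [this]
  exact haarInt_one_mul (fun k hk => a.mul_right x hk)

theorem Hecke.conv_continuous (a b : Hecke K) (x : Γ) :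
    Continuous (fun g => a.toFun g * b.toFun (g⁻¹ * x)) :=
  a.continuous.mul (b.continuous.comp (by fun_prop))

theorem Hecke.conv_support (a b : Hecke K) (x : Γ) :
    HasCompactSupport (fun g => a.toFun g * b.toFun (g⁻¹ * x)) :=
  a.hasCompactSupport.mul_right

theorem hecke_mul_assoc (a b c : Hecke K) : a * b * c = a * (b * c) := by
  apply Hecke.ext
  ext x
  change haarInt K (fun h => haarInt K (fun g => a.toFun g * b.toFun (g⁻¹ * h)) *
    c.toFun (h⁻¹ * x)) = haarInt K (fun g => a.toFun g *
      haarInt K (fun h => b.toFun h * c.toFun (h⁻¹ * (g⁻¹ * x))))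
  have h1 : ∀ g, a.toFun g * haarInt K (fun h => b.toFun h * c.toFun (h⁻¹ * (g⁻¹ * x))) =
      haarInt K (fun h => a.toFun g * b.toFun (g⁻¹ * h) * c.toFun (h⁻¹ * x)) := by
    intro g
    rw [← haarInt_mul_left K _ g⁻¹, ← haarInt_const_mul]
    congr 1
    ext h
    rw [mul_assoc]
    congr 3
    group
  have h2 : ∀ h, haarInt K (fun g => a.toFun g * b.toFun (g⁻¹ * h)) * c.toFun (h⁻¹ * x) =
      haarInt K (fun g => a.toFun g * b.toFun (g⁻¹ * h) * c.toFun (h⁻¹ * x)) := by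
    intro h
    rw [mul_comm, ← haarInt_const_mul]
    congr 1
    ext g
    ring
  simp only [h1, h2]
  symm
  apply haarInt_swap
  · have ha := a.continuous
    have hb := b.continuous
    have hc := c.continuous
    exact ((ha.comp continuous_fst).mul
      (hb.comp (continuous_fst.inv.mul continuous_snd))).mul
        (hc.comp (continuous_snd.inv.mul continuous_const))
  · refine HasCompactSupport.of_support_subset_isCompact
      ((a.hasCompactSupport.isCompact.prod b.hasCompactSupport.isCompact).image
        (f := fun z : Γ × Γ => (z.1, z.1 * z.2)) (by fun_prop)) ?_
    rintro ⟨g, h⟩ hx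
    have hx' : a.toFun g * b.toFun (g⁻¹ * h) * c.toFun (h⁻¹ * x) ≠ 0 := hx
    have h3 := left_ne_zero_of_mul hx'
    exact ⟨(g, g⁻¹ * h), ⟨subset_tsupport _ (left_ne_zero_of_mul h3),
      subset_tsupport _ (right_ne_zero_of_mul h3)⟩, by simp⟩

/-- The Hecke algebra is a (unital, associative) ring under convolution. -/
noncomputable instance : Ring (Hecke K) :=
  { (inferInstance : AddCommGroup (Hecke K)) with
    mul := (· * ·)
    one := 1
    mul_assoc := hecke_mul_assoc
    one_mul := hecke_one_mul
    mul_one := hecke_mul_one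
    left_distrib := fun a b c => by
      apply Hecke.ext
      ext x
      have : (fun g => a.toFun g * (b + c).toFun (g⁻¹ * x)) = fun g =>
          a.toFun g * b.toFun (g⁻¹ * x) + a.toFun g * c.toFun (g⁻¹ * x) := by
        ext g
        rw [Hecke.toFun_add, Pi.add_apply, mul_add]
      change haarInt K (fun g => a.toFun g * (b + c).toFun (g⁻¹ * x)) = _
      rw [this]
      exact haarInt_add K (a.conv_continuous b x) (a.conv_support b x) (a.conv_continuous c x)
        (a.conv_support c x)
    right_distrib := fun a b c => by
      apply Hecke.ext
      ext x
      have : (fun g => (a + b).toFun g * c.toFun (g⁻¹ * x)) = fun g =>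
          a.toFun g * c.toFun (g⁻¹ * x) + b.toFun g * c.toFun (g⁻¹ * x) := by
        ext g
        rw [Hecke.toFun_add, Pi.add_apply, add_mul]
      change haarInt K (fun g => (a + b).toFun g * c.toFun (g⁻¹ * x)) = _
      rw [this]
      exact haarInt_add K (a.conv_continuous c x) (a.conv_support c x) (b.conv_continuous c x)
        (b.conv_support c x)
    zero_mul := fun a => by
      apply Hecke.ext
      ext x
      change haarInt K (fun g => (0 : Hecke K).toFun g * a.toFun (g⁻¹ * x)) = 0
      simp [Hecke.toFun_zero, haarInt_zero]
    mul_zero := fun a => by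
      apply Hecke.ext
      ext x
      change haarInt K (fun g => a.toFun g * (0 : Hecke K).toFun (g⁻¹ * x)) = 0
      simp [Hecke.toFun_zero, haarInt_zero] }

/-- The Hecke algebra is a `ℂ`-algebra. -/
noncomputable instance : Algebra ℂ (Hecke K) :=
  Algebra.ofModule
    (fun c a b => by
      apply Hecke.ext
      ext x
      change haarInt K (fun g => (c • a).toFun g * b.toFun (g⁻¹ * x)) =
        c * haarInt K (fun g => a.toFun g * b.toFun (g⁻¹ * x))
      rw [← haarInt_const_mul]
      simp only [Hecke.toFun_smul, Pi.smul_apply, smul_eq_mul, mul_assoc])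
    (fun c a b => by
      apply Hecke.ext
      ext x
      change haarInt K (fun g => a.toFun g * (c • b).toFun (g⁻¹ * x)) =
        c * haarInt K (fun g => a.toFun g * b.toFun (g⁻¹ * x))
      rw [← haarInt_const_mul]
      simp only [Hecke.toFun_smul, Pi.smul_apply, smul_eq_mul, mul_left_comm])

theorem rightAct_continuous (θ : Hecke K) (ξ : CcRight K) (x : Γ) :
    Continuous (fun g => θ.toFun g * ξ.toFun (x * g)) :=
  θ.continuous.mul (ξ.continuous.comp (by fun_prop))

theorem rightAct_support (θ : Hecke K) (ξ : CcRight K) (x : Γ) :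
    HasCompactSupport (fun g => θ.toFun g * ξ.toFun (x * g)) :=
  θ.hasCompactSupport.mul_right

variable (K) in
/-- The action of the Hecke algebra on `C_c^∞(Γ/K)` induced by right translation,
`(θ · ξ)(x) = ∫ θ(g) ξ(xg) dg`. -/
noncomputable def heckeAct : Hecke K →+* Module.End ℂ (CcRight K) where
  toFun θ :=
    { toFun := fun ξ => ⟨rightAct K θ.toFun ξ.toFun, rightAct_mem θ ξ⟩
      map_add' := fun ξ ξ' => by
        apply CcRight.ext
        ext x
        have : (fun g => θ.toFun g * (ξ + ξ').toFun (x * g)) = fun g =>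
            θ.toFun g * ξ.toFun (x * g) + θ.toFun g * ξ'.toFun (x * g) := by
          ext g
          rw [← mul_add]
          rfl
        change haarInt K (fun g => θ.toFun g * (ξ + ξ').toFun (x * g)) = _
        rw [this]
        exact haarInt_add K (rightAct_continuous θ ξ x) (rightAct_support θ ξ x)
          (rightAct_continuous θ ξ' x) (rightAct_support θ ξ' x)
      map_smul' := fun c ξ => by
        apply CcRight.ext
        ext x
        change haarInt K (fun g => θ.toFun g * (c * ξ.toFun (x * g))) =
          c * haarInt K (fun g => θ.toFun g * ξ.toFun (x * g))
        rw [← haarInt_const_mul]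
        simp only [mul_left_comm] }
  map_one' := by
    apply LinearMap.ext
    intro ξ
    apply CcRight.ext
    ext x
    exact haarInt_one_mul (fun k hk => ξ.mul_right x hk)
  map_zero' := by
    apply LinearMap.ext
    intro ξ
    apply CcRight.ext
    ext x
    change haarInt K (fun g => (0 : Hecke K).toFun g * ξ.toFun (x * g)) = 0
    simp [Hecke.toFun_zero, haarInt_zero]
  map_add' := fun a b => by
    apply LinearMap.ext
    intro ξ
    apply CcRight.ext
    ext x
    have : (fun g => (a + b).toFun g * ξ.toFun (x * g)) = fun g =>
        a.toFun g * ξ.toFun (x * g) + b.toFun g * ξ.toFun (x * g) := by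
      ext g
      rw [Hecke.toFun_add, Pi.add_apply, add_mul]
    change haarInt K (fun g => (a + b).toFun g * ξ.toFun (x * g)) = _
    rw [this]
    exact haarInt_add K (rightAct_continuous a ξ x) (rightAct_support a ξ x)
      (rightAct_continuous b ξ x) (rightAct_support b ξ x)
  map_mul' := fun a b => by
    apply LinearMap.ext
    intro ξ
    apply CcRight.ext
    ext x
    change haarInt K (fun h => haarInt K (fun g => a.toFun g * b.toFun (g⁻¹ * h)) *
      ξ.toFun (x * h)) = haarInt K (fun g => a.toFun g *
        haarInt K (fun h => b.toFun h * ξ.toFun (x * g * h)))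
    have h1 : ∀ g, a.toFun g * haarInt K (fun h => b.toFun h * ξ.toFun (x * g * h)) =
        haarInt K (fun h => a.toFun g * b.toFun (g⁻¹ * h) * ξ.toFun (x * h)) := by
      intro g
      rw [← haarInt_mul_left K _ g⁻¹, ← haarInt_const_mul]
      congr 1
      ext h
      rw [mul_assoc (a.toFun g), show x * g * (g⁻¹ * h) = x * h by group]
    have h2 : ∀ h, haarInt K (fun g => a.toFun g * b.toFun (g⁻¹ * h)) * ξ.toFun (x * h) =
        haarInt K (fun g => a.toFun g * b.toFun (g⁻¹ * h) * ξ.toFun (x * h)) := by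
      intro h
      rw [mul_comm, ← haarInt_const_mul]
      congr 1
      ext g
      ring
    simp only [h1, h2]
    symm
    apply haarInt_swap
    · have ha := a.continuous
      have hb := b.continuous
      have hc := ξ.continuous
      exact ((ha.comp continuous_fst).mul
        (hb.comp (continuous_fst.inv.mul continuous_snd))).mul
          (hc.comp (continuous_const.mul continuous_snd))
    · refine HasCompactSupport.of_support_subset_isCompact
        ((a.hasCompactSupport.isCompact.prod b.hasCompactSupport.isCompact).image
          (f := fun z : Γ × Γ => (z.1, z.1 * z.2)) (by fun_prop)) ?_
      rintro ⟨g, h⟩ hx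
      have hx' : a.toFun g * b.toFun (g⁻¹ * h) * ξ.toFun (x * h) ≠ 0 := hx
      have h3 := left_ne_zero_of_mul hx'
      exact ⟨(g, g⁻¹ * h), ⟨subset_tsupport _ (left_ne_zero_of_mul h3),
        subset_tsupport _ (right_ne_zero_of_mul h3)⟩, by simp⟩

end General

/-! ### Schwartz functions and the modules of coinvariants -/

section Coinvariants

variable (p : ℕ) [Fact p.Prime]

/-- The space of locally constant, compactly supported functions on `ℚ_p²`. -/
def schwartzSubmodule : Submodule ℂ ((Fin 2 → ℚ_[p]) → ℂ) where
  carrier := {φ | IsLocallyConstant φ ∧ HasCompactSupport φ}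
  zero_mem' := ⟨IsLocallyConstant.const 0, HasCompactSupport.zero⟩
  add_mem' := fun {a b} ha hb => ⟨ha.1.add hb.1, ha.2.add hb.2⟩
  smul_mem' := fun c a ha => ⟨ha.1.comp (fun z => c * z), ha.2.smul_left (f := fun _ => c)⟩

/-- `𝒮(ℚ_p²)`: the Schwartz functions, that is the locally constant, compactly supported functions,
on `ℚ_p²`, as a type. -/
def Schwartz : Type := schwartzSubmodule p

instance : AddCommGroup (Schwartz p) := inferInstanceAs (AddCommGroup (schwartzSubmodule p))

instance : Module ℂ (Schwartz p) := inferInstanceAs (Module ℂ (schwartzSubmodule p))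

variable {p} in
/-- The function on `ℚ_p²` underlying a Schwartz function. -/
def Schwartz.toFun (φ : Schwartz p) : (Fin 2 → ℚ_[p]) → ℂ := φ.1

variable {p} in
theorem Schwartz.ext {φ φ' : Schwartz p} (h : φ.toFun = φ'.toFun) : φ = φ' := Subtype.ext h

/-- The characteristic function of `ℤ_p²`. -/
noncomputable def chZp2 : Schwartz p :=
  ⟨{v : Fin 2 → ℚ_[p] | ∀ i, ‖v i‖ ≤ 1}.indicator (fun _ => 1), by
    have hpi : {v : Fin 2 → ℚ_[p] | ∀ i, ‖v i‖ ≤ 1} =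
        Set.univ.pi (fun _ => Metric.closedBall (0 : ℚ_[p]) 1) := by
      ext v
      simp
    have hcl : IsClopen {v : Fin 2 → ℚ_[p] | ∀ i, ‖v i‖ ≤ 1} := by
      rw [hpi]
      exact ⟨isClosed_set_pi (fun _ _ => Metric.isClosed_closedBall),
        isOpen_set_pi Set.finite_univ
          (fun _ _ => IsUltrametricDist.isOpen_closedBall _ one_ne_zero)⟩
    have hc : IsCompact {v : Fin 2 → ℚ_[p] | ∀ i, ‖v i‖ ≤ 1} := by
      rw [hpi]
      exact isCompact_univ_pi (fun _ => isCompact_closedBall _ _)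
    classical
    have hlc : IsLocallyConstant
        ({v : Fin 2 → ℚ_[p] | ∀ i, ‖v i‖ ≤ 1}.indicator (fun _ => (1 : ℂ))) := by
      rw [IsLocallyConstant.iff_exists_open]
      intro x
      by_cases hx : x ∈ {v : Fin 2 → ℚ_[p] | ∀ i, ‖v i‖ ≤ 1}
      · exact ⟨_, hcl.isOpen, hx, fun y hy => by
          rw [Set.indicator_of_mem hy, Set.indicator_of_mem hx]⟩
      · exact ⟨_, hcl.compl.isOpen, hx, fun y hy => by
          rw [Set.indicator_of_notMem hy, Set.indicator_of_notMem hx]⟩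
    exact ⟨hlc,
      HasCompactSupport.of_support_subset_isCompact hc Set.support_indicator_subset⟩⟩

/-- The action of `GL₂(ℚ_p)` on `𝒮(ℚ_p²)`: `(γφ)(v) = φ(vγ)`, with `v` a row vector. -/
noncomputable def schwartzRep : Representation ℂ (GL (Fin 2) ℚ_[p]) (Schwartz p) where
  toFun γ :=
    { toFun := fun φ => ⟨fun v => φ.toFun (Matrix.vecMul v γ.1), by
        have hc : ∀ δ : GL (Fin 2) ℚ_[p], Continuous (fun v => Matrix.vecMul v δ.1) :=
          fun δ => Continuous.matrix_vecMul continuous_id continuous_const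
        let e : (Fin 2 → ℚ_[p]) ≃ₜ (Fin 2 → ℚ_[p]) :=
          { toFun := fun v => Matrix.vecMul v γ.1
            invFun := fun v => Matrix.vecMul v (γ⁻¹).1
            left_inv := fun v => by
              change Matrix.vecMul (Matrix.vecMul v _) _ = v
              rw [Matrix.vecMul_vecMul, ← Units.val_mul, mul_inv_cancel, Units.val_one,
                Matrix.vecMul_one]
            right_inv := fun v => by
              change Matrix.vecMul (Matrix.vecMul v _) _ = v
              rw [Matrix.vecMul_vecMul, ← Units.val_mul, inv_mul_cancel, Units.val_one,
                Matrix.vecMul_one]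
            continuous_toFun := hc γ
            continuous_invFun := hc γ⁻¹ }
        exact ⟨φ.2.1.comp_continuous (hc γ), φ.2.2.comp_homeomorph e⟩⟩
      map_add' := fun _ _ => rfl
      map_smul' := fun _ _ => rfl }
  map_one' := by
    apply LinearMap.ext
    intro φ
    apply Schwartz.ext
    ext v
    change φ.toFun (Matrix.vecMul v (1 : Matrix (Fin 2) (Fin 2) ℚ_[p])) = φ.toFun v
    rw [Matrix.vecMul_one]
  map_mul' := fun γ δ => by
    apply LinearMap.ext
    intro φ
    apply Schwartz.ext
    ext v
    change φ.toFun (Matrix.vecMul v (γ.1 * δ.1)) =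
      φ.toFun (Matrix.vecMul (Matrix.vecMul v γ.1) δ.1)
    rw [Matrix.vecMul_vecMul]

variable {p}
variable {Γ : Type*} [Group Γ] [TopologicalSpace Γ] [IsTopologicalGroup Γ]

/-- The action of `GL₂(ℚ_p)` on `C_c^∞(Γ/K)` through `j : GL₂(ℚ_p) → Γ`:
`(γξ)(x) = ξ(j(γ)⁻¹x)`. -/
noncomputable def leftRep (K : Subgroup Γ) (j : GL (Fin 2) ℚ_[p] →* Γ) :
    Representation ℂ (GL (Fin 2) ℚ_[p]) (CcRight K) where
  toFun γ :=
    { toFun := fun ξ => ⟨fun x => ξ.toFun ((j γ)⁻¹ * x),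
        ξ.2.1.comp_continuous (f := fun x => (j γ)⁻¹ * x) (by fun_prop),
        ξ.hasCompactSupport.comp_homeomorph (Homeomorph.mulLeft (j γ)⁻¹),
        fun x k hk => by
          change ξ.toFun ((j γ)⁻¹ * (x * k)) = ξ.toFun ((j γ)⁻¹ * x)
          rw [← mul_assoc, ξ.mul_right _ hk]⟩
      map_add' := fun _ _ => rfl
      map_smul' := fun _ _ => rfl }
  map_one' := by
    apply LinearMap.ext
    intro ξ
    apply CcRight.ext
    ext x
    change ξ.toFun ((j 1)⁻¹ * x) = ξ.toFun x
    simp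
  map_mul' := fun γ δ => by
    apply LinearMap.ext
    intro ξ
    apply CcRight.ext
    ext x
    change ξ.toFun ((j (γ * δ))⁻¹ * x) = ξ.toFun ((j δ)⁻¹ * ((j γ)⁻¹ * x))
    rw [map_mul, mul_inv_rev, mul_assoc]

/-- The diagonal action `γ(φ ⊗ ξ) = φ((-)γ) ⊗ ξ(j(γ)⁻¹(-))` of `GL₂(ℚ_p)` on
`𝒮(ℚ_p²) ⊗ C_c^∞(Γ/K)`. -/
noncomputable def diagRep (K : Subgroup Γ) (j : GL (Fin 2) ℚ_[p] →* Γ) :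
    Representation ℂ (GL (Fin 2) ℚ_[p]) (Schwartz p ⊗[ℂ] CcRight K) :=
  (schwartzRep p).tprod (leftRep K j)

/-- The subspace of `𝒮(ℚ_p²) ⊗ C_c^∞(Γ/K)` spanned by the elements `γx - x`. -/
noncomputable def coinvKer (K : Subgroup Γ) (j : GL (Fin 2) ℚ_[p] →* Γ) :
    Submodule ℂ (Schwartz p ⊗[ℂ] CcRight K) :=
  Submodule.span ℂ {y | ∃ (γ : GL (Fin 2) ℚ_[p]) (x : Schwartz p ⊗[ℂ] CcRight K),
    y = diagRep K j γ x - x}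

/-- The module `ℐ(Γ/K) = (𝒮(ℚ_p²) ⊗ C_c^∞(Γ/K))_{GL₂(ℚ_p)}` of coinvariants for the diagonal
action. -/
def CoinvModule (K : Subgroup Γ) (j : GL (Fin 2) ℚ_[p] →* Γ) : Type _ :=
  (Schwartz p ⊗[ℂ] CcRight K) ⧸ coinvKer K j

noncomputable instance (K : Subgroup Γ) (j : GL (Fin 2) ℚ_[p] →* Γ) :
    AddCommGroup (CoinvModule K j) :=
  Submodule.Quotient.addCommGroup (coinvKer K j)

noncomputable instance (K : Subgroup Γ) (j : GL (Fin 2) ℚ_[p] →* Γ) :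
    Module ℂ (CoinvModule K j) :=
  Submodule.Quotient.module (coinvKer K j)

/-- The quotient map `𝒮(ℚ_p²) ⊗ C_c^∞(Γ/K) → ℐ(Γ/K)`. -/
noncomputable def CoinvModule.quot (K : Subgroup Γ) (j : GL (Fin 2) ℚ_[p] →* Γ) :
    Schwartz p ⊗[ℂ] CcRight K →ₗ[ℂ] CoinvModule K j :=
  (coinvKer K j).mkQ

theorem CoinvModule.hom_ext {K : Subgroup Γ} {j : GL (Fin 2) ℚ_[p] →* Γ} {W : Type*}
    [AddCommGroup W] [Module ℂ W] {f f' : CoinvModule K j →ₗ[ℂ] W}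
    (h : ∀ φ ξ, f (CoinvModule.quot K j (φ ⊗ₜ[ℂ] ξ)) = f' (CoinvModule.quot K j (φ ⊗ₜ[ℂ] ξ))) :
    f = f' := by
  have h2 : f ∘ₗ CoinvModule.quot K j = f' ∘ₗ CoinvModule.quot K j := by
    apply TensorProduct.ext'
    exact h
  apply LinearMap.ext
  intro x
  obtain ⟨y, rfl⟩ := Submodule.mkQ_surjective (coinvKer K j) x
  exact LinearMap.congr_fun h2 y

/-- The class of `φ ⊗ ξ` in `ℐ(Γ/K)`. -/
noncomputable def CoinvModule.mk (K : Subgroup Γ) (j : GL (Fin 2) ℚ_[p] →* Γ)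
    (φ : Schwartz p) (ξ : CcRight K) : CoinvModule K j :=
  CoinvModule.quot K j (φ ⊗ₜ[ℂ] ξ)

/-- The action of the Hecke algebra on `C_c^∞(Γ/K)` commutes with left translations. -/
theorem heckeAct_leftRep {K : Subgroup Γ} [IsOpenCompact K] (j : GL (Fin 2) ℚ_[p] →* Γ)
    (θ : Hecke K) (γ : GL (Fin 2) ℚ_[p]) (ξ : CcRight K) :
    heckeAct K θ (leftRep K j γ ξ) = leftRep K j γ (heckeAct K θ ξ) := by
  apply CcRight.ext
  ext x
  change haarInt K (fun g => θ.toFun g * ξ.toFun ((j γ)⁻¹ * (x * g))) =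
    haarInt K (fun g => θ.toFun g * ξ.toFun ((j γ)⁻¹ * x * g))
  simp only [mul_assoc]

theorem lTensor_diagRep {K : Subgroup Γ} [IsOpenCompact K] (j : GL (Fin 2) ℚ_[p] →* Γ)
    (θ : Hecke K) (γ : GL (Fin 2) ℚ_[p]) (x : Schwartz p ⊗[ℂ] CcRight K) :
    LinearMap.lTensor (Schwartz p) (heckeAct K θ) (diagRep K j γ x) =
      diagRep K j γ (LinearMap.lTensor (Schwartz p) (heckeAct K θ) x) := by
  induction x with
  | zero => simp only [map_zero]
  | add x y hx hy => simp only [map_add, hx, hy]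
  | tmul φ ξ =>
    change schwartzRep p γ φ ⊗ₜ[ℂ] heckeAct K θ (leftRep K j γ ξ) =
      schwartzRep p γ φ ⊗ₜ[ℂ] leftRep K j γ (heckeAct K θ ξ)
    rw [heckeAct_leftRep]

/-- The endomorphism of `ℐ(Γ/K)` given by a Hecke operator `θ`, induced by the action of `θ` on the
second factor of `𝒮(ℚ_p²) ⊗ C_c^∞(Γ/K)`. -/
noncomputable def heckeEnd (K : Subgroup Γ) [IsOpenCompact K]
    (j : GL (Fin 2) ℚ_[p] →* Γ) (θ : Hecke K) : Module.End ℂ (CoinvModule K j) :=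
  (coinvKer K j).mapQ (coinvKer K j) (LinearMap.lTensor (Schwartz p) (heckeAct K θ)) (by
    rw [coinvKer, Submodule.span_le]
    rintro y ⟨γ, x, rfl⟩
    apply Submodule.subset_span
    exact ⟨γ, LinearMap.lTensor (Schwartz p) (heckeAct K θ) x, by
      rw [map_sub, lTensor_diagRep]⟩)

theorem heckeEnd_quot {K : Subgroup Γ} [IsOpenCompact K] (j : GL (Fin 2) ℚ_[p] →* Γ)
    (θ : Hecke K) (φ : Schwartz p) (ξ : CcRight K) :
    heckeEnd K j θ (CoinvModule.quot K j (φ ⊗ₜ[ℂ] ξ)) =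
      CoinvModule.quot K j (φ ⊗ₜ[ℂ] heckeAct K θ ξ) := rfl

/-- The action of the Hecke algebra on `ℐ(Γ/K)`, as a ring homomorphism. -/
noncomputable def heckeActCoinv (K : Subgroup Γ) [IsOpenCompact K]
    (j : GL (Fin 2) ℚ_[p] →* Γ) : Hecke K →+* Module.End ℂ (CoinvModule K j) where
  toFun := heckeEnd K j
  map_one' := by
    apply CoinvModule.hom_ext
    intro φ ξ
    rw [heckeEnd_quot, map_one, Module.End.one_apply, Module.End.one_apply]
  map_zero' := by
    apply CoinvModule.hom_ext
    intro φ ξ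
    rw [heckeEnd_quot, map_zero, LinearMap.zero_apply, TensorProduct.tmul_zero, map_zero,
      LinearMap.zero_apply]
  map_add' := fun a b => by
    apply CoinvModule.hom_ext
    intro φ ξ
    rw [LinearMap.add_apply, heckeEnd_quot, heckeEnd_quot, heckeEnd_quot, map_add,
      LinearMap.add_apply, TensorProduct.tmul_add, map_add]
  map_mul' := fun a b => by
    apply CoinvModule.hom_ext
    intro φ ξ
    rw [Module.End.mul_apply, heckeEnd_quot, heckeEnd_quot, heckeEnd_quot, map_mul,
      Module.End.mul_apply]

/-- `ℐ(Γ/K)` as a module over the Hecke algebra `C_c^∞(K\Γ/K)`. -/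
noncomputable instance (K : Subgroup Γ) [IsOpenCompact K] (j : GL (Fin 2) ℚ_[p] →* Γ) :
    Module (Hecke K) (CoinvModule K j) :=
  Module.compHom (CoinvModule K j) (heckeActCoinv K j)

theorem CoinvModule.smul_mk (K : Subgroup Γ) [IsOpenCompact K] (j : GL (Fin 2) ℚ_[p] →* Γ)
    (θ : Hecke K) (φ : Schwartz p) (ξ : CcRight K) :
    θ • CoinvModule.mk K j φ ξ = CoinvModule.mk K j φ (heckeAct K θ ξ) := rfl

end Coinvariants

/-! ### The groups -/

section Groups

variable (p : ℕ) [Fact p.Prime] (E : Type*) [Field E] [NumberField E]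

/-- `E_p = ℚ_p ⊗_ℚ E`. -/
abbrev LocalAlg : Type _ := ℚ_[p] ⊗[ℚ] E

/-- `E_p` carries its topology as a finite-dimensional `ℚ_p`-vector space. -/
noncomputable instance : TopologicalSpace (LocalAlg p E) := moduleTopology ℚ_[p] (LocalAlg p E)

instance : IsModuleTopology ℚ_[p] (LocalAlg p E) := ⟨rfl⟩

instance : IsTopologicalRing (LocalAlg p E) :=
  IsModuleTopology.isTopologicalRing ℚ_[p] (LocalAlg p E)

/-- The natural map `ℤ_p ⊗_ℤ 𝓞_E → ℚ_p ⊗_ℚ E`. -/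
noncomputable def integralMap : ℤ_[p] ⊗[ℤ] (NumberField.RingOfIntegers E) →+* LocalAlg p E :=
  (Algebra.TensorProduct.lift
    ((Algebra.TensorProduct.includeLeftRingHom.comp
      (algebraMap ℤ_[p] ℚ_[p])).toIntAlgHom : ℤ_[p] →ₐ[ℤ] LocalAlg p E)
    ((Algebra.TensorProduct.includeRight : E →ₐ[ℚ] LocalAlg p E).toRingHom.comp
      (algebraMap (NumberField.RingOfIntegers E) E)).toIntAlgHom
    (fun _ _ => Commute.all _ _)).toRingHom

/-- `𝓞_{E,p}`, the image of `ℤ_p ⊗_ℤ 𝓞_E` in `E_p = ℚ_p ⊗_ℚ E`. -/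
noncomputable def LocalInt : Subring (LocalAlg p E) := (integralMap p E).range

/-- The basis of `E_p` over `ℚ_p` given by an integral basis of `E`. -/
noncomputable def localBasis :
    Module.Basis (Module.Free.ChooseBasisIndex ℤ (NumberField.RingOfIntegers E)) ℚ_[p]
      (LocalAlg p E) :=
  Algebra.TensorProduct.basis ℚ_[p] (NumberField.integralBasis E)

theorem integralMap_tmul (z : ℤ_[p]) (x : NumberField.RingOfIntegers E) :
    integralMap p E (z ⊗ₜ x) = (z : ℚ_[p]) ⊗ₜ[ℚ] (x : E) := by
  change ((z : ℚ_[p]) ⊗ₜ[ℚ] (1 : E)) * ((1 : ℚ_[p]) ⊗ₜ[ℚ] (x : E)) = _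
  rw [Algebra.TensorProduct.tmul_mul_tmul, one_mul, mul_one]

theorem mem_localInt_iff (x : LocalAlg p E) :
    x ∈ LocalInt p E ↔ ∀ i, ‖(localBasis p E).repr x i‖ ≤ 1 := by
  constructor
  · rintro ⟨y, rfl⟩ i
    induction y with
    | zero => simp
    | add a b ha hb =>
      rw [map_add, map_add, Finsupp.add_apply]
      exact (Padic.nonarchimedean _ _).trans (max_le ha hb)
    | tmul z x =>
      rw [integralMap_tmul]
      have h1 : (NumberField.integralBasis E).repr (x : E) i =
          ((NumberField.RingOfIntegers.basis E).repr x i : ℚ) := by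
        simp
      rw [localBasis, Algebra.TensorProduct.basis_repr_tmul]
      simp only [Finsupp.smul_apply, Finsupp.mapRange_apply, smul_eq_mul, h1]
      rw [norm_mul]
      have h2 : ‖((((NumberField.RingOfIntegers.basis E).repr x i : ℤ) : ℚ_[p]))‖ ≤ 1 :=
        Padic.norm_int_le_one _
      have h3 : algebraMap ℚ ℚ_[p] (((NumberField.RingOfIntegers.basis E).repr x i : ℤ) : ℚ) =
          (((NumberField.RingOfIntegers.basis E).repr x i : ℤ) : ℚ_[p]) := by simp
      rw [h3]
      exact mul_le_one₀ z.2 (norm_nonneg _) h2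
  · intro h
    rw [← (localBasis p E).sum_repr x]
    refine Subring.sum_mem _ (fun i _ => ?_)
    obtain ⟨z, hz⟩ : ∃ z : ℤ_[p], (z : ℚ_[p]) = (localBasis p E).repr x i := ⟨⟨_, h i⟩, rfl⟩
    refine ⟨z ⊗ₜ NumberField.RingOfIntegers.basis E i, ?_⟩
    rw [integralMap_tmul, hz]
    simp [localBasis, Algebra.smul_def]

/-- The coordinates of `E_p` with respect to an integral basis, as a homeomorphism. -/
noncomputable def localCoord : LocalAlg p E ≃ₜ
    (Module.Free.ChooseBasisIndex ℤ (NumberField.RingOfIntegers E) → ℚ_[p]) :=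
  { (localBasis p E).equivFun.toEquiv with
    continuous_toFun :=
      IsModuleTopology.continuous_of_linearMap (R := ℚ_[p]) (localBasis p E).equivFun.toLinearMap
    continuous_invFun :=
      IsModuleTopology.continuous_of_linearMap (R := ℚ_[p])
        (localBasis p E).equivFun.symm.toLinearMap }

instance : T2Space (LocalAlg p E) := (localCoord p E).isEmbedding.t2Space

theorem localInt_eq_preimage : (LocalInt p E : Set (LocalAlg p E)) =
    localCoord p E ⁻¹' Set.univ.pi (fun _ => Metric.closedBall (0 : ℚ_[p]) 1) := by
  ext x
  rw [SetLike.mem_coe, mem_localInt_iff]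
  simp only [Set.mem_preimage, Set.mem_pi, Set.mem_univ, true_imp_iff, mem_closedBall_zero_iff]
  rfl

theorem isOpen_localInt : IsOpen (LocalInt p E : Set (LocalAlg p E)) := by
  rw [localInt_eq_preimage]
  exact (isOpen_set_pi Set.finite_univ
    (fun _ _ => IsUltrametricDist.isOpen_closedBall _ one_ne_zero)).preimage
      (localCoord p E).continuous

theorem isCompact_localInt : IsCompact (LocalInt p E : Set (LocalAlg p E)) := by
  rw [localInt_eq_preimage, Homeomorph.isCompact_preimage]
  exact isCompact_univ_pi (fun _ => isCompact_closedBall _ _)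

/-- `𝒢(ℚ_p) = GL₂(E_p)`, where `𝒢 = Res_{E/ℚ} GL₂`. -/
abbrev GQp : Type _ := GL (Fin 2) (LocalAlg p E)

/-- `𝒢(ℤ_p) = GL₂(𝓞_{E,p})`: the `g ∈ GL₂(E_p)` such that both `g` and `g⁻¹` have all
entries in `𝓞_{E,p}`. -/
def GZp : Subgroup (GQp p E) where
  carrier := {g | (∀ i j, g.1 i j ∈ LocalInt p E) ∧ ∀ i j, (g⁻¹).1 i j ∈ LocalInt p E}
  one_mem' := by
    have h : ∀ i j, (1 : Matrix (Fin 2) (Fin 2) (LocalAlg p E)) i j ∈ LocalInt p E := by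
      intro i j
      rw [Matrix.one_apply]
      split_ifs
      · exact one_mem _
      · exact zero_mem _
    exact ⟨h, by rw [inv_one]; exact h⟩
  mul_mem' := fun {a b} ha hb => by
    refine ⟨fun i j => ?_, fun i j => ?_⟩
    · rw [Units.val_mul, Matrix.mul_apply]
      exact Subring.sum_mem _ (fun k _ => mul_mem (ha.1 i k) (hb.1 k j))
    · rw [mul_inv_rev, Units.val_mul, Matrix.mul_apply]
      exact Subring.sum_mem _ (fun k _ => mul_mem (hb.2 i k) (ha.2 k j))
  inv_mem' := fun {a} ha => ⟨ha.2, by rw [inv_inv]; exact ha.1⟩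

/-- `𝒢*(ℚ_p)`, where `𝒢* = 𝒢 ×_{Res_{E/ℚ} GL₁} GL₁` is the fibre product over the determinant:
the `g ∈ GL₂(E_p)` with `det g ∈ ℚ_pˣ`. -/
noncomputable def GStarQp : Subgroup (GQp p E) :=
  (Units.map (algebraMap ℚ_[p] (LocalAlg p E)).toMonoidHom).range.comap Matrix.GeneralLinearGroup.det

/-- `𝒢*(ℤ_p)`: the `g ∈ 𝒢(ℤ_p)` with `det g ∈ ℤ_pˣ`, as a subgroup of `𝒢*(ℚ_p)`. -/
noncomputable def GStarZp : Subgroup (GStarQp p E) :=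
  ((GZp p E) ⊓
    (Units.map ((algebraMap ℚ_[p] (LocalAlg p E)).comp (algebraMap ℤ_[p] ℚ_[p])).toMonoidHom
      ).range.comap Matrix.GeneralLinearGroup.det).subgroupOf (GStarQp p E)

/-- The embedding `GL₂(ℚ_p) → 𝒢(ℚ_p)`. -/
noncomputable def embG : GL (Fin 2) ℚ_[p] →* GQp p E :=
  Matrix.GeneralLinearGroup.map (algebraMap ℚ_[p] (LocalAlg p E))

/-- The embedding `GL₂(ℚ_p) → 𝒢*(ℚ_p)`. -/
noncomputable def embGStar : GL (Fin 2) ℚ_[p] →* GStarQp p E :=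
  (embG p E).codRestrict (GStarQp p E) (fun g =>
    ⟨Matrix.GeneralLinearGroup.det g, by
      apply Units.ext
      exact RingHom.map_det (algebraMap ℚ_[p] (LocalAlg p E)) g.1⟩)

theorem gZp_eq_preimage : (GZp p E : Set (GQp p E)) =
    Units.embedProduct (Matrix (Fin 2) (Fin 2) (LocalAlg p E)) ⁻¹'
      ({A | ∀ i j, A i j ∈ LocalInt p E} ×ˢ
        (MulOpposite.unop ⁻¹' {A | ∀ i j, A i j ∈ LocalInt p E})) := rfl

theorem isOpen_integralMatrices :
    IsOpen {A : Matrix (Fin 2) (Fin 2) (LocalAlg p E) | ∀ i j, A i j ∈ LocalInt p E} := by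
  simp only [Set.ofPred_forall]
  exact isOpen_iInter_of_finite (fun i => isOpen_iInter_of_finite (fun j =>
    (isOpen_localInt p E).preimage (continuous_id.matrix_elem i j)))

theorem isCompact_integralMatrices :
    IsCompact {A : Matrix (Fin 2) (Fin 2) (LocalAlg p E) | ∀ i j, A i j ∈ LocalInt p E} := by
  have := isCompact_univ_pi (X := fun _ : Fin 2 => Fin 2 → LocalAlg p E)
    (s := fun _ => Set.univ.pi (fun _ => (LocalInt p E : Set (LocalAlg p E))))
    (fun _ => isCompact_univ_pi (fun _ => isCompact_localInt p E))
  have h : {A : Matrix (Fin 2) (Fin 2) (LocalAlg p E) | ∀ i j, A i j ∈ LocalInt p E} =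
      Set.univ.pi (fun _ => Set.univ.pi (fun _ => (LocalInt p E : Set (LocalAlg p E)))) :=
    Set.ext fun A => ⟨fun hA i _ j _ => hA i j, fun hA i j => hA i trivial j trivial⟩
  rw [h]
  exact this

instance : T2Space (Matrix (Fin 2) (Fin 2) (LocalAlg p E)) :=
  inferInstanceAs (T2Space (Fin 2 → Fin 2 → LocalAlg p E))

instance : IsTopologicalGroup (GQp p E) := inferInstance

instance isOpenCompact_gZp : IsOpenCompact (GZp p E) where
  isOpen := by
    rw [gZp_eq_preimage]
    exact ((isOpen_integralMatrices p E).prod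
      ((isOpen_integralMatrices p E).preimage MulOpposite.continuous_unop)).preimage
        Units.continuous_embedProduct
  isCompact := by
    rw [gZp_eq_preimage]
    refine Units.isClosedEmbedding_embedProduct.isCompact_preimage
      ((isCompact_integralMatrices p E).prod ?_)
    exact (MulOpposite.opHomeomorph.symm.isCompact_preimage).2 (isCompact_integralMatrices p E)

theorem norm_le_one_of_mem_localInt {x : ℚ_[p]}
    (hx : algebraMap ℚ_[p] (LocalAlg p E) x ∈ LocalInt p E) : ‖x‖ ≤ 1 := by
  by_contra hlt
  push Not at hlt
  obtain ⟨i, hi⟩ : ∃ i, (localBasis p E).repr 1 i ≠ 0 := by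
    by_contra hc
    push Not at hc
    exact one_ne_zero ((localBasis p E).repr.map_eq_zero_iff.1 (Finsupp.ext hc))
  have hb : ∀ n : ℕ, ‖x‖ ^ n * ‖(localBasis p E).repr 1 i‖ ≤ 1 := by
    intro n
    have h1 := (mem_localInt_iff p E _).1 (pow_mem hx n) i
    rw [← map_pow, Algebra.algebraMap_eq_smul_one, map_smul, Finsupp.smul_apply, smul_eq_mul,
      norm_mul, norm_pow] at h1
    exact h1
  obtain ⟨n, hn⟩ := pow_unbounded_of_one_lt (‖(localBasis p E).repr 1 i‖⁻¹) hlt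
  have h2 : 0 < ‖(localBasis p E).repr 1 i‖ := norm_pos_iff.2 hi
  have h3 := mul_lt_mul_of_pos_right hn h2
  rw [inv_mul_cancel₀ h2.ne'] at h3
  exact absurd (hb n) (not_le.2 h3)

theorem det_mem_localInt {A : Matrix (Fin 2) (Fin 2) (LocalAlg p E)}
    (hA : ∀ i j, A i j ∈ LocalInt p E) : A.det ∈ LocalInt p E := by
  rw [Matrix.det_fin_two]
  exact sub_mem (mul_mem (hA 0 0) (hA 1 1)) (mul_mem (hA 0 1) (hA 1 0))

/-- `𝒢*(ℤ_p) = 𝒢*(ℚ_p) ∩ 𝒢(ℤ_p)`. -/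
theorem gStarZp_eq : GStarZp p E = (GZp p E).subgroupOf (GStarQp p E) := by
  ext g
  constructor
  · intro h
    exact h.1
  · intro h
    refine ⟨h, ?_⟩
    obtain ⟨u, hu⟩ := g.2
    have h1 : algebraMap ℚ_[p] (LocalAlg p E) u = (g.1.1).det := congrArg Units.val hu
    have h2 : algebraMap ℚ_[p] (LocalAlg p E) (u⁻¹ : ℚ_[p]ˣ) = ((g.1⁻¹).1).det := by
      have := congrArg (fun z => (z⁻¹ : (LocalAlg p E)ˣ)) hu
      rw [← map_inv, ← map_inv] at this
      exact congrArg Units.val this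
    have h3 : ‖(u : ℚ_[p])‖ ≤ 1 :=
      norm_le_one_of_mem_localInt p E (by rw [h1]; exact det_mem_localInt p E h.1)
    have h4 : ‖((u⁻¹ : ℚ_[p]ˣ) : ℚ_[p])‖ ≤ 1 :=
      norm_le_one_of_mem_localInt p E (by rw [h2]; exact det_mem_localInt p E h.2)
    refine ⟨⟨⟨u, h3⟩, ⟨(u⁻¹ : ℚ_[p]ˣ), h4⟩, ?_, ?_⟩, ?_⟩
    · apply Subtype.ext
      exact u.mul_inv
    · apply Subtype.ext
      exact u.inv_mul
    · apply Units.ext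
      exact h1

theorem isClosed_gStarQp : IsClosed (GStarQp p E : Set (GQp p E)) := by
  have hcl : IsClosed ((LinearMap.range (Algebra.linearMap ℚ_[p] (LocalAlg p E)) :
      Submodule ℚ_[p] (LocalAlg p E)) : Set (LocalAlg p E)) :=
    Submodule.closed_of_finiteDimensional _
  have hdet : Continuous (fun g : GQp p E => (g.1).det) :=
    Continuous.matrix_det Units.continuous_val
  convert hcl.preimage hdet using 1
  apply Set.ext
  intro g
  constructor
  · rintro ⟨u, hu⟩
    exact ⟨u, congrArg Units.val hu⟩
  · rintro ⟨x, hx⟩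
    have hx' : algebraMap ℚ_[p] (LocalAlg p E) x = (g.1).det := hx
    have hx0 : x ≠ 0 := by
      rintro rfl
      rw [map_zero] at hx'
      exact (Matrix.GeneralLinearGroup.det g).ne_zero hx'.symm
    exact ⟨Units.mk0 x hx0, Units.ext hx'⟩

instance isOpenCompact_gStarZp : IsOpenCompact (GStarZp p E) where
  isOpen := by
    rw [gStarZp_eq]
    exact (isOpenCompact_gZp p E).isOpen.preimage continuous_subtype_val
  isCompact := by
    rw [gStarZp_eq]
    exact (isClosed_gStarQp p E).isClosedEmbedding_subtypeVal.isCompact_preimage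
      (isOpenCompact_gZp p E).isCompact

end Groups

end AsaiHecke

/-! Write `K` for `𝒢*(ℤ_p)` and `O` for `𝓞_{E,p}`. As `p` is unramified, `O = ℤ_p ω + ℤ_p` with `ω²
= Tω - M` and `T² - 4M` a unit (`exists_quadBasis`). Identify the row vector `(a, b)` with `aω + b`,
let `σ` be the coefficient of `ω`, and put `x_n = [[p^n, ω], [0, 1]]`.

A Hecke operator `θ` sends the generator to the class of `ch(ℤ_p²) ⊗ θ(x⁻¹)`, so freeness on one
generator means that this linear map from the Hecke algebra to the coinvariants is bijective. Both
sides are described by the same data, the pairs `(n, tO)` with `p^n σ(tO) ⊆ tO` (the good lattices).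

On the side of the coinvariants, `𝒢*(ℚ_p)` is the union of the sets `GL₂(ℚ_p) x_n K`
(`QuadBasis.exists_orbit`), so the classes of `φ ⊗ ch(x_n K)` span. Such a class does not change
when `φ` is moved by the stabiliser of `x_n K`, which contains the elements of `GL₂(ℤ_p)` that are
multiplication by an element of `O` modulo `p^n`; hence the characteristic functions of good
lattices suffice (`map_mem_of_goodLattice`). On the side of the Hecke algebra, each double coset of
`K` contains some `δ x_n` whose row lattice is good (`exists_goodLattice`).

The map is triangular for these data: if `γ x_m ∈ K δ x_n K` with `ℤ_p² δ` good, then `m ≤ n`, and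
`m = n` forces `ℤ_p² γ = ℤ_p² δ` (`goodLattice_le`). Surjectivity follows by induction on `n`. For
injectivity, a pair `(n, tO)` maximal in the support of a nonzero function is detected by the
invariant functional `φ ⊗ ξ ↦ ∫ φ(vγ⁻¹) ξ(γ x_n) dγ`, where `v` is the vector of the generator `t`.

The arithmetic input is that any `a, b ∈ E_p` have a common divisor of the form `a + xb` with `x ∈
O` (`exists_gcd`), whether `E_p` is a field or splits. It gives the Cartan decomposition with
factors of determinant one, and lifts units modulo ideals.

The comparison of the two groups rests on `QuadBasis.exists_swap`: for `k ∈ 𝒢(ℤ_p)` and `g`, one has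
`kg = k₁ g k₂` with `det k₁ = 1`, so that `𝒢(ℤ_p) g 𝒢(ℤ_p) = K g 𝒢(ℤ_p)` for `g ∈ 𝒢*(ℚ_p)`.
Extending functions by right invariance to `𝒢*(ℚ_p) 𝒢(ℤ_p)`, and by zero elsewhere, then respects
integrals, convolution and the actions. This defines `ι_p` and `i_p`; restriction of functions is a
left inverse. -/

namespace AsaiHecke

/-! ### Characteristic functions of cosets and double cosets -/

section Cosets

variable {Γ : Type*} [Group Γ] [TopologicalSpace Γ] [IsTopologicalGroup Γ]
variable {K : Subgroup Γ} [hK : IsOpenCompact K]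

theorem chCoset_apply_of_mem {g x : Γ} (h : g⁻¹ * x ∈ K) : (chCoset K g).toFun x = 1 :=
  Set.indicator_of_mem (s := {x : Γ | ∃ k ∈ K, x = g * k}) (a := x) ⟨g⁻¹ * x, h, by group⟩ (fun _ => (1 : ℂ))

theorem chCoset_apply_of_notMem {g x : Γ} (h : g⁻¹ * x ∉ K) : (chCoset K g).toFun x = 0 :=
  Set.indicator_of_notMem (s := {x : Γ | ∃ k ∈ K, x = g * k})
    (a := x) (by rintro ⟨k, hk, rfl⟩; exact h (by simpa using hk)) (fun _ => (1 : ℂ))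

theorem chCoset_mul_right (g : Γ) {k : Γ} (hk : k ∈ K) : chCoset K (g * k) = chCoset K g := by
  apply CcRight.ext
  ext x
  by_cases h : g⁻¹ * x ∈ K
  · rw [chCoset_apply_of_mem h, chCoset_apply_of_mem]
    rw [mul_inv_rev, mul_assoc]
    exact K.mul_mem (K.inv_mem hk) h
  · rw [chCoset_apply_of_notMem h, chCoset_apply_of_notMem]
    intro h'
    apply h
    have := K.mul_mem hk h'
    rwa [mul_inv_rev, mul_assoc, mul_inv_cancel_left] at this

theorem chCoset_eq_of_mem {g x : Γ} (h : g⁻¹ * x ∈ K) : chCoset K x = chCoset K g := by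
  have := chCoset_mul_right (K := K) g h
  rwa [mul_inv_cancel_left] at this

theorem chCoset_out (g : Γ) : chCoset K ((g : Γ ⧸ K).out) = chCoset K g :=
  chCoset_eq_of_mem (QuotientGroup.eq.1 (QuotientGroup.out_eq' (g : Γ ⧸ K)).symm)

theorem CcRight.apply_out (ξ : CcRight K) (g : Γ) : ξ.toFun ((g : Γ ⧸ K).out) = ξ.toFun g := by
  have h : g⁻¹ * (g : Γ ⧸ K).out ∈ K :=
    QuotientGroup.eq.1 (QuotientGroup.out_eq' (g : Γ ⧸ K)).symm
  have := ξ.mul_right g h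
  rwa [mul_inv_cancel_left] at this

theorem CcRight.toFun_sum {ι : Type*} (s : Finset ι) (f : ι → CcRight K) (x : Γ) :
    (∑ i ∈ s, f i).toFun x = ∑ i ∈ s, (f i).toFun x := by
  let ev : CcRight K →+ ℂ :=
    { toFun := fun ξ => ξ.toFun x, map_zero' := rfl, map_add' := fun _ _ => rfl }
  exact map_sum ev f s

theorem CcRight.toFun_smul (c : ℂ) (ξ : CcRight K) (x : Γ) :
    (c • ξ).toFun x = c * ξ.toFun x := rfl

/-- An element of `C_c^∞(Γ/K)` is a finite combination of characteristic functions of cosets. -/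
theorem CcRight.exists_eq_sum (ξ : CcRight K) : ∃ s : Finset (Γ ⧸ K),
    (∀ x, ξ.toFun x ≠ 0 → (x : Γ ⧸ K) ∈ s) ∧
      ξ = ∑ q ∈ s, ξ.toFun q.out • chCoset K q.out := by
  classical
  have : DiscreteTopology (Γ ⧸ K) := QuotientGroup.discreteTopology hK.isOpen
  have hc := ξ.hasCompactSupport.isCompact.image
    (f := ((↑) : Γ → Γ ⧸ K)) QuotientGroup.continuous_mk
  have hfin := hc.finite_of_discrete
  have hmem : ∀ x, ξ.toFun x ≠ 0 → (x : Γ ⧸ K) ∈ hfin.toFinset := fun x hx => by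
    rw [Set.Finite.mem_toFinset]
    exact ⟨x, subset_tsupport _ hx, rfl⟩
  refine ⟨hfin.toFinset, hmem, ?_⟩
  apply CcRight.ext
  ext x
  rw [CcRight.toFun_sum]
  simp only [CcRight.toFun_smul]
  have hne : ∀ q : Γ ⧸ K, q ≠ (x : Γ ⧸ K) →
      ξ.toFun q.out * (chCoset K q.out).toFun x = 0 := by
    intro q hq
    rw [chCoset_apply_of_notMem, mul_zero]
    intro h
    exact hq (by rw [← QuotientGroup.eq.2 h, QuotientGroup.out_eq'])
  rw [Finset.sum_eq_single (x : Γ ⧸ K) (fun q _ hq => hne q hq), chCoset_out, ξ.apply_out,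
    chCoset_apply_of_mem (by simp), mul_one]
  intro hx
  rw [ξ.apply_out]
  by_contra h0
  exact hx (hmem x (left_ne_zero_of_mul h0))

theorem CcRight.induction {motive : CcRight K → Prop} (ξ : CcRight K)
    (zero : motive 0) (add : ∀ ξ ξ', motive ξ → motive ξ' → motive (ξ + ξ'))
    (smul : ∀ (c : ℂ) g, motive (c • chCoset K g)) : motive ξ := by
  obtain ⟨s, -, hs⟩ := ξ.exists_eq_sum
  rw [hs]
  clear hs
  classical
  induction s using Finset.induction_on with
  | empty => exact zero
  | insert q s hq ih =>
    rw [Finset.sum_insert hq]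
    exact add _ _ (smul _ _) ih

/-- The function `x ↦ θ(x⁻¹)` attached to an element of the Hecke algebra. -/
def heckeInv : Hecke K →ₗ[ℂ] CcRight K where
  toFun θ := ⟨fun x => θ.toFun x⁻¹, by
    have hr : ∀ g, ∀ k ∈ K, θ.toFun (g * k)⁻¹ = θ.toFun g⁻¹ := fun g k hk => by
      rw [mul_inv_rev, θ.mul_left (K.inv_mem hk)]
    exact ⟨isLocallyConstant_of_right hK.isOpen hr,
      θ.hasCompactSupport.comp_homeomorph (Homeomorph.inv Γ), hr⟩⟩
  map_add' _ _ := rfl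
  map_smul' _ _ := rfl

theorem heckeInv_apply (θ : Hecke K) (x : Γ) : (heckeInv θ).toFun x = θ.toFun x⁻¹ := rfl

/-- The substitution of `x⁻¹g` for `g` turns the integral into the average of `θ` over `x⁻¹K`, where
`θ` is constant. The orbit of the generator thus becomes the set of classes of `ch(ℤ_p²) ⊗ θ(x⁻¹)`.
-/
theorem heckeAct_chCoset_one (θ : Hecke K) : heckeAct K θ (chCoset K 1) = heckeInv θ := by
  apply CcRight.ext
  ext x
  change haarInt K (fun g => θ.toFun g * (chCoset K 1).toFun (x * g)) = θ.toFun x⁻¹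
  rw [← haarInt_mul_left K _ x⁻¹]
  have : (fun g => θ.toFun (x⁻¹ * g) * (chCoset K 1).toFun (x * (x⁻¹ * g))) =
      fun g => (1 : Hecke K).toFun g * θ.toFun (x⁻¹ * g) := by
    ext g
    rw [mul_inv_cancel_left, mul_comm, Hecke.toFun_one]
    congr 1
    by_cases hg : g ∈ K
    · rw [chCoset_apply_of_mem (by simpa using hg), Set.indicator_of_mem (by exact hg)]
    · rw [chCoset_apply_of_notMem (by simpa using hg), Set.indicator_of_notMem (by exact hg)]
  rw [this]
  exact haarInt_one_mul (fun k hk => θ.mul_right x⁻¹ hk)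

theorem chDoubleCoset_apply_of_mem {g k₁ k₂ : Γ} (h₁ : k₁ ∈ K) (h₂ : k₂ ∈ K) :
    (chDoubleCoset K g).toFun (k₁ * g * k₂) = 1 :=
  Set.indicator_of_mem (s := {x : Γ | ∃ k₁ ∈ K, ∃ k₂ ∈ K, x = k₁ * g * k₂})
    ⟨k₁, h₁, k₂, h₂, rfl⟩ (fun _ => (1 : ℂ))

theorem chDoubleCoset_apply_cases (g x : Γ) :
    (∃ k₁ ∈ K, ∃ k₂ ∈ K, x = k₁ * g * k₂) ∧ (chDoubleCoset K g).toFun x = 1 ∨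
      (¬ ∃ k₁ ∈ K, ∃ k₂ ∈ K, x = k₁ * g * k₂) ∧ (chDoubleCoset K g).toFun x = 0 := by
  by_cases h : ∃ k₁ ∈ K, ∃ k₂ ∈ K, x = k₁ * g * k₂
  · exact Or.inl ⟨h, Set.indicator_of_mem
      (s := {x : Γ | ∃ k₁ ∈ K, ∃ k₂ ∈ K, x = k₁ * g * k₂}) h (fun _ => (1 : ℂ))⟩
  · exact Or.inr ⟨h, Set.indicator_of_notMem
      (s := {x : Γ | ∃ k₁ ∈ K, ∃ k₂ ∈ K, x = k₁ * g * k₂}) h (fun _ => (1 : ℂ))⟩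

theorem haarInt_indicator_ne_zero {S : Set Γ} (hS : IsOpen S) (hc : IsCompact S)
    (hne : S.Nonempty) : haarInt K (S.indicator (fun _ => 1)) ≠ 0 := by
  let : MeasurableSpace Γ := borel Γ
  have : BorelSpace Γ := ⟨rfl⟩
  have : (normHaar K).IsHaarMeasure := Measure.isHaarMeasure_haarMeasure _
  have h2 : haarInt K (S.indicator (fun _ => 1)) = ((normHaar K).real S : ℂ) := by
    simp [haarInt, integral_indicator hS.measurableSet]
  rw [h2, Complex.ofReal_ne_zero, Measure.real]
  exact (ENNReal.toReal_pos (hS.measure_pos _ hne).ne' hc.measure_lt_top.ne).ne'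

end Cosets

/-! ### Integral matrices of size two -/

section IntegralGL

variable {R : Type*} [CommRing R]

/-- `GL₂(O)` as a subgroup of `GL₂(R)`, for a subring `O` of `R`. -/
def integralGL (O : Subring R) : Subgroup (GL (Fin 2) R) where
  carrier := {g | (∀ i j, g.1 i j ∈ O) ∧ ∀ i j, (g⁻¹).1 i j ∈ O}
  one_mem' := by
    have h : ∀ i j, (1 : Matrix (Fin 2) (Fin 2) R) i j ∈ O := by
      intro i j
      rw [Matrix.one_apply]
      split_ifs
      · exact one_mem _
      · exact zero_mem _
    exact ⟨h, by rw [inv_one]; exact h⟩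
  mul_mem' := fun {a b} ha hb => by
    refine ⟨fun i j => ?_, fun i j => ?_⟩
    · rw [Units.val_mul, Matrix.mul_apply]
      exact O.sum_mem (fun k _ => O.mul_mem (ha.1 i k) (hb.1 k j))
    · rw [mul_inv_rev, Units.val_mul, Matrix.mul_apply]
      exact O.sum_mem (fun k _ => O.mul_mem (hb.2 i k) (ha.2 k j))
  inv_mem' := fun {a} ha => ⟨ha.2, by rw [inv_inv]; exact ha.1⟩

theorem val_inv_eq_of_det_mul {g : GL (Fin 2) R} {d : R} (h : g.1.det * d = 1) :
    (g⁻¹).1 = !![d * g.1 1 1, -(d * g.1 0 1); -(d * g.1 1 0), d * g.1 0 0] := by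
  rw [Matrix.det_fin_two] at h
  have h1 : g.1 * !![d * g.1 1 1, -(d * g.1 0 1); -(d * g.1 1 0), d * g.1 0 0] = 1 := by
    ext i j
    fin_cases i <;> fin_cases j <;> simp [Matrix.mul_apply, Fin.sum_univ_two] <;>
      first | ring1 | linear_combination h
  rw [← Units.inv_mul_cancel_left g (!![d * g.1 1 1, -(d * g.1 0 1); -(d * g.1 1 0), d * g.1 0 0]),
    h1, mul_one]

/-- The inverse is `d` times the adjugate, hence integral together with `g` and `d`. -/
theorem mem_integralGL_of_det {O : Subring R} {g : GL (Fin 2) R} (hg : ∀ i j, g.1 i j ∈ O) {d : R}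
    (hd : d ∈ O) (h : g.1.det * d = 1) : g ∈ integralGL O := by
  refine ⟨hg, ?_⟩
  rw [val_inv_eq_of_det_mul h]
  intro i j
  fin_cases i <;> fin_cases j
  · exact O.mul_mem hd (hg 1 1)
  · exact O.neg_mem (O.mul_mem hd (hg 0 1))
  · exact O.neg_mem (O.mul_mem hd (hg 1 0))
  · exact O.mul_mem hd (hg 0 0)

theorem det_mem_of_integral {O : Subring R} {B : Matrix (Fin 2) (Fin 2) R}
    (hB : ∀ i j, B i j ∈ O) : B.det ∈ O := by
  rw [Matrix.det_fin_two]
  exact O.sub_mem (O.mul_mem (hB 0 0) (hB 1 1)) (O.mul_mem (hB 0 1) (hB 1 0))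

end IntegralGL

/-! ### The group `GL₂(ℤ_p)` and lattices of row vectors -/

section PadicGroup

variable (p : ℕ) [Fact p.Prime]

/-- `GL₂(ℤ_p)` as a subgroup of `GL₂(ℚ_p)`. -/
noncomputable def GL2Zp : Subgroup (GL (Fin 2) ℚ_[p]) := integralGL (PadicInt.subring p)

theorem gl2Zp_eq_preimage : (GL2Zp p : Set (GL (Fin 2) ℚ_[p])) =
    Units.embedProduct (Matrix (Fin 2) (Fin 2) ℚ_[p]) ⁻¹'
      ({A | ∀ i j, ‖A i j‖ ≤ 1} ×ˢ (MulOpposite.unop ⁻¹' {A | ∀ i j, ‖A i j‖ ≤ 1})) := rfl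

theorem integralPadicMatrices_eq : {A : Matrix (Fin 2) (Fin 2) ℚ_[p] | ∀ i j, ‖A i j‖ ≤ 1} =
    Set.univ.pi (fun _ => Set.univ.pi (fun _ => Metric.closedBall (0 : ℚ_[p]) 1)) :=
  Set.ext fun _ => ⟨fun hA i _ j _ => mem_closedBall_zero_iff.2 (hA i j),
    fun hA i j => mem_closedBall_zero_iff.1 (hA i trivial j trivial)⟩

theorem isOpen_integralPadicMatrices :
    IsOpen {A : Matrix (Fin 2) (Fin 2) ℚ_[p] | ∀ i j, ‖A i j‖ ≤ 1} := by
  rw [integralPadicMatrices_eq]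
  exact isOpen_set_pi Set.finite_univ fun _ _ => isOpen_set_pi Set.finite_univ
    fun _ _ => IsUltrametricDist.isOpen_closedBall _ one_ne_zero

theorem isCompact_integralPadicMatrices :
    IsCompact {A : Matrix (Fin 2) (Fin 2) ℚ_[p] | ∀ i j, ‖A i j‖ ≤ 1} := by
  rw [integralPadicMatrices_eq]
  exact isCompact_univ_pi fun _ => isCompact_univ_pi fun _ => isCompact_closedBall _ _

instance : T2Space (Matrix (Fin 2) (Fin 2) ℚ_[p]) :=
  inferInstanceAs (T2Space (Fin 2 → Fin 2 → ℚ_[p]))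

instance isOpenCompact_gl2Zp : IsOpenCompact (GL2Zp p) where
  isOpen := by
    rw [gl2Zp_eq_preimage]
    exact ((isOpen_integralPadicMatrices p).prod
      ((isOpen_integralPadicMatrices p).preimage MulOpposite.continuous_unop)).preimage
        Units.continuous_embedProduct
  isCompact := by
    rw [gl2Zp_eq_preimage]
    refine Units.isClosedEmbedding_embedProduct.isCompact_preimage
      ((isCompact_integralPadicMatrices p).prod ?_)
    exact (MulOpposite.opHomeomorph.symm.isCompact_preimage).2
      (isCompact_integralPadicMatrices p)

variable {p}

/-- The lattice `ℤ_p² δ` of row vectors. -/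
def rowLattice (δ : GL (Fin 2) ℚ_[p]) : Set (Fin 2 → ℚ_[p]) :=
  {v | ∀ i, ‖Matrix.vecMul v (δ⁻¹).1 i‖ ≤ 1}

theorem vecMul_inv_vecMul (v : Fin 2 → ℚ_[p]) (δ : GL (Fin 2) ℚ_[p]) :
    Matrix.vecMul (Matrix.vecMul v δ.1) (δ⁻¹).1 = v := by
  rw [Matrix.vecMul_vecMul, ← Units.val_mul, mul_inv_cancel, Units.val_one, Matrix.vecMul_one]

theorem vecMul_vecMul_inv (v : Fin 2 → ℚ_[p]) (δ : GL (Fin 2) ℚ_[p]) :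
    Matrix.vecMul (Matrix.vecMul v (δ⁻¹).1) δ.1 = v := by
  rw [Matrix.vecMul_vecMul, ← Units.val_mul, inv_mul_cancel, Units.val_one, Matrix.vecMul_one]

theorem norm_vecMul_le {v : Fin 2 → ℚ_[p]} {A : Matrix (Fin 2) (Fin 2) ℚ_[p]}
    (hv : ∀ i, ‖v i‖ ≤ 1) (hA : ∀ i j, ‖A i j‖ ≤ 1) (j : Fin 2) :
    ‖Matrix.vecMul v A j‖ ≤ 1 := by
  change ∑ k, v k * A k j ∈ PadicInt.subring p
  exact Subring.sum_mem _ (fun k _ => (PadicInt.subring p).mul_mem (hv k) (hA k j))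

theorem rowLattice_eq_of_mem {γ δ : GL (Fin 2) ℚ_[p]} (h : γ * δ⁻¹ ∈ GL2Zp p) :
    rowLattice γ = rowLattice δ := by
  have key : ∀ {γ δ : GL (Fin 2) ℚ_[p]}, γ * δ⁻¹ ∈ GL2Zp p → rowLattice γ ⊆ rowLattice δ := by
    intro γ δ h v hv i
    have := norm_vecMul_le hv h.1 i
    rwa [Matrix.vecMul_vecMul, ← Units.val_mul, inv_mul_cancel_left] at this
  refine (key h).antisymm (key ?_)
  have := (GL2Zp p).inv_mem h
  rwa [mul_inv_rev, inv_inv] at this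

/-- The vector `e_i γ` lies in `ℤ_p² γ`, and its coordinates with respect to the rows of `δ` form
the `i`-th row of `γδ⁻¹`. -/
theorem entry_norm_le_of_rowLattice_subset {γ δ : GL (Fin 2) ℚ_[p]}
    (h : rowLattice γ ⊆ rowLattice δ) (i j : Fin 2) : ‖(γ * δ⁻¹).1 i j‖ ≤ 1 := by
  have h1 : Matrix.vecMul (Pi.single i 1) γ.1 ∈ rowLattice γ := by
    intro k
    rw [vecMul_inv_vecMul, Pi.single_apply]
    split_ifs <;> simp
  have h2 := h h1 j
  rw [Matrix.vecMul_vecMul, ← Units.val_mul, Matrix.single_one_vecMul] at h2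
  exact h2

theorem mem_of_rowLattice_eq {γ δ : GL (Fin 2) ℚ_[p]}
    (h : rowLattice γ = rowLattice δ) : γ * δ⁻¹ ∈ GL2Zp p :=
  ⟨entry_norm_le_of_rowLattice_subset h.subset, by
    rw [mul_inv_rev, inv_inv]
    exact entry_norm_le_of_rowLattice_subset h.superset⟩

/-- The characteristic function of the lattice `ℤ_p² δ`. -/
noncomputable def chLattice (δ : GL (Fin 2) ℚ_[p]) : Schwartz p := schwartzRep p δ⁻¹ (chZp2 p)

theorem schwartzRep_apply (γ : GL (Fin 2) ℚ_[p]) (φ : Schwartz p) (v : Fin 2 → ℚ_[p]) :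
    (schwartzRep p γ φ).toFun v = φ.toFun (Matrix.vecMul v γ.1) := rfl

theorem chLattice_toFun (δ : GL (Fin 2) ℚ_[p]) :
    (chLattice δ).toFun = (rowLattice δ).indicator (fun _ => 1) := rfl

theorem chLattice_eq_of_mem {γ δ : GL (Fin 2) ℚ_[p]} (h : γ * δ⁻¹ ∈ GL2Zp p) :
    chLattice γ = chLattice δ := by
  apply Schwartz.ext
  rw [chLattice_toFun, chLattice_toFun, rowLattice_eq_of_mem h]

end PadicGroup

/-! ### Invariant functionals on the coinvariants -/

section Functional

variable {p : ℕ} [Fact p.Prime]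
variable {Γ : Type*} [Group Γ] [TopologicalSpace Γ] [IsTopologicalGroup Γ]
variable {K : Subgroup Γ} {j : GL (Fin 2) ℚ_[p] →* Γ}

theorem CoinvModule.mk_rep (γ : GL (Fin 2) ℚ_[p]) (φ : Schwartz p) (ξ : CcRight K) :
    CoinvModule.mk K j (schwartzRep p γ φ) (leftRep K j γ ξ) = CoinvModule.mk K j φ ξ := by
  refine (Submodule.Quotient.eq (coinvKer K j)).2 ?_
  exact Submodule.subset_span ⟨γ, φ ⊗ₜ ξ, rfl⟩

/-- `CoinvModule.mk` as a bilinear map. -/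
noncomputable def CoinvModule.mkBilin (K : Subgroup Γ) (j : GL (Fin 2) ℚ_[p] →* Γ) :
    Schwartz p →ₗ[ℂ] CcRight K →ₗ[ℂ] CoinvModule K j :=
  (TensorProduct.mk ℂ (Schwartz p) (CcRight K)).compr₂ (CoinvModule.quot K j)

theorem CoinvModule.mkBilin_apply (φ : Schwartz p) (ξ : CcRight K) :
    CoinvModule.mkBilin K j φ ξ = CoinvModule.mk K j φ ξ := rfl

theorem CoinvModule.induction {motive : CoinvModule K j → Prop} (x : CoinvModule K j)
    (zero : motive 0) (add : ∀ x y, motive x → motive y → motive (x + y))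
    (mk : ∀ φ ξ, motive (CoinvModule.mk K j φ ξ)) : motive x := by
  obtain ⟨y, rfl⟩ := Submodule.mkQ_surjective (coinvKer K j) x
  induction y with
  | zero => rw [map_zero]; exact zero
  | add a b ha hb => rw [map_add]; exact add _ _ ha hb
  | tmul φ ξ => exact mk φ ξ

/-- A bilinear map invariant under `GL₂(ℚ_p)` descends to the coinvariants. -/
noncomputable def CoinvModule.lift {W : Type*} [AddCommGroup W] [Module ℂ W]
    (f : Schwartz p →ₗ[ℂ] CcRight K →ₗ[ℂ] W)
    (hf : ∀ γ φ ξ, f (schwartzRep p γ φ) (leftRep K j γ ξ) = f φ ξ) : CoinvModule K j →ₗ[ℂ] W :=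
  (coinvKer K j).liftQ (TensorProduct.lift f) (by
    rw [coinvKer, Submodule.span_le]
    rintro y ⟨γ, x, rfl⟩
    rw [SetLike.mem_coe, LinearMap.mem_ker, map_sub, sub_eq_zero]
    induction x with
    | zero => simp
    | add a b ha hb => rw [map_add, map_add, map_add, ha, hb]
    | tmul φ ξ => exact hf γ φ ξ)

theorem Schwartz.continuous (φ : Schwartz p) : Continuous φ.toFun := φ.2.1.continuous

theorem orbitIntegrand_continuous (hj : Topology.IsClosedEmbedding j) (φ : Schwartz p)
    (ξ : CcRight K) (v : Fin 2 → ℚ_[p]) (x : Γ) :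
    Continuous (fun γ => φ.toFun (Matrix.vecMul v (γ⁻¹).1) * ξ.toFun (j γ * x)) := by
  refine (φ.continuous.comp ?_).mul (ξ.continuous.comp (hj.continuous.mul continuous_const))
  exact Continuous.matrix_vecMul continuous_const (Units.continuous_val.comp continuous_inv)

/-- The support is controlled by `ξ` alone: a closed embedding is proper, so `γ ↦ ξ(j(γ)x)` has
compact support. -/
theorem orbitIntegrand_support (hj : Topology.IsClosedEmbedding j) (φ : Schwartz p)
    (ξ : CcRight K) (v : Fin 2 → ℚ_[p]) (x : Γ) :
    HasCompactSupport
      (fun γ => φ.toFun (Matrix.vecMul v (γ⁻¹).1) * ξ.toFun (j γ * x)) := by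
  refine HasCompactSupport.mul_left ?_
  exact (ξ.hasCompactSupport.comp_homeomorph (Homeomorph.mulRight x)).comp_isClosedEmbedding hj

/-- The invariant functional `φ ⊗ ξ ↦ ∫ φ(vγ⁻¹) ξ(γx) dγ`, the integral being
over `GL₂(ℚ_p)`. -/
noncomputable def orbitIntegral (hj : Topology.IsClosedEmbedding j) (v : Fin 2 → ℚ_[p]) (x : Γ) :
    CoinvModule K j →ₗ[ℂ] ℂ :=
  CoinvModule.lift
    (LinearMap.mk₂ ℂ (fun φ ξ => haarInt (GL2Zp p)
        (fun γ => φ.toFun (Matrix.vecMul v (γ⁻¹).1) * ξ.toFun (j γ * x)))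
      (fun φ φ' ξ => by
        rw [← haarInt_add _ (orbitIntegrand_continuous hj φ ξ v x)
          (orbitIntegrand_support hj φ ξ v x) (orbitIntegrand_continuous hj φ' ξ v x)
          (orbitIntegrand_support hj φ' ξ v x)]
        congr 1
        ext γ
        exact add_mul _ _ _)
      (fun c φ ξ => by
        rw [smul_eq_mul, ← haarInt_const_mul]
        congr 1
        ext γ
        exact mul_assoc _ _ _)
      (fun φ ξ ξ' => by
        rw [← haarInt_add _ (orbitIntegrand_continuous hj φ ξ v x)
          (orbitIntegrand_support hj φ ξ v x) (orbitIntegrand_continuous hj φ ξ' v x)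
          (orbitIntegrand_support hj φ ξ' v x)]
        congr 1
        ext γ
        exact mul_add _ _ _)
      (fun c φ ξ => by
        rw [smul_eq_mul, ← haarInt_const_mul]
        congr 1
        ext γ
        exact mul_left_comm _ _ _))
    (fun γ φ ξ => by
      simp only [LinearMap.mk₂_apply]
      -- Replacing `δ` by `γδ` cancels `γ` in both factors: `(γδ)⁻¹γ = δ⁻¹` and `j(γ)⁻¹ j(γδ) =
      -- j(δ)`.
      rw [← haarInt_mul_left _ _ γ]
      congr 1
      ext δ
      change φ.toFun (Matrix.vecMul (Matrix.vecMul v ((γ * δ)⁻¹).1) γ.1) *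
        ξ.toFun ((j γ)⁻¹ * (j (γ * δ) * x)) = _
      rw [Matrix.vecMul_vecMul, ← Units.val_mul, mul_inv_rev, inv_mul_cancel_right, map_mul,
        mul_assoc (j γ), inv_mul_cancel_left])

theorem orbitIntegral_mk (hj : Topology.IsClosedEmbedding j) (v : Fin 2 → ℚ_[p]) (x : Γ)
    (φ : Schwartz p) (ξ : CcRight K) :
    orbitIntegral hj v x (CoinvModule.mk K j φ ξ) = haarInt (GL2Zp p)
      (fun γ => φ.toFun (Matrix.vecMul v (γ⁻¹).1) * ξ.toFun (j γ * x)) := rfl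

variable [hK : IsOpenCompact K]

theorem leftRep_chCoset (γ : GL (Fin 2) ℚ_[p]) (g : Γ) :
    leftRep K j γ (chCoset K g) = chCoset K (j γ * g) := by
  apply CcRight.ext
  ext x
  change (chCoset K g).toFun ((j γ)⁻¹ * x) = _
  by_cases h : g⁻¹ * ((j γ)⁻¹ * x) ∈ K
  · rw [chCoset_apply_of_mem h, chCoset_apply_of_mem (by rwa [mul_inv_rev, mul_assoc])]
  · rw [chCoset_apply_of_notMem h, chCoset_apply_of_notMem (by rwa [mul_inv_rev, mul_assoc])]

/-- The coinvariance relation, used to reduce the coset of `j(γ)g` to that of `g` at the price of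
moving `φ`. For `φ = ch(ℤ_p²)` the moved function is that of the lattice `ℤ_p² γ`. -/
theorem CoinvModule.mk_chCoset_mul (γ : GL (Fin 2) ℚ_[p]) (φ : Schwartz p) (g : Γ) :
    CoinvModule.mk K j φ (chCoset K (j γ * g)) =
      CoinvModule.mk K j (schwartzRep p γ⁻¹ φ) (chCoset K g) := by
  rw [← CoinvModule.mk_rep γ (schwartzRep p γ⁻¹ φ), leftRep_chCoset, ← Module.End.mul_apply,
    ← map_mul, mul_inv_cancel, map_one, Module.End.one_apply]

end Functional

/-! ### Triangularity implies freeness of rank one -/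

section Abstract

variable {p : ℕ} [Fact p.Prime]
variable {Γ : Type*} [Group Γ] [TopologicalSpace Γ] [IsTopologicalGroup Γ]

/-- Representatives `x n` of `GL₂(ℚ_p)\Γ/K`, together with a family of lattices `ℤ_p² δ` for each
of them, such that the elements `δ · x n` are triangular representatives of `K\Γ/K`. -/
structure OrbitSystem (K : Subgroup Γ) [IsOpenCompact K] (j : GL (Fin 2) ℚ_[p] →* Γ)
    (x : ℕ → Γ) (Good : ℕ → GL (Fin 2) ℚ_[p] → Prop) : Prop where
  isClosedEmbedding : Topology.IsClosedEmbedding j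
  map_mem : ∀ γ ∈ GL2Zp p, j γ ∈ K
  exists_orbit : ∀ g, ∃ γ n, ∃ k ∈ K, g = j γ * x n * k
  mk_mem_span : ∀ n φ, CoinvModule.mk K j φ (chCoset K (x n)) ∈
    Submodule.span ℂ {y | ∃ δ, Good n δ ∧ y = CoinvModule.mk K j (chLattice δ) (chCoset K (x n))}
  le_of_mem : ∀ {n m δ γ k₁ k₂}, Good n δ → k₁ ∈ K → k₂ ∈ K →
    j γ * x m = k₁ * (j δ * x n) * k₂ → m ≤ n ∧ (m = n → γ * δ⁻¹ ∈ GL2Zp p)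
  exists_double : ∀ g, ∃ n δ, Good n δ ∧ ∃ k₁ ∈ K, ∃ k₂ ∈ K, g = k₁ * (j δ * x n) * k₂
  exists_vec : ∀ {n δ}, Good n δ → ∃ v ∈ rowLattice δ, ∀ δ', Good n δ' → v ∈ rowLattice δ' →
    rowLattice δ ⊆ rowLattice δ'

variable {K : Subgroup Γ} [hK : IsOpenCompact K] {j : GL (Fin 2) ℚ_[p] →* Γ}
variable {x : ℕ → Γ} {Good : ℕ → GL (Fin 2) ℚ_[p] → Prop}

/-- The map `θ ↦ θ · (ch(ℤ_p²) ⊗ ch(K))`. -/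
noncomputable def heckeOrbitMap (K : Subgroup Γ) [IsOpenCompact K]
    (j : GL (Fin 2) ℚ_[p] →* Γ) : Hecke K →ₗ[ℂ] CoinvModule K j :=
  (CoinvModule.mkBilin K j (chZp2 p)).comp heckeInv

theorem smul_mk_chCoset_one (θ : Hecke K) :
    θ • CoinvModule.mk K j (chZp2 p) (chCoset K 1) = heckeOrbitMap K j θ := by
  rw [CoinvModule.smul_mk, heckeAct_chCoset_one]
  rfl

theorem mk_chZp2_chCoset (δ : GL (Fin 2) ℚ_[p]) (g : Γ) :
    CoinvModule.mk K j (chZp2 p) (chCoset K (j δ * g)) =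
      CoinvModule.mk K j (chLattice δ) (chCoset K g) :=
  CoinvModule.mk_chCoset_mul δ (chZp2 p) g

/-- With `y = δ x_n`, the operator `ch(K y⁻¹ K)` sends the generator to `ch(ℤ_p²) ⊗ ch(KyK)`, a sum
over the cosets contained in `KyK`. By triangularity each coset contributes either the class `b`
itself or a class of smaller index, which is in the range by induction. A positive multiple of `b`
is therefore in the range. -/
theorem OrbitSystem.chLattice_mem_range (H : OrbitSystem K j x Good) {n : ℕ}
    (ih : ∀ m < n, ∀ φ, CoinvModule.mk K j φ (chCoset K (x m)) ∈ LinearMap.range (heckeOrbitMap K j))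
    {δ : GL (Fin 2) ℚ_[p]} (hδ : Good n δ) :
    CoinvModule.mk K j (chLattice δ) (chCoset K (x n)) ∈ LinearMap.range (heckeOrbitMap K j) := by
  classical
  set W := LinearMap.range (heckeOrbitMap K j) with hW
  set b := CoinvModule.mk K j (chLattice δ) (chCoset K (x n)) with hb
  set y := j δ * x n with hy
  obtain ⟨s, hs, hsum⟩ := (heckeInv (chDoubleCoset K y⁻¹)).exists_eq_sum
  have h0 : (heckeInv (chDoubleCoset K y⁻¹)).toFun y = 1 := by
    rw [heckeInv_apply]
    simpa using chDoubleCoset_apply_of_mem (g := y⁻¹) K.one_mem K.one_mem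
  have hq0 : (y : Γ ⧸ K) ∈ s := hs y (by rw [h0]; exact one_ne_zero)
  -- The integer `a` is `1` where the coset contributes `b`, and `0` where its contribution is in
  -- the range by induction or vanishes. The coset of `y` has `a = 1`, which keeps the total
  -- positive.
  have hterm : ∀ q ∈ s, ∃ a : ℕ, (q = (y : Γ ⧸ K) → a = 1) ∧
      (heckeInv (chDoubleCoset K y⁻¹)).toFun q.out •
        CoinvModule.mk K j (chZp2 p) (chCoset K q.out) - (a : ℂ) • b ∈ W := by
    intro q _
    by_cases hq : q = (y : Γ ⧸ K)
    · refine ⟨1, fun _ => rfl, ?_⟩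
      rw [hq, CcRight.apply_out, h0, chCoset_out, hy, mk_chZp2_chCoset, Nat.cast_one, sub_self]
      exact W.zero_mem
    · rcases chDoubleCoset_apply_cases (K := K) y⁻¹ q.out⁻¹ with ⟨⟨k₁, h₁, k₂, h₂, h⟩, hv⟩ | ⟨-, hv⟩
      · have hout : q.out = k₂⁻¹ * y * k₁⁻¹ := by
          rw [← inv_inv q.out, h]
          group
        obtain ⟨γ, m, k, hk, hγ⟩ := H.exists_orbit q.out
        have hmk : CoinvModule.mk K j (chZp2 p) (chCoset K q.out) =
            CoinvModule.mk K j (chLattice γ) (chCoset K (x m)) := by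
          rw [hγ, chCoset_mul_right _ hk, mk_chZp2_chCoset]
        obtain ⟨hle, heq⟩ := H.le_of_mem (k₁ := k₂⁻¹) (k₂ := k₁⁻¹ * k⁻¹) (m := m) (γ := γ) hδ
          (K.inv_mem h₂) (K.mul_mem (K.inv_mem h₁) (K.inv_mem hk)) (by
            rw [← mul_assoc, ← hy, ← hout, hγ]
            group)
        rw [heckeInv_apply, hv, one_smul, hmk]
        rcases hle.lt_or_eq with hlt | rfl
        · exact ⟨0, fun h' => absurd h' hq, by
            rw [Nat.cast_zero, zero_smul, sub_zero]
            exact ih m hlt _⟩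
        · exact ⟨1, fun h' => absurd h' hq, by
            rw [chLattice_eq_of_mem (heq rfl), Nat.cast_one, one_smul, sub_self]
            exact W.zero_mem⟩
      · refine ⟨0, fun h' => absurd h' hq, ?_⟩
        rw [heckeInv_apply, hv, zero_smul, Nat.cast_zero, zero_smul, sub_zero]
        exact W.zero_mem
  choose! a ha ha' using hterm
  have h1 : heckeOrbitMap K j (chDoubleCoset K y⁻¹) = ∑ q ∈ s,
      (heckeInv (chDoubleCoset K y⁻¹)).toFun q.out •
        CoinvModule.mk K j (chZp2 p) (chCoset K q.out) := by
    change CoinvModule.mkBilin K j (chZp2 p) (heckeInv (chDoubleCoset K y⁻¹)) = _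
    conv_lhs => rw [hsum]
    simp only [map_sum, map_smul, CoinvModule.mkBilin_apply]
  have h2 : (((∑ q ∈ s, a q : ℕ) : ℂ)) • b ∈ W := by
    have h3 := W.sub_mem (LinearMap.mem_range_self (heckeOrbitMap K j) (chDoubleCoset K y⁻¹))
      (W.sum_mem ha')
    rw [h1, ← Finset.sum_sub_distrib] at h3
    simpa [Finset.sum_smul] using h3
  refine (W.smul_mem_iff ?_).1 h2
  rw [Nat.cast_ne_zero]
  intro h3
  have h4 := Finset.sum_eq_zero_iff.1 h3 _ hq0
  rw [ha _ hq0 rfl] at h4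
  exact one_ne_zero h4

theorem OrbitSystem.mk_mem_range (H : OrbitSystem K j x Good) (n : ℕ) (φ : Schwartz p) :
    CoinvModule.mk K j φ (chCoset K (x n)) ∈ LinearMap.range (heckeOrbitMap K j) := by
  induction n using Nat.strong_induction_on generalizing φ with
  | _ n ih =>
    refine Submodule.span_le.2 ?_ (H.mk_mem_span n φ)
    rintro _ ⟨δ, hδ, rfl⟩
    exact H.chLattice_mem_range ih hδ

theorem OrbitSystem.surjective (H : OrbitSystem K j x Good) :
    Function.Surjective (heckeOrbitMap K j) := by
  rw [← LinearMap.range_eq_top, Submodule.eq_top_iff']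
  intro z
  induction z using CoinvModule.induction with
  | zero => exact Submodule.zero_mem _
  | add a b ha hb => exact Submodule.add_mem _ ha hb
  | mk φ ξ =>
    rw [← CoinvModule.mkBilin_apply]
    induction ξ using CcRight.induction with
    | zero => rw [map_zero]; exact Submodule.zero_mem _
    | add ξ ξ' h h' => rw [map_add]; exact Submodule.add_mem _ h h'
    | smul c g =>
      rw [map_smul]
      refine Submodule.smul_mem _ c ?_
      obtain ⟨γ, n, k, hk, rfl⟩ := H.exists_orbit g
      rw [CoinvModule.mkBilin_apply, chCoset_mul_right _ hk, CoinvModule.mk_chCoset_mul]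
      exact H.mk_mem_range n _

/-- Triangularity applied in both directions. A function supported on finitely many cosets thus
meets only finitely many pairs of an index and a good lattice. -/
theorem OrbitSystem.rowLattice_eq_of_coset (H : OrbitSystem K j x Good) {n m : ℕ}
    {δ δ' : GL (Fin 2) ℚ_[p]} (hδ : Good n δ) (hδ' : Good m δ')
    (h : ((j δ * x n : Γ) : Γ ⧸ K) = (j δ' * x m : Γ)) :
    n = m ∧ (n = m → rowLattice δ = rowLattice δ') := by
  have h1 : (j δ * x n)⁻¹ * (j δ' * x m) ∈ K := QuotientGroup.eq.1 h
  obtain ⟨h2, h3⟩ := H.le_of_mem hδ K.one_mem h1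
    (show j δ' * x m = 1 * (j δ * x n) * ((j δ * x n)⁻¹ * (j δ' * x m)) by group)
  obtain ⟨h4, -⟩ := H.le_of_mem hδ' K.one_mem (K.inv_mem h1)
    (show j δ * x n = 1 * (j δ' * x m) * ((j δ * x n)⁻¹ * (j δ' * x m))⁻¹ by group)
  exact ⟨h4.antisymm h2, fun e => (rowLattice_eq_of_mem (h3 e.symm)).symm⟩

/-- A nonzero left invariant function in `C_c^∞(Γ/K)` does not vanish at some `δ · x n`
for which both `n` and the lattice of `δ` are maximal. -/
theorem OrbitSystem.exists_maximal (H : OrbitSystem K j x Good) {ξ : CcRight K}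
    (hξ : ∀ k ∈ K, ∀ g, ξ.toFun (k * g) = ξ.toFun g) {g : Γ} (hg : ξ.toFun g ≠ 0) :
    ∃ n δ, Good n δ ∧ ξ.toFun (j δ * x n) ≠ 0 ∧
      (∀ m δ', Good m δ' → ξ.toFun (j δ' * x m) ≠ 0 → m ≤ n) ∧
      ∀ δ', Good n δ' → ξ.toFun (j δ' * x n) ≠ 0 → rowLattice δ ⊆ rowLattice δ' →
        rowLattice δ' = rowLattice δ := by
  obtain ⟨s, hs, -⟩ := ξ.exists_eq_sum
  let N : Set ℕ := {n | ∃ δ, Good n δ ∧ ξ.toFun (j δ * x n) ≠ 0}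
  have hN : N.Nonempty := by
    obtain ⟨n, δ, hδ, k₁, h₁, k₂, h₂, rfl⟩ := H.exists_double g
    exact ⟨n, δ, hδ, by rwa [ξ.mul_right _ h₂, hξ _ h₁] at hg⟩
  have hNf : N.Finite := by
    have hc : ∀ n, ∃ δ, n ∈ N → Good n δ ∧ ξ.toFun (j δ * x n) ≠ 0 := fun n => by
      by_cases hn : n ∈ N
      · exact ⟨hn.choose, fun _ => hn.choose_spec⟩
      · exact ⟨1, fun h => absurd h hn⟩
    choose D hD using hc
    -- Distinct indices give distinct cosets, so `N` embeds in the finite set of cosets meeting the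
    -- support. The lattices are treated in the same way below.
    refine Set.Finite.of_injOn (f := fun n => ((j (D n) * x n : Γ) : Γ ⧸ K)) (t := s)
      (fun n hn => hs _ (hD n hn).2) ?_ s.finite_toSet
    intro n hn m hm h
    exact (H.rowLattice_eq_of_coset (hD n hn).1 (hD m hm).1 h).1
  obtain ⟨n, hn, hmax⟩ := Set.exists_max_image N id hNf hN
  let T : Set (Set (Fin 2 → ℚ_[p])) :=
    {Λ | ∃ δ, rowLattice δ = Λ ∧ Good n δ ∧ ξ.toFun (j δ * x n) ≠ 0}
  have hT : T.Nonempty := hn.elim fun δ h => ⟨_, δ, rfl, h⟩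
  have hTf : T.Finite := by
    have hc : ∀ Λ, ∃ δ, Λ ∈ T → rowLattice δ = Λ ∧ Good n δ ∧ ξ.toFun (j δ * x n) ≠ 0 := fun Λ => by
      by_cases hn : Λ ∈ T
      · exact ⟨hn.choose, fun _ => hn.choose_spec⟩
      · exact ⟨1, fun h => absurd h hn⟩
    choose D hD using hc
    refine Set.Finite.of_injOn (f := fun Λ => ((j (D Λ) * x n : Γ) : Γ ⧸ K)) (t := s)
      (fun Λ h => hs _ (hD Λ h).2.2) ?_ s.finite_toSet
    intro Λ h Λ' h' e
    rw [← (hD Λ h).1, ← (hD Λ' h').1]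
    exact (H.rowLattice_eq_of_coset (hD Λ h).2.1 (hD Λ' h').2.1 e).2 rfl
  obtain ⟨_, ⟨δ, rfl, hδ, hδ0⟩, hmax'⟩ := hTf.exists_maximal hT
  exact ⟨n, δ, hδ, hδ0, fun m δ' h h' => hmax m ⟨δ', h, h'⟩,
    fun δ' h h' hle => (hmax' ⟨δ', rfl, h, h'⟩ hle).antisymm hle⟩

/-- Let `ξ(x) = θ(x⁻¹)` and choose `(n, δ)` maximal with `ξ(δ x_n) ≠ 0`. The functional attached to
`x_n` and to the vector `v` of `exists_vec` sees only those `γ` with `v ∈ ℤ_p² γ` and `ξ(γ x_n) ≠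
0`. Maximality leaves only the coset `GL₂(ℤ_p) δ`, so its value is `ξ(δ x_n)` times a positive
volume. -/
theorem OrbitSystem.injective (H : OrbitSystem K j x Good) :
    Function.Injective (heckeOrbitMap K j) := by
  classical
  rw [injective_iff_map_eq_zero]
  intro θ hθ
  by_contra hne
  obtain ⟨g, hg⟩ : ∃ g, θ.toFun g ≠ 0 := by
    by_contra hc
    push Not at hc
    exact hne (Hecke.ext (funext hc))
  set ξ := heckeInv θ with hξ
  have hξl : ∀ k ∈ K, ∀ g, ξ.toFun (k * g) = ξ.toFun g := fun k hk g => by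
    rw [hξ, heckeInv_apply, heckeInv_apply, mul_inv_rev, θ.mul_right _ (K.inv_mem hk)]
  obtain ⟨n, δ, hδ, hδ0, hn, hmax⟩ := H.exists_maximal hξl
    (g := g⁻¹) (by rwa [hξ, heckeInv_apply, inv_inv])
  obtain ⟨v, hv, hvec⟩ := H.exists_vec hδ
  have hint : orbitIntegral H.isClosedEmbedding v (x n)
      (CoinvModule.mk K j (chZp2 p) ξ) = 0 := by
    change orbitIntegral H.isClosedEmbedding v (x n) (heckeOrbitMap K j θ) = 0
    rw [hθ, map_zero]
  rw [orbitIntegral_mk] at hint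
  let S : Set (GL (Fin 2) ℚ_[p]) := (fun γ => γ * δ⁻¹) ⁻¹' (GL2Zp p)
  have hS : (fun γ : GL (Fin 2) ℚ_[p] => (chZp2 p).toFun (Matrix.vecMul v (γ⁻¹).1) *
      ξ.toFun (j γ * x n)) = fun γ => ξ.toFun (j δ * x n) * S.indicator (fun _ => 1) γ := by
    ext γ
    change (rowLattice γ).indicator (fun _ => 1) v * _ = _
    by_cases hγ : γ ∈ S
    · have h1 : γ * δ⁻¹ ∈ GL2Zp p := hγ
      rw [Set.indicator_of_mem hγ, rowLattice_eq_of_mem h1, Set.indicator_of_mem hv, one_mul,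
        mul_one, ← hξl _ (H.map_mem _ h1) (j δ * x n), ← mul_assoc, ← map_mul,
        inv_mul_cancel_right]
    · rw [Set.indicator_of_notMem hγ, mul_zero]
      by_contra h0
      have hvγ : v ∈ rowLattice γ := by
        by_contra hc
        rw [Set.indicator_of_notMem hc, zero_mul] at h0
        exact h0 rfl
      have hγ0 : ξ.toFun (j γ * x n) ≠ 0 := right_ne_zero_of_mul h0
      -- Pass to the good representative of the double coset of `γ x_n`. Triangularity gives `n ≤
      -- m`, maximality of the index gives `m ≤ n`, hence `γ` and `δ'` have the same lattice; it
      -- contains `v`, so it contains the lattice of `δ`, and maximality of the latter gives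
      -- equality.
      obtain ⟨m, δ', hδ', k₁, h₁, k₂, h₂, e⟩ := H.exists_double (j γ * x n)
      have hδ'0 : ξ.toFun (j δ' * x m) ≠ 0 := by
        rwa [e, ξ.mul_right _ h₂, hξl _ h₁] at hγ0
      obtain ⟨h3, h4⟩ := H.le_of_mem hδ' h₁ h₂ e
      obtain rfl : n = m := h3.antisymm (hn m δ' hδ' hδ'0)
      have h5 := rowLattice_eq_of_mem (h4 rfl)
      have h6 := hmax δ' hδ' hδ'0 (hvec δ' hδ' (h5 ▸ hvγ))
      exact hγ (mem_of_rowLattice_eq (h5.trans h6))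
  rw [hS, haarInt_const_mul] at hint
  refine (mul_ne_zero hδ0 (haarInt_indicator_ne_zero ?_ ?_ ⟨δ, ?_⟩)) hint
  · exact (isOpenCompact_gl2Zp p).isOpen.preimage (by fun_prop)
  · exact (Homeomorph.mulRight δ⁻¹).isCompact_preimage.2 (isOpenCompact_gl2Zp p).isCompact
  · change δ * δ⁻¹ ∈ GL2Zp p
    rw [mul_inv_cancel]
    exact (GL2Zp p).one_mem

theorem OrbitSystem.existsUnique_smul (H : OrbitSystem K j x Good) (z : CoinvModule K j) :
    ∃! P : Hecke K, P • CoinvModule.mk K j (chZp2 p) (chCoset K 1) = z := by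
  simp only [smul_mk_chCoset_one]
  exact (Function.bijective_iff_existsUnique _).1 ⟨H.injective, H.surjective⟩ z

theorem OrbitSystem.span_eq_top (H : OrbitSystem K j x Good) :
    Submodule.span (Hecke K) {CoinvModule.mk K j (chZp2 p) (chCoset K 1)} = ⊤ := by
  rw [Submodule.eq_top_iff']
  intro z
  obtain ⟨P, hP, -⟩ := H.existsUnique_smul z
  exact Submodule.mem_span_singleton.2 ⟨P, hP⟩

theorem OrbitSystem.free (H : OrbitSystem K j x Good) :
    Module.Free (Hecke K) (CoinvModule K j) := by
  refine Module.Free.of_equiv (LinearEquiv.ofBijective (LinearMap.toSpanSingleton (Hecke K)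
    (CoinvModule K j) (CoinvModule.mk K j (chZp2 p) (chCoset K 1))) ?_)
  exact (Function.bijective_iff_existsUnique _).2 H.existsUnique_smul

end Abstract

/-! ### Extension of functions from a closed subgroup -/

section Extension

variable {Γ : Type*} [Group Γ] [TopologicalSpace Γ] [IsTopologicalGroup Γ]

/-- Compatibility of open compact subgroups `Ks ≤ Γs` and `K ≤ Γ`, where `Γs ≤ Γ`: the subgroup `Ks`
is `Γs ∩ K`, and every double coset `KgK` with `g ∈ Γs` is `Ks g K`. -/
structure IsHeckePair (K : Subgroup Γ) (Γs : Subgroup Γ) (Ks : Subgroup Γs) : Prop where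
  mem_iff : ∀ g : Γs, g ∈ Ks ↔ (g : Γ) ∈ K
  isClosed : IsClosed (Γs : Set Γ)
  exists_swap : ∀ k ∈ K, ∀ g : Γs, ∃ k₁ ∈ Ks, ∃ k₂ ∈ K, k * (g : Γ) = k₁ * g * k₂

variable {K : Subgroup Γ} {Γs : Subgroup Γ} {Ks : Subgroup Γs}

open Classical in
/-- Extension of a right `Ks`-invariant function on `Γs` to a right `K`-invariant function on `Γ`
which vanishes outside `Γs K`. -/
noncomputable def extFun (K : Subgroup Γ) {Γs : Subgroup Γ} (f : Γs → ℂ) (x : Γ) : ℂ :=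
  if h : ∃ g : Γs, (g : Γ)⁻¹ * x ∈ K then f h.choose else 0

/-- Two choices of the element of `Γs` differ by an element of `Γs ∩ K = Ks`, so the value does not
depend on the choice made in `extFun`. -/
theorem IsHeckePair.extFun_mul (H : IsHeckePair K Γs Ks) {f : Γs → ℂ}
    (hf : ∀ g, ∀ k ∈ Ks, f (g * k) = f g) (g : Γs) {k : Γ} (hk : k ∈ K) :
    extFun K f (g * k) = f g := by
  have h : ∃ g' : Γs, (g' : Γ)⁻¹ * (g * k) ∈ K := ⟨g, by rwa [inv_mul_cancel_left]⟩
  rw [extFun, dif_pos h]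
  have h1 := h.choose_spec
  set g' := h.choose
  have h2 : g⁻¹ * g' ∈ Ks := by
    rw [H.mem_iff]
    have := K.mul_mem hk (K.inv_mem h1)
    simpa [mul_assoc] using this
  rw [← hf g _ h2, mul_inv_cancel_left]

theorem IsHeckePair.extFun_coe (H : IsHeckePair K Γs Ks) {f : Γs → ℂ}
    (hf : ∀ g, ∀ k ∈ Ks, f (g * k) = f g) (g : Γs) : extFun K f g = f g := by
  have := H.extFun_mul hf g K.one_mem
  rwa [mul_one] at this

theorem extFun_of_not {f : Γs → ℂ} {x : Γ} (h : ¬ ∃ g : Γs, ∃ k ∈ K, x = g * k) :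
    extFun K f x = 0 := by
  rw [extFun, dif_neg]
  rintro ⟨g, hg⟩
  exact h ⟨g, _, hg, by group⟩

theorem exists_of_extFun_ne_zero {f : Γs → ℂ} {x : Γ} (h : extFun K f x ≠ 0) :
    ∃ g : Γs, ∃ k ∈ K, x = g * k := by
  by_contra hc
  exact h (extFun_of_not hc)

theorem not_exists_mul_right {x : Γ} (h : ¬ ∃ g : Γs, ∃ k ∈ K, x = g * k) {k : Γ} (hk : k ∈ K) :
    ¬ ∃ g : Γs, ∃ k' ∈ K, x * k = g * k' := by
  rintro ⟨g, k', hk', e⟩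
  exact h ⟨g, k' * k⁻¹, K.mul_mem hk' (K.inv_mem hk), by rw [← mul_assoc, ← e]; group⟩

theorem IsHeckePair.extFun_mul_right (H : IsHeckePair K Γs Ks) {f : Γs → ℂ}
    (hf : ∀ g, ∀ k ∈ Ks, f (g * k) = f g) (x : Γ) (k : Γ) (hk : k ∈ K) :
    extFun K f (x * k) = extFun K f x := by
  by_cases h : ∃ g : Γs, ∃ k ∈ K, x = g * k
  · obtain ⟨g, k', hk', rfl⟩ := h
    rw [mul_assoc, H.extFun_mul hf g hk', H.extFun_mul hf g (K.mul_mem hk' hk)]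
  · rw [extFun_of_not h, extFun_of_not (not_exists_mul_right h hk)]

/-- Functions on `Γ` supported in `Γs K` are determined by their restrictions to `Γs`. -/
theorem ext_of_coe {f f' : Γ → ℂ} (hf : ∀ x, ∀ k ∈ K, f (x * k) = f x)
    (hf' : ∀ x, ∀ k ∈ K, f' (x * k) = f' x) (h : ∀ g : Γs, f g = f' g)
    (h0 : ∀ x, (¬ ∃ g : Γs, ∃ k ∈ K, x = g * k) → f x = f' x) : f = f' := by
  ext x
  by_cases hx : ∃ g : Γs, ∃ k ∈ K, x = g * k
  · obtain ⟨g, k, hk, rfl⟩ := hx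
    rw [hf _ k hk, hf' _ k hk, h]
  · exact h0 x hx

variable [hK : IsOpenCompact K] [hKs : IsOpenCompact Ks]

theorem IsHeckePair.extFun_mem (H : IsHeckePair K Γs Ks) (ξ : CcRight Ks) :
    extFun K ξ.toFun ∈ ccRightSubmodule K := by
  have hr := H.extFun_mul_right (fun g k hk => ξ.mul_right g hk)
  refine ⟨isLocallyConstant_of_right hK.isOpen hr, ?_, hr⟩
  refine HasCompactSupport.of_support_subset_isCompact
    ((ξ.hasCompactSupport.isCompact.prod hK.isCompact).image
      (f := fun z : Γs × Γ => (z.1 : Γ) * z.2) (by fun_prop)) ?_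
  intro x hx
  obtain ⟨g, k, hk, rfl⟩ := exists_of_extFun_ne_zero hx
  refine ⟨(g, k), ⟨subset_tsupport _ ?_, hk⟩, rfl⟩
  rwa [Function.mem_support, H.extFun_mul (fun g k hk => ξ.mul_right g hk) g hk] at hx

/-- Extension from `C_c^∞(Γs/Ks)` to `C_c^∞(Γ/K)`. -/
noncomputable def IsHeckePair.ext (H : IsHeckePair K Γs Ks) : CcRight Ks →ₗ[ℂ] CcRight K where
  toFun ξ := ⟨extFun K ξ.toFun, H.extFun_mem ξ⟩
  map_add' ξ ξ' := by
    apply CcRight.ext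
    refine ext_of_coe (Γs := Γs) (CcRight.mul_right _) (CcRight.mul_right _) (fun g => ?_) (fun x hx => ?_)
    · change extFun K (ξ + ξ').toFun g = extFun K ξ.toFun g + extFun K ξ'.toFun g
      rw [H.extFun_coe (CcRight.mul_right _), H.extFun_coe (CcRight.mul_right _),
        H.extFun_coe (CcRight.mul_right _)]
      rfl
    · change extFun K (ξ + ξ').toFun x = extFun K ξ.toFun x + extFun K ξ'.toFun x
      rw [extFun_of_not hx, extFun_of_not hx, extFun_of_not hx, add_zero]
  map_smul' c ξ := by
    apply CcRight.ext
    refine ext_of_coe (Γs := Γs) (CcRight.mul_right _) (CcRight.mul_right _) (fun g => ?_) (fun x hx => ?_)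
    · change extFun K (c • ξ).toFun g = c * extFun K ξ.toFun g
      rw [H.extFun_coe (CcRight.mul_right _), H.extFun_coe (CcRight.mul_right _)]
      rfl
    · change extFun K (c • ξ).toFun x = c * extFun K ξ.toFun x
      rw [extFun_of_not hx, extFun_of_not hx, mul_zero]

theorem IsHeckePair.ext_toFun (H : IsHeckePair K Γs Ks) (ξ : CcRight Ks) :
    (H.ext ξ).toFun = extFun K ξ.toFun := rfl

theorem IsHeckePair.ext_coe (H : IsHeckePair K Γs Ks) (ξ : CcRight Ks) (g : Γs) :
    (H.ext ξ).toFun g = ξ.toFun g := H.extFun_coe (CcRight.mul_right _) g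

theorem IsHeckePair.ext_chCoset (H : IsHeckePair K Γs Ks) (g : Γs) :
    H.ext (chCoset Ks g) = chCoset K (g : Γ) := by
  apply CcRight.ext
  refine ext_of_coe (Γs := Γs) (CcRight.mul_right _) (CcRight.mul_right _) (fun x => ?_) (fun x hx => ?_)
  · rw [H.ext_coe]
    by_cases h : g⁻¹ * x ∈ Ks
    · rw [chCoset_apply_of_mem h, chCoset_apply_of_mem ((H.mem_iff _).1 h)]
    · rw [chCoset_apply_of_notMem h, chCoset_apply_of_notMem (fun h' => h ((H.mem_iff _).2 h'))]
  · rw [H.ext_toFun, extFun_of_not hx, chCoset_apply_of_notMem]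
    exact fun h => hx ⟨g, _, h, by group⟩

omit hKs in
theorem haarInt_chCoset (g : Γ) : haarInt K (chCoset K g).toFun = 1 := by
  rw [← haarInt_mul_left K _ g, ← haarInt_indicator K]
  congr 1
  ext x
  by_cases hx : x ∈ K
  · rw [chCoset_apply_of_mem (by simpa using hx), Set.indicator_of_mem (by exact hx)]
  · rw [chCoset_apply_of_notMem (by simpa using hx), Set.indicator_of_notMem (by exact hx)]

/-- Both sides are linear in `ξ`, and the two normalised measures give volume one to `gK` and to `g
Ks`. This identity makes extension compatible with convolution and with the Hecke action. -/
theorem IsHeckePair.haarInt_ext (H : IsHeckePair K Γs Ks) (ξ : CcRight Ks) :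
    haarInt K (H.ext ξ).toFun = haarInt Ks ξ.toFun := by
  induction ξ using CcRight.induction with
  | zero =>
    rw [map_zero]
    exact (haarInt_zero K).trans (haarInt_zero Ks).symm
  | add ξ ξ' h h' =>
    rw [map_add]
    change haarInt K (fun x => (H.ext ξ).toFun x + (H.ext ξ').toFun x) =
      haarInt Ks (fun x => ξ.toFun x + ξ'.toFun x)
    rw [haarInt_add K (CcRight.continuous _) (CcRight.hasCompactSupport _)
      (CcRight.continuous _) (CcRight.hasCompactSupport _),
      haarInt_add Ks (CcRight.continuous _) (CcRight.hasCompactSupport _)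
      (CcRight.continuous _) (CcRight.hasCompactSupport _), h, h']
  | smul c g =>
    rw [map_smul, H.ext_chCoset]
    change haarInt K (fun x => c * (chCoset K (g : Γ)).toFun x) =
      haarInt Ks (fun x => c * (chCoset Ks g).toFun x)
    rw [haarInt_const_mul, haarInt_const_mul, haarInt_chCoset, haarInt_chCoset]

/-- A product of an element of `C_c^∞(Γ/K)` with a right invariant function. -/
def CcRight.mulRightInv (ξ : CcRight Ks) (f : Γs → ℂ) (hf : ∀ g, ∀ k ∈ Ks, f (g * k) = f g) :
    CcRight Ks :=
  ⟨fun g => ξ.toFun g * f g, by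
    have hr : ∀ g, ∀ k ∈ Ks, ξ.toFun (g * k) * f (g * k) = ξ.toFun g * f g := fun g k hk => by
      rw [ξ.mul_right g hk, hf g k hk]
    exact ⟨isLocallyConstant_of_right hKs.isOpen hr, ξ.hasCompactSupport.mul_right, hr⟩⟩

/-- The element of `C_c^∞(Γ/K)` underlying an element of the Hecke algebra. -/
def Hecke.toCcRight (θ : Hecke Ks) : CcRight Ks := ⟨θ.toFun, θ.2.1⟩

/-- The map `C_c^∞(Ks\Γs/Ks) → C_c^∞(K\Γ/K)` given by extension of functions. -/
noncomputable def IsHeckePair.heckeExt (H : IsHeckePair K Γs Ks) : Hecke Ks →ₗ[ℂ] Hecke K where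
  toFun θ := ⟨extFun K θ.toFun, H.extFun_mem θ.toCcRight, fun k hk x => by
    by_cases hx : ∃ g : Γs, ∃ k ∈ K, x = g * k
    · obtain ⟨g, k', hk', rfl⟩ := hx
      obtain ⟨k₁, h₁, k₂, h₂, e⟩ := H.exists_swap k hk g
      rw [← mul_assoc, e, mul_assoc, ← Subgroup.coe_mul,
        H.extFun_mul (fun g k hk => θ.mul_right g hk) _ (K.mul_mem h₂ hk'),
        H.extFun_mul (fun g k hk => θ.mul_right g hk) _ hk', θ.mul_left h₁]
    · rw [extFun_of_not hx, extFun_of_not]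
      rintro ⟨g, k', hk', e⟩
      obtain ⟨k₁, h₁, k₂, h₂, e'⟩ := H.exists_swap k⁻¹ (K.inv_mem hk) g
      exact hx ⟨k₁ * g, k₂ * k', K.mul_mem h₂ hk', by
        rw [Subgroup.coe_mul, ← mul_assoc, ← e', mul_assoc, ← e, inv_mul_cancel_left]⟩⟩
  map_add' θ θ' := Hecke.ext (congrArg CcRight.toFun (H.ext.map_add θ.toCcRight θ'.toCcRight))
  map_smul' c θ := Hecke.ext (congrArg CcRight.toFun (H.ext.map_smul c θ.toCcRight))

theorem IsHeckePair.heckeExt_toFun (H : IsHeckePair K Γs Ks) (θ : Hecke Ks) :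
    (H.heckeExt θ).toFun = extFun K θ.toFun := rfl

theorem IsHeckePair.heckeExt_coe (H : IsHeckePair K Γs Ks) (θ : Hecke Ks) (g : Γs) :
    (H.heckeExt θ).toFun g = θ.toFun g := H.extFun_coe (fun g k hk => θ.mul_right g hk) g

theorem IsHeckePair.heckeExt_injective (H : IsHeckePair K Γs Ks) :
    Function.Injective H.heckeExt := fun θ θ' h => by
  apply Hecke.ext
  ext g
  rw [← H.heckeExt_coe, h, H.heckeExt_coe]

/-- By `exists_swap` the double coset `KgK` equals `Ks g K`, which is contained in `Γs K` and meets
`Γs` in `Ks g Ks`. -/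
theorem IsHeckePair.heckeExt_chDoubleCoset (H : IsHeckePair K Γs Ks) (g : Γs) :
    H.heckeExt (chDoubleCoset Ks g) = chDoubleCoset K (g : Γ) := by
  apply Hecke.ext
  have hmem : ∀ x : Γ, (∃ k₁ ∈ K, ∃ k₂ ∈ K, x = k₁ * g * k₂) →
      ∃ k₁ ∈ Ks, ∃ k₂ ∈ K, x = k₁ * g * k₂ := by
    rintro _ ⟨k₁, h₁, k₂, h₂, rfl⟩
    obtain ⟨k₃, h₃, k₄, h₄, e⟩ := H.exists_swap k₁ h₁ g
    exact ⟨k₃, h₃, k₄ * k₂, K.mul_mem h₄ h₂, by rw [e, mul_assoc]⟩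
  refine ext_of_coe (Γs := Γs) (fun x k hk => Hecke.mul_right _ x hk) (fun x k hk => Hecke.mul_right _ x hk)
    (fun x => ?_) (fun x hx => ?_)
  · rw [H.heckeExt_coe]
    rcases chDoubleCoset_apply_cases (K := K) (g : Γ) x with ⟨h, hv⟩ | ⟨h, hv⟩
    · obtain ⟨k₁, h₁, k₂, h₂, e⟩ := hmem x h
      have h3 : x = k₁ * g * ((k₁ * g)⁻¹ * x) := by group
      have h4 : (k₁ * g)⁻¹ * x ∈ Ks := by
        rw [H.mem_iff]
        simpa [e, mul_assoc] using h₂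
      rw [hv, h3, chDoubleCoset_apply_of_mem h₁ h4]
    · rcases chDoubleCoset_apply_cases (K := Ks) g x with ⟨⟨k₁, h₁, k₂, h₂, e⟩, -⟩ | ⟨-, hv'⟩
      · exact absurd ⟨k₁, (H.mem_iff _).1 h₁, k₂, (H.mem_iff _).1 h₂, by rw [e]; rfl⟩ h
      · rw [hv, hv']
  · rw [H.heckeExt_toFun, extFun_of_not hx]
    rcases chDoubleCoset_apply_cases (K := K) (g : Γ) x with ⟨h, hv⟩ | ⟨h, hv⟩
    · obtain ⟨k₁, h₁, k₂, h₂, e⟩ := hmem x h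
      exact absurd ⟨k₁ * g, k₂, h₂, e⟩ hx
    · exact hv.symm

/-- For `x ∈ Γs` the integrand on `Γ` is the extension of the integrand on `Γs`, and `haarInt_ext`
applies. Outside `Γs K` both sides vanish, because `K Γs ⊆ Γs K` makes `Γs K` stable under products.
-/
theorem IsHeckePair.heckeExt_mul (H : IsHeckePair K Γs Ks) (a b : Hecke Ks) :
    H.heckeExt (a * b) = H.heckeExt a * H.heckeExt b := by
  apply Hecke.ext
  refine ext_of_coe (Γs := Γs) (fun x k hk => Hecke.mul_right _ x hk) (fun x k hk => Hecke.mul_right _ x hk)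
    (fun x => ?_) (fun x hx => ?_)
  · rw [H.heckeExt_coe, Hecke.toFun_mul, Hecke.toFun_mul]
    let ξ := a.toCcRight.mulRightInv (fun g => b.toFun (g⁻¹ * x)) (fun g k hk => by
      rw [mul_inv_rev, mul_assoc, b.mul_left (Ks.inv_mem hk)])
    change haarInt Ks ξ.toFun = _
    rw [← H.haarInt_ext]
    change _ = haarInt K (fun g => (H.heckeExt a).toFun g * (H.heckeExt b).toFun (g⁻¹ * x))
    congr 1
    refine ext_of_coe (Γs := Γs) (CcRight.mul_right _) (fun g k hk => ?_) (fun g => ?_) (fun g hg => ?_)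
    · rw [Hecke.mul_right _ _ hk, mul_inv_rev, mul_assoc, Hecke.mul_left _ (K.inv_mem hk)]
    · rw [H.ext_coe, H.heckeExt_coe, ← Subgroup.coe_inv, ← Subgroup.coe_mul, H.heckeExt_coe]
      rfl
    · rw [H.ext_toFun, H.heckeExt_toFun, extFun_of_not hg, extFun_of_not hg, zero_mul]
  · rw [H.heckeExt_toFun, extFun_of_not hx]
    by_contra h
    obtain ⟨g, hg⟩ := exists_of_haarInt_ne_zero K (Ne.symm h)
    obtain ⟨g₁, k₁, h₁, e₁⟩ := exists_of_extFun_ne_zero (left_ne_zero_of_mul hg)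
    obtain ⟨g₂, k₂, h₂, e₂⟩ := exists_of_extFun_ne_zero (right_ne_zero_of_mul hg)
    obtain ⟨k₃, h₃, k₄, h₄, e⟩ := H.exists_swap k₁ h₁ g₂
    refine hx ⟨g₁ * (k₃ * g₂), k₄ * k₂, K.mul_mem h₄ h₂, ?_⟩
    rw [← mul_inv_cancel_left g x, e₂, e₁, Subgroup.coe_mul, Subgroup.coe_mul, mul_assoc,
      ← mul_assoc k₁, e]
    group

/-- The algebra homomorphism `C_c^∞(Ks\Γs/Ks) → C_c^∞(K\Γ/K)` given by extension. -/
noncomputable def IsHeckePair.heckeExtAlgHom (H : IsHeckePair K Γs Ks) :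
    Hecke Ks →ₐ[ℂ] Hecke K :=
  AlgHom.ofLinearMap H.heckeExt (H.heckeExt_chDoubleCoset 1) H.heckeExt_mul

/-- As for convolution: if `g` and `xg` both lie in `Γs K`, then so does `x`, by `exists_swap`. -/
theorem IsHeckePair.ext_heckeAct (H : IsHeckePair K Γs Ks) (θ : Hecke Ks) (ξ : CcRight Ks) :
    H.ext (heckeAct Ks θ ξ) = heckeAct K (H.heckeExt θ) (H.ext ξ) := by
  apply CcRight.ext
  refine ext_of_coe (Γs := Γs) (CcRight.mul_right _) (CcRight.mul_right _) (fun x => ?_) (fun x hx => ?_)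
  · rw [H.ext_coe]
    let η := θ.toCcRight.mulRightInv (fun g => ξ.toFun (x * g)) (fun g k hk => by
      rw [← mul_assoc, ξ.mul_right _ hk])
    change haarInt Ks η.toFun = _
    rw [← H.haarInt_ext]
    change _ = haarInt K (fun g => (H.heckeExt θ).toFun g * (H.ext ξ).toFun (x * g))
    congr 1
    refine ext_of_coe (Γs := Γs) (CcRight.mul_right _) (fun g k hk => ?_) (fun g => ?_) (fun g hg => ?_)
    · rw [Hecke.mul_right _ _ hk, ← mul_assoc, CcRight.mul_right _ _ hk]
    · rw [H.ext_coe, H.heckeExt_coe, ← Subgroup.coe_mul, H.ext_coe]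
      rfl
    · rw [H.ext_toFun, H.heckeExt_toFun, extFun_of_not hg, extFun_of_not hg, zero_mul]
  · rw [H.ext_toFun, extFun_of_not hx]
    by_contra h
    obtain ⟨g, hg⟩ := exists_of_haarInt_ne_zero K (Ne.symm h)
    obtain ⟨g₁, k₁, h₁, e₁⟩ := exists_of_extFun_ne_zero (left_ne_zero_of_mul hg)
    obtain ⟨g₂, k₂, h₂, e₂⟩ := exists_of_extFun_ne_zero (right_ne_zero_of_mul hg)
    obtain ⟨k₃, h₃, k₄, h₄, e⟩ := H.exists_swap (k₂ * k₁⁻¹)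
      (K.mul_mem h₂ (K.inv_mem h₁)) g₁⁻¹
    refine hx ⟨g₂ * (k₃ * g₁⁻¹), k₄, h₄, ?_⟩
    rw [← mul_inv_cancel_right x g, e₂, e₁, Subgroup.coe_mul, Subgroup.coe_mul, mul_assoc,
      mul_assoc, ← e, Subgroup.coe_inv]
    group

/-! ### Extension on coinvariants -/

section Coinvariants

variable {p : ℕ} [Fact p.Prime] {j : GL (Fin 2) ℚ_[p] →* Γ} {js : GL (Fin 2) ℚ_[p] →* Γs}

theorem IsHeckePair.ext_leftRep (H : IsHeckePair K Γs Ks) (hj : ∀ γ, (js γ : Γ) = j γ)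
    (γ : GL (Fin 2) ℚ_[p]) (ξ : CcRight Ks) :
    H.ext (leftRep Ks js γ ξ) = leftRep K j γ (H.ext ξ) := by
  induction ξ using CcRight.induction with
  | zero => simp only [map_zero]
  | add ξ ξ' h h' => simp only [map_add, h, h']
  | smul c g => simp only [map_smul, leftRep_chCoset, H.ext_chCoset, Subgroup.coe_mul, hj]

/-- The map on coinvariants given by extension of functions. -/
noncomputable def IsHeckePair.coinvExt (H : IsHeckePair K Γs Ks) (hj : ∀ γ, (js γ : Γ) = j γ) :
    CoinvModule Ks js →ₗ[ℂ] CoinvModule K j :=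
  CoinvModule.lift ((CoinvModule.mkBilin K j).compl₂ H.ext) (fun γ φ ξ => by
    rw [LinearMap.compl₂_apply, LinearMap.compl₂_apply, H.ext_leftRep hj]
    exact CoinvModule.mk_rep γ φ _)

theorem IsHeckePair.coinvExt_mk (H : IsHeckePair K Γs Ks) (hj : ∀ γ, (js γ : Γ) = j γ)
    (φ : Schwartz p) (ξ : CcRight Ks) :
    H.coinvExt hj (CoinvModule.mk Ks js φ ξ) = CoinvModule.mk K j φ (H.ext ξ) := rfl

theorem IsHeckePair.coinvExt_smul (H : IsHeckePair K Γs Ks) (hj : ∀ γ, (js γ : Γ) = j γ)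
    (θ : Hecke Ks) (x : CoinvModule Ks js) :
    H.coinvExt hj (θ • x) = H.heckeExt θ • H.coinvExt hj x := by
  induction x using CoinvModule.induction with
  | zero => simp only [smul_zero, map_zero]
  | add x y hx hy => simp only [smul_add, map_add, hx, hy]
  | mk φ ξ =>
    rw [CoinvModule.smul_mk, H.coinvExt_mk, H.coinvExt_mk, CoinvModule.smul_mk, H.ext_heckeAct]

/-- Restriction from `C_c^∞(Γ/K)` to `C_c^∞(Γs/Ks)`. -/
noncomputable def IsHeckePair.res (H : IsHeckePair K Γs Ks) : CcRight K →ₗ[ℂ] CcRight Ks where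
  toFun ξ := ⟨fun g => ξ.toFun g, ξ.2.1.comp_continuous continuous_subtype_val,
    ξ.hasCompactSupport.comp_isClosedEmbedding H.isClosed.isClosedEmbedding_subtypeVal,
    fun g _ hk => ξ.mul_right g ((H.mem_iff _).1 hk)⟩
  map_add' _ _ := rfl
  map_smul' _ _ := rfl

theorem IsHeckePair.res_leftRep (H : IsHeckePair K Γs Ks) (hj : ∀ γ, (js γ : Γ) = j γ)
    (γ : GL (Fin 2) ℚ_[p]) (ξ : CcRight K) :
    H.res (leftRep K j γ ξ) = leftRep Ks js γ (H.res ξ) := by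
  apply CcRight.ext
  ext g
  change ξ.toFun ((j γ)⁻¹ * g) = ξ.toFun (((js γ)⁻¹ * g : Γs) : Γ)
  rw [Subgroup.coe_mul, Subgroup.coe_inv, hj]

theorem IsHeckePair.res_ext (H : IsHeckePair K Γs Ks) (ξ : CcRight Ks) : H.res (H.ext ξ) = ξ :=
  CcRight.ext (funext (H.ext_coe ξ))

/-- Restriction of functions to `Γs` is equivariant, so it descends to coinvariants, where it is a
left inverse of extension. -/
theorem IsHeckePair.coinvExt_injective (H : IsHeckePair K Γs Ks)
    (hj : ∀ γ, (js γ : Γ) = j γ) : Function.Injective (H.coinvExt (js := js) hj) := by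
  let r : CoinvModule K j →ₗ[ℂ] CoinvModule Ks js :=
    CoinvModule.lift ((CoinvModule.mkBilin Ks js).compl₂ H.res) (fun γ φ ξ => by
      rw [LinearMap.compl₂_apply, LinearMap.compl₂_apply, H.res_leftRep hj]
      exact CoinvModule.mk_rep γ φ _)
  have h : r ∘ₗ H.coinvExt hj = LinearMap.id := by
    apply CoinvModule.hom_ext
    intro φ ξ
    change CoinvModule.mk Ks js φ (H.res (H.ext ξ)) = CoinvModule.mk Ks js φ ξ
    rw [H.res_ext]
  exact Function.LeftInverse.injective (g := r) (LinearMap.congr_fun h)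

end Coinvariants

end Extension

/-! ### Quadratic orders of unit discriminant over `ℤ_p` -/

section Quadratic

variable {p : ℕ} [Fact p.Prime] {A : Type*} [CommRing A] [Algebra ℚ_[p] A]

/-- `O ⊆ A` is an order `ℤ_p ω + ℤ_p` of unit discriminant in the quadratic algebra
`A = ℚ_p ω + ℚ_p`, where `ω² = T ω - M`; the map `V` sends `(a, b)` to `a ω + b`. -/
structure QuadBasis (O : Subring A) (V : (Fin 2 → ℚ_[p]) ≃ₗ[ℚ_[p]] A) (T M : ℚ_[p]) : Prop where
  norm_T : ‖T‖ ≤ 1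
  norm_M : ‖M‖ ≤ 1
  norm_disc : ‖T ^ 2 - 4 * M‖ = 1
  one : V ![0, 1] = 1
  sq : V ![1, 0] * V ![1, 0] = T • V ![1, 0] - M • 1
  mem_iff : ∀ v, V v ∈ O ↔ ∀ i, ‖v i‖ ≤ 1

local notation "c" => algebraMap ℚ_[p] A

namespace QuadBasis

variable {O : Subring A} {V : (Fin 2 → ℚ_[p]) ≃ₗ[ℚ_[p]] A} {T M : ℚ_[p]}

theorem omega_sq (H : QuadBasis O V T M) :
    V ![1, 0] * V ![1, 0] = c T * V ![1, 0] - c M := by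
  rw [H.sq, Algebra.smul_def, Algebra.smul_def, mul_one]

theorem apply (H : QuadBasis O V T M) (v : Fin 2 → ℚ_[p]) :
    V v = c (v 0) * V ![1, 0] + c (v 1) := by
  have hv : v = v 0 • ![1, 0] + v 1 • ![0, 1] := by
    ext i
    fin_cases i <;> simp
  conv_lhs => rw [hv]
  rw [map_add, map_smul, map_smul, H.one, Algebra.smul_def, Algebra.smul_def, mul_one]

theorem decomp (H : QuadBasis O V T M) (z : A) :
    z = c (V.symm z 0) * V ![1, 0] + c (V.symm z 1) := by
  rw [← H.apply, V.apply_symm_apply]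

theorem symm_apply (H : QuadBasis O V T M) (a b : ℚ_[p]) :
    V.symm (c a * V ![1, 0] + c b) = ![a, b] := by
  rw [LinearEquiv.symm_apply_eq, H.apply ![a, b]]
  rfl

theorem mem_iff_symm (H : QuadBasis O V T M) (z : A) : z ∈ O ↔ ∀ i, ‖V.symm z i‖ ≤ 1 := by
  rw [← H.mem_iff, V.apply_symm_apply]

theorem mem_iff' (H : QuadBasis O V T M) (a b : ℚ_[p]) :
    c a * V ![1, 0] + c b ∈ O ↔ ‖a‖ ≤ 1 ∧ ‖b‖ ≤ 1 := by
  rw [H.mem_iff_symm, H.symm_apply, Fin.forall_fin_two]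
  rfl

theorem algebraMap_mem_iff (H : QuadBasis O V T M) (a : ℚ_[p]) : c a ∈ O ↔ ‖a‖ ≤ 1 := by
  have := H.mem_iff' 0 a
  simpa using this

theorem omega_mem (H : QuadBasis O V T M) : V ![1, 0] ∈ O := by
  have := H.mem_iff' 1 0
  simpa using this

theorem injective (H : QuadBasis O V T M) : Function.Injective c := fun a b h => by
  have h1 := H.symm_apply 0 a
  rw [h, H.symm_apply] at h1
  exact (congrFun h1 1).symm

/-- The nontrivial automorphism `ω ↦ T - ω` of the quadratic algebra. -/
noncomputable def conj (H : QuadBasis O V T M) : A →+* A where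
  toFun z := c (-V.symm z 0) * V ![1, 0] + c (V.symm z 0 * T + V.symm z 1)
  map_one' := by
    have h : V.symm 1 = ![0, 1] := by rw [← H.one, V.symm_apply_apply]
    simp [h]
  map_zero' := by simp
  map_add' z w := by
    simp only [map_add, Pi.add_apply, map_neg, map_mul]
    ring
  map_mul' z w := by
    have h : V.symm (z * w) = ![V.symm z 0 * V.symm w 0 * T + V.symm z 0 * V.symm w 1 +
        V.symm z 1 * V.symm w 0, V.symm z 1 * V.symm w 1 - V.symm z 0 * V.symm w 0 * M] := by
      rw [← H.symm_apply]
      congr 1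
      conv_lhs => rw [H.decomp z, H.decomp w]
      simp only [map_add, map_mul, map_sub]
      linear_combination (c (V.symm z 0) * c (V.symm w 0)) * H.omega_sq
    rw [h]
    simp only [Matrix.cons_val_zero, Matrix.cons_val_one, map_add, map_mul, map_sub, map_neg]
    linear_combination (-c (V.symm z 0) * c (V.symm w 0)) * H.omega_sq

theorem conj_coord (H : QuadBasis O V T M) (a b : ℚ_[p]) :
    H.conj (c a * V ![1, 0] + c b) = c (-a) * V ![1, 0] + c (a * T + b) := by
  change c (-V.symm _ 0) * V ![1, 0] + c (V.symm _ 0 * T + V.symm _ 1) = _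
  rw [H.symm_apply]
  rfl

theorem conj_algebraMap (H : QuadBasis O V T M) (a : ℚ_[p]) : H.conj (c a) = c a := by
  have := H.conj_coord 0 a
  simpa using this

theorem conj_omega (H : QuadBasis O V T M) : H.conj (V ![1, 0]) = c T - V ![1, 0] := by
  have := H.conj_coord 1 0
  simp only [map_one, one_mul, map_zero, add_zero, map_neg, neg_mul] at this
  rw [this]
  ring

theorem conj_conj (H : QuadBasis O V T M) (z : A) : H.conj (H.conj z) = z := by
  conv_lhs => rw [H.decomp z]
  simp only [map_add, map_mul, H.conj_algebraMap, H.conj_omega, map_sub]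
  conv_rhs => rw [H.decomp z]
  ring

theorem conj_mem (H : QuadBasis O V T M) {z : A} (hz : z ∈ O) : H.conj z ∈ O := by
  rw [H.decomp z] at hz ⊢
  obtain ⟨h0, h1⟩ := (H.mem_iff' _ _).1 hz
  rw [H.conj_coord, H.mem_iff', norm_neg]
  refine ⟨h0, (Padic.nonarchimedean _ _).trans (max_le ?_ h1)⟩
  rw [norm_mul]
  exact mul_le_one₀ h0 (norm_nonneg _) H.norm_T

/-- The norm form of the quadratic algebra. -/
noncomputable def nrm (_ : QuadBasis O V T M) (z : A) : ℚ_[p] :=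
  V.symm z 0 ^ 2 * M + V.symm z 0 * V.symm z 1 * T + V.symm z 1 ^ 2

theorem mul_conj (H : QuadBasis O V T M) (z : A) : z * H.conj z = c (H.nrm z) := by
  conv_lhs => rw [H.decomp z, H.conj_coord]
  simp only [nrm, map_add, map_mul, map_neg, map_pow]
  linear_combination (-c (V.symm z 0) * c (V.symm z 0)) * H.omega_sq

theorem nrm_mul (H : QuadBasis O V T M) (z w : A) : H.nrm (z * w) = H.nrm z * H.nrm w := by
  apply H.injective
  rw [map_mul, ← H.mul_conj, ← H.mul_conj, ← H.mul_conj, map_mul]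
  ring

theorem nrm_one (H : QuadBasis O V T M) : H.nrm 1 = 1 := by
  apply H.injective
  rw [← H.mul_conj, map_one, map_one, mul_one]

theorem nrm_algebraMap (H : QuadBasis O V T M) (a : ℚ_[p]) : H.nrm (c a) = a ^ 2 := by
  apply H.injective
  rw [← H.mul_conj, H.conj_algebraMap, map_pow, pow_two]

theorem norm_nrm_le (H : QuadBasis O V T M) {z : A} (hz : z ∈ O) : ‖H.nrm z‖ ≤ 1 := by
  rw [← H.algebraMap_mem_iff, ← H.mul_conj]
  exact O.mul_mem hz (H.conj_mem hz)

theorem isUnit_of_nrm_ne_zero (H : QuadBasis O V T M) {z : A} (h : H.nrm z ≠ 0) : IsUnit z := by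
  refine IsUnit.of_mul_eq_one (H.conj z * c (H.nrm z)⁻¹) ?_
  rw [← mul_assoc, H.mul_conj, ← map_mul, mul_inv_cancel₀ h, map_one]

/-- The square root `2ω - T` of the discriminant. -/
noncomputable def theta (_ : QuadBasis O V T M) : A := 2 * V ![1, 0] - c T

theorem theta_sq (H : QuadBasis O V T M) : H.theta * H.theta = c (T ^ 2 - 4 * M) := by
  simp only [theta, map_sub, map_pow, map_mul, map_ofNat]
  linear_combination 4 * H.omega_sq

theorem sub_conj (H : QuadBasis O V T M) (z : A) :
    z - H.conj z = c (V.symm z 0) * H.theta := by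
  conv_lhs => rw [H.decomp z, H.conj_coord]
  simp only [theta, map_add, map_mul, map_neg]
  ring

theorem theta_mem (H : QuadBasis O V T M) : H.theta ∈ O :=
  O.sub_mem (O.mul_mem (ofNat_mem O 2) H.omega_mem) ((H.algebraMap_mem_iff T).2 H.norm_T)

theorem disc_ne_zero (H : QuadBasis O V T M) : T ^ 2 - 4 * M ≠ 0 := by
  intro h
  have := H.norm_disc
  rw [h, norm_zero] at this
  exact zero_ne_one this

/-- The inverse of `2ω - T`. -/
noncomputable def thetaInv (H : QuadBasis O V T M) : A := H.theta * c (T ^ 2 - 4 * M)⁻¹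

theorem theta_mul_thetaInv (H : QuadBasis O V T M) : H.theta * H.thetaInv = 1 := by
  rw [thetaInv, ← mul_assoc, H.theta_sq, ← map_mul, mul_inv_cancel₀ H.disc_ne_zero, map_one]

theorem thetaInv_mem (H : QuadBasis O V T M) : H.thetaInv ∈ O :=
  O.mul_mem H.theta_mem ((H.algebraMap_mem_iff _).2 (by rw [norm_inv, H.norm_disc, inv_one]))

/-- From `z - z̄ = σ(z) θ` with `θ = 2ω - T`. Since `θ²` is the discriminant, `θ` is a unit of `O`,
so the coefficient of `ω` is expressed through conjugation without loss of integrality. -/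
theorem coord_eq (H : QuadBasis O V T M) (z : A) :
    c (V.symm z 0) = (z - H.conj z) * H.thetaInv := by
  rw [H.sub_conj, mul_assoc, H.theta_mul_thetaInv, mul_one]

/-- Total divisibility in the component of an idempotent `e` gives a common divisor of the
form `a + x b` there. -/
theorem exists_gcd_component (H : QuadBasis O V T M) (e : A)
    (he : ∀ a b : A, (∃ r ∈ O, e * b = e * a * r) ∨ ∃ r ∈ O, e * a = e * b * r) (a b : A) :
    ∃ x ∈ O, ∃ r ∈ O, ∃ s ∈ O, e * a = e * (a + x * b) * r ∧ e * b = e * (a + x * b) * s := by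
  have := H
  rcases he a b with ⟨r, hr, h⟩ | ⟨r, hr, h⟩
  · exact ⟨0, O.zero_mem, 1, O.one_mem, r, hr, by ring, by rw [h]; ring⟩
  -- Here `b` divides `a = br` in the component. The divisor must still have the form `a + xb`, and
  -- `x = 1 - r` makes it equal to `b` there.
  · refine ⟨1 - r, O.sub_mem O.one_mem hr, r, hr, 1, O.one_mem, ?_, ?_⟩
    · linear_combination (1 - r) * h
    · linear_combination -h

theorem padic_dvd (x y : ℚ_[p]) : (∃ r : ℚ_[p], ‖r‖ ≤ 1 ∧ y = x * r) ∨
    ∃ r : ℚ_[p], ‖r‖ ≤ 1 ∧ x = y * r := by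
  have key : ∀ {x y : ℚ_[p]}, ‖y‖ ≤ ‖x‖ → ∃ r : ℚ_[p], ‖r‖ ≤ 1 ∧ y = x * r := by
    intro x y h
    by_cases hx : x = 0
    · rw [hx, norm_zero, norm_le_zero_iff] at h
      exact ⟨0, by simp, by rw [h, mul_zero]⟩
    · refine ⟨y / x, ?_, (mul_div_cancel₀ y hx).symm⟩
      rw [norm_div]
      exact div_le_one_of_le₀ h (norm_nonneg _)
  rcases le_total ‖y‖ ‖x‖ with h | h
  · exact Or.inl (key h)
  · exact Or.inr (key h)

/-- In the anisotropic case any two elements are comparable for divisibility. -/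
theorem dvd_of_anisotropic (H : QuadBasis O V T M)
    (hN : ∀ z, z ∈ O → ‖H.nrm z‖ < 1 → ∃ z' ∈ O, z = c p * z') (a b : A) :
    (∃ r ∈ O, b = a * r) ∨ ∃ r ∈ O, a = b * r := by
  have hp0 : (p : ℚ_[p]) ≠ 0 := Nat.cast_ne_zero.2 (Fact.out : p.Prime).ne_zero
  have hunit : ∀ u ∈ O, ‖H.nrm u‖ = 1 → ∃ u' ∈ O, u * u' = 1 := by
    intro u hu h1
    refine ⟨H.conj u * c (H.nrm u)⁻¹, O.mul_mem (H.conj_mem hu)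
      ((H.algebraMap_mem_iff _).2 (by rw [norm_inv, h1, inv_one])), ?_⟩
    rw [← mul_assoc, H.mul_conj, ← map_mul, mul_inv_cancel₀, map_one]
    rw [← norm_ne_zero_iff, h1]
    exact one_ne_zero
  -- Each nonzero element is a power of `p` times a unit of `O`: dividing by the power of `p` in the
  -- largest coordinate gives an element of `O` not divisible by `p`, whose norm is then a unit by
  -- `hN`. Divisibility thus reduces to comparing powers of `p`.
  have hrep : ∀ z : A, z ≠ 0 → ∃ (k : ℤ) (u : A), u ∈ O ∧ ‖H.nrm u‖ = 1 ∧
      z = c ((p : ℚ_[p]) ^ k) * u := by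
    intro z hz
    obtain ⟨_, hi⟩ : ∃ i, V.symm z i ≠ 0 := by
      by_contra hc
      push Not at hc
      exact hz (V.symm.map_eq_zero_iff.1 (funext hc))
    obtain ⟨i, hmax⟩ : ∃ i, ∀ j, ‖V.symm z j‖ ≤ ‖V.symm z i‖ := by
      rcases le_total ‖V.symm z 0‖ ‖V.symm z 1‖ with h | h
      · exact ⟨1, Fin.forall_fin_two.2 ⟨h, le_rfl⟩⟩
      · exact ⟨0, Fin.forall_fin_two.2 ⟨le_rfl, h⟩⟩
    have hi0 : V.symm z i ≠ 0 := by
      intro h0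
      exact hi (norm_le_zero_iff.1 ((hmax _).trans (by rw [h0, norm_zero])))
    set k := (V.symm z i).valuation with hk
    have hnk : ‖V.symm z i‖ = ‖(p : ℚ_[p]) ^ k‖ := by
      rw [Padic.norm_eq_zpow_neg_valuation hi0, Padic.norm_p_zpow]
    have hpk : (p : ℚ_[p]) ^ k ≠ 0 := zpow_ne_zero _ hp0
    have hpk' : ‖(p : ℚ_[p]) ^ k‖ ≠ 0 := norm_ne_zero_iff.2 hpk
    let u := c ((p : ℚ_[p]) ^ k)⁻¹ * z
    have hu : ∀ j, V.symm u j = ((p : ℚ_[p]) ^ k)⁻¹ * V.symm z j := by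
      intro j
      change V.symm (c ((p : ℚ_[p]) ^ k)⁻¹ * z) j = _
      rw [← Algebra.smul_def, map_smul]
      rfl
    have hzu : z = c ((p : ℚ_[p]) ^ k) * u := by
      change z = c ((p : ℚ_[p]) ^ k) * (c ((p : ℚ_[p]) ^ k)⁻¹ * z)
      rw [← mul_assoc, ← map_mul, mul_inv_cancel₀ hpk, map_one, one_mul]
    have huO : u ∈ O := by
      rw [H.mem_iff_symm]
      intro j
      rw [hu, norm_mul, norm_inv, ← hnk, inv_mul_le_one₀ (norm_pos_iff.2 hi0)]
      exact hmax j
    refine ⟨k, u, huO, ?_, hzu⟩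
    refine le_antisymm (H.norm_nrm_le huO) (not_lt.1 fun hlt => ?_)
    obtain ⟨z', hz', e⟩ := hN u huO hlt
    have h1 : ‖V.symm u i‖ = 1 := by
      rw [hu, norm_mul, norm_inv, hnk, inv_mul_cancel₀ hpk']
    rw [e, ← Algebra.smul_def, map_smul, Pi.smul_apply, smul_eq_mul, norm_mul] at h1
    have h2 := (H.mem_iff_symm z').1 hz' i
    have h3 : ‖(p : ℚ_[p])‖ < 1 := Padic.norm_p_lt_one
    nlinarith [norm_nonneg (V.symm z' i), norm_nonneg (p : ℚ_[p])]
  by_cases ha : a = 0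
  · exact Or.inr ⟨0, O.zero_mem, by rw [ha, mul_zero]⟩
  by_cases hb : b = 0
  · exact Or.inl ⟨0, O.zero_mem, by rw [hb, mul_zero]⟩
  obtain ⟨k, u, hu, hu1, rfl⟩ := hrep a ha
  obtain ⟨l, w, hw, hw1, rfl⟩ := hrep b hb
  obtain ⟨u', hu', hu2⟩ := hunit u hu hu1
  obtain ⟨w', hw', hw2⟩ := hunit w hw hw1
  rcases padic_dvd ((p : ℚ_[p]) ^ k) ((p : ℚ_[p]) ^ l) with ⟨r, hr, e⟩ | ⟨r, hr, e⟩
  · refine Or.inl ⟨c r * w * u', O.mul_mem (O.mul_mem ((H.algebraMap_mem_iff r).2 hr) hw) hu', ?_⟩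
    rw [e, map_mul]
    linear_combination (-c ((p : ℚ_[p]) ^ k) * c r * w) * hu2
  · refine Or.inr ⟨c r * u * w', O.mul_mem (O.mul_mem ((H.algebraMap_mem_iff r).2 hr) hu) hw', ?_⟩
    rw [e, map_mul]
    linear_combination (-c ((p : ℚ_[p]) ^ l) * c r * u) * hw2

/-- If the norm form is isotropic modulo `p`, the polynomial `X² - T X + M` has a root. -/
theorem exists_root (H : QuadBasis O V T M) {z : A} (hz : z ∈ O) (hn : ‖H.nrm z‖ < 1)
    (hp : ¬ ∃ z' ∈ O, z = c p * z') : ∃ r : ℚ_[p], ‖r‖ ≤ 1 ∧ r ^ 2 - T * r + M = 0 := by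
  have hp0 : (p : ℚ_[p]) ≠ 0 := Nat.cast_ne_zero.2 (Fact.out : p.Prime).ne_zero
  have hlt : ∀ x : ℚ_[p], ‖x‖ < 1 → ‖(p : ℚ_[p])⁻¹ * x‖ ≤ 1 := by
    intro x hx
    let x' : ℤ_[p] := ⟨x, hx.le⟩
    obtain ⟨y, hy⟩ := (PadicInt.norm_lt_one_iff_dvd x').1 hx
    have h2 : x = p * (y : ℚ_[p]) := congrArg Subtype.val hy
    rw [h2, inv_mul_cancel_left₀ hp0]
    exact y.2
  set a := V.symm z 0 with ha
  set b := V.symm z 1 with hb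
  have ha1 : ‖a‖ ≤ 1 := (H.mem_iff_symm z).1 hz 0
  have hb1 : ‖b‖ ≤ 1 := (H.mem_iff_symm z).1 hz 1
  -- If `a` were divisible by `p`, then `b² = N(z) - a(aM + bT)` would force `p ∣ b`, hence `p ∣ z`.
  have ha' : ‖a‖ = 1 := by
    refine le_antisymm ha1 (not_lt.1 fun hlta => ?_)
    have hb2 : ‖b ^ 2‖ < 1 := by
      have e : b ^ 2 = H.nrm z + (-(a * (a * M + b * T))) := by
        simp only [nrm, ← ha, ← hb]
        ring
      rw [e]
      refine (Padic.nonarchimedean _ _).trans_lt (max_lt hn ?_)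
      rw [norm_neg, norm_mul]
      have h3 : ‖a * M + b * T‖ ≤ 1 := by
        refine (Padic.nonarchimedean _ _).trans (max_le ?_ ?_)
        · rw [norm_mul]
          exact mul_le_one₀ ha1 (norm_nonneg _) H.norm_M
        · rw [norm_mul]
          exact mul_le_one₀ hb1 (norm_nonneg _) H.norm_T
      nlinarith [norm_nonneg a, norm_nonneg (a * M + b * T)]
    have hb3 : ‖b‖ < 1 := by
      rw [norm_pow] at hb2
      exact (pow_lt_one_iff_of_nonneg (norm_nonneg _) two_ne_zero).1 hb2
    refine hp ⟨c (p : ℚ_[p])⁻¹ * z, ?_, ?_⟩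
    · rw [H.mem_iff_symm, ← Algebra.smul_def, map_smul, Fin.forall_fin_two]
      exact ⟨hlt _ hlta, hlt _ hb3⟩
    · rw [← mul_assoc, ← map_mul, mul_inv_cancel₀ hp0, map_one, one_mul]
  have ha0 : a ≠ 0 := by
    rw [← norm_ne_zero_iff, ha']
    exact one_ne_zero
  have hr0 : ‖-b / a‖ ≤ 1 := by rwa [norm_div, norm_neg, ha', div_one]
  let T' : ℤ_[p] := ⟨T, H.norm_T⟩
  let M' : ℤ_[p] := ⟨M, H.norm_M⟩
  let r₀ : ℤ_[p] := ⟨-b / a, hr0⟩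
  -- As `N(z) = a² F(-b/a)`, the point `r₀ = -b/a` is a root modulo `p`. It is a simple one because
  -- `F'(r₀)² = (T² - 4M) + 4F(r₀)` is a unit, so Hensel's lemma lifts it.
  let F : Polynomial ℤ_[p] := Polynomial.X ^ 2 - Polynomial.C T' * Polynomial.X + Polynomial.C M'
  have hF : ∀ y : ℤ_[p], F.eval y = y ^ 2 - T' * y + M' := fun y => by simp [F]
  have hF' : ∀ y : ℤ_[p], F.derivative.eval y = 2 * y - T' := fun y => by
    simp [F, one_add_one_eq_two]
  have h1 : ‖F.eval r₀‖ < 1 := by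
    rw [hF]
    change ‖(-b / a) ^ 2 - T * (-b / a) + M‖ < 1
    have e : (-b / a) ^ 2 - T * (-b / a) + M = H.nrm z / a ^ 2 := by
      simp only [nrm, ← ha, ← hb]
      field_simp
      ring
    rw [e, norm_div, norm_pow, ha', one_pow, div_one]
    exact hn
  have h2 : ‖F.derivative.eval r₀‖ ^ 2 = 1 := by
    rw [← norm_pow, hF']
    have e : (2 * r₀ - T') ^ 2 = (T' ^ 2 - 4 * M') + 4 * F.eval r₀ := by
      rw [hF]
      ring
    have hd : ‖T' ^ 2 - 4 * M'‖ = 1 := H.norm_disc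
    have h4 : ‖4 * F.eval r₀‖ < 1 := by
      rw [norm_mul]
      have := PadicInt.norm_le_one (4 : ℤ_[p])
      nlinarith [norm_nonneg (F.eval r₀), norm_nonneg (4 : ℤ_[p])]
    rw [e, PadicInt.norm_add_eq_max_of_ne (by rw [hd]; exact h4.ne'), hd, max_eq_left h4.le]
  obtain ⟨r, hr, -⟩ := hensels_lemma (F := F) (a := r₀) (by
    simp only [Polynomial.coe_aeval_eq_eval]
    rw [h2]
    exact h1)
  refine ⟨r, r.2, ?_⟩
  simp only [Polynomial.coe_aeval_eq_eval] at hr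
  rw [hF] at hr
  exact congrArg Subtype.val hr

/-- For `a, b ∈ A` there is a common divisor of the form `a + x b`. -/
theorem exists_gcd (H : QuadBasis O V T M) (a b : A) :
    ∃ x ∈ O, ∃ r ∈ O, ∃ s ∈ O, a = (a + x * b) * r ∧ b = (a + x * b) * s := by
  by_cases hN : ∀ z, z ∈ O → ‖H.nrm z‖ < 1 → ∃ z' ∈ O, z = c p * z'
  · have := H.exists_gcd_component 1 (fun a b => by
      simpa only [one_mul] using H.dvd_of_anisotropic hN a b) a b
    simpa only [one_mul] using this
  push Not at hN
  obtain ⟨z, hz, hn, hz'⟩ := hN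
  obtain ⟨r, hr1, hr⟩ := H.exists_root hz hn (by push Not; exact hz')
  set d := 2 * r - T with hd
  have hd2 : d ^ 2 = T ^ 2 - 4 * M := by
    rw [hd]
    linear_combination 4 * hr
  have hd0 : d ≠ 0 := by
    rintro h0
    exact H.disc_ne_zero (by rw [← hd2, h0]; ring)
  have hr' : (T - r) ^ 2 - T * (T - r) + M = 0 := by linear_combination hr
  have hcr : c r ^ 2 - c T * c r + c M = 0 := by
    rw [← map_pow, ← map_mul, ← map_sub, ← map_add, hr, map_zero]
  -- The roots `r` and `T - r` differ by the unit `d`, so the algebra splits: `e₁` and `e₂` are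
  -- orthogonal idempotents of `O` on which `ω` acts as `r` and as `T - r`. Each component is then
  -- governed by divisibility in `ℚ_p`, and the two solutions are glued with the idempotents.
  set e₁ := (V ![1, 0] - c (T - r)) * c d⁻¹ with he₁
  set e₂ := (V ![1, 0] - c r) * c (-d⁻¹) with he₂
  have hdi : c d * c d⁻¹ = 1 := by rw [← map_mul, mul_inv_cancel₀ hd0, map_one]
  have hcd : c d = 2 * c r - c T := by rw [hd, map_sub, map_mul, map_ofNat]
  have hsum : e₁ + e₂ = 1 := by
    rw [he₁, he₂, map_neg, map_sub]
    rw [hcd] at hdi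
    linear_combination hdi
  have hω₁ : e₁ * V ![1, 0] = e₁ * c r := by
    rw [he₁, map_sub]
    linear_combination c d⁻¹ * H.omega_sq - c d⁻¹ * hcr
  have hω₂ : e₂ * V ![1, 0] = e₂ * c (T - r) := by
    rw [he₂, map_sub, map_neg]
    linear_combination -c d⁻¹ * H.omega_sq + c d⁻¹ * hcr
  have hcomp : ∀ (e : A) (ρ : ℚ_[p]), e * V ![1, 0] = e * c ρ →
      ∀ a b : A, (∃ r ∈ O, e * b = e * a * r) ∨ ∃ r ∈ O, e * a = e * b * r := by
    intro e ρ he a b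
    have hval : ∀ z, e * z = e * c (V.symm z 0 * ρ + V.symm z 1) := by
      intro z
      conv_lhs => rw [H.decomp z]
      rw [map_add, map_mul]
      linear_combination c (V.symm z 0) * he
    rw [hval a, hval b]
    rcases padic_dvd (V.symm a 0 * ρ + V.symm a 1) (V.symm b 0 * ρ + V.symm b 1) with
      ⟨r, hr, h⟩ | ⟨r, hr, h⟩
    · exact Or.inl ⟨c r, (H.algebraMap_mem_iff r).2 hr, by rw [h, map_mul, mul_assoc]⟩
    · exact Or.inr ⟨c r, (H.algebraMap_mem_iff r).2 hr, by rw [h, map_mul, mul_assoc]⟩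
  have hdn : ‖d⁻¹‖ = 1 := by
    have h1 : ‖d‖ ^ 2 = 1 := by rw [← norm_pow, hd2, H.norm_disc]
    rw [norm_inv, (pow_eq_one_iff_of_nonneg (norm_nonneg _) two_ne_zero).1 h1, inv_one]
  have hmem : ∀ x : ℚ_[p], ‖x‖ ≤ 1 → c x ∈ O := fun x => (H.algebraMap_mem_iff x).2
  have hTr : c (T - r) ∈ O := by
    rw [map_sub]
    exact O.sub_mem (hmem T H.norm_T) (hmem r hr1)
  have hO₁ : e₁ ∈ O := O.mul_mem (O.sub_mem H.omega_mem hTr) (hmem _ hdn.le)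
  have hO₂ : e₂ ∈ O := O.mul_mem (O.sub_mem H.omega_mem (hmem r hr1))
    (hmem _ (by rw [norm_neg]; exact hdn.le))
  have h12 : e₁ * e₂ = 0 := by
    rw [he₂]
    linear_combination c (-d⁻¹) * hω₁
  obtain ⟨x₁, hx₁, r₁, hr₁, s₁, hs₁, ha₁, hb₁⟩ := H.exists_gcd_component e₁ (hcomp e₁ r hω₁) a b
  obtain ⟨x₂, hx₂, r₂, hr₂, s₂, hs₂, ha₂, hb₂⟩ :=
    H.exists_gcd_component e₂ (hcomp e₂ (T - r) hω₂) a b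
  have h11 : e₁ * e₁ = e₁ := by linear_combination e₁ * hsum - h12
  have h22 : e₂ * e₂ = e₂ := by linear_combination e₂ * hsum - h12
  refine ⟨e₁ * x₁ + e₂ * x₂, O.add_mem (O.mul_mem hO₁ hx₁) (O.mul_mem hO₂ hx₂),
    e₁ * r₁ + e₂ * r₂, O.add_mem (O.mul_mem hO₁ hr₁) (O.mul_mem hO₂ hr₂),
    e₁ * s₁ + e₂ * s₂, O.add_mem (O.mul_mem hO₁ hs₁) (O.mul_mem hO₂ hs₂), ?_, ?_⟩
  · have key : (a + (e₁ * x₁ + e₂ * x₂) * b) * (e₁ * r₁ + e₂ * r₂) =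
        e₁ * (a + x₁ * b) * r₁ + e₂ * (a + x₂ * b) * r₂ := by
      linear_combination b * x₁ * r₁ * h11 + b * x₂ * r₂ * h22 +
        (x₁ * b * r₂ + x₂ * b * r₁) * h12
    rw [key, ← ha₁, ← ha₂]
    linear_combination -a * hsum
  · have key : (a + (e₁ * x₁ + e₂ * x₂) * b) * (e₁ * s₁ + e₂ * s₂) =
        e₁ * (a + x₁ * b) * s₁ + e₂ * (a + x₂ * b) * s₂ := by
      linear_combination b * x₁ * s₁ * h11 + b * x₂ * s₂ * h22 +
        (x₁ * b * s₂ + x₂ * b * s₁) * h12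
    rw [key, ← hb₁, ← hb₂]
    linear_combination -b * hsum

end QuadBasis

end Quadratic

/-! ### Cartan decomposition and triangularity of double cosets -/

section Matrices

variable {p : ℕ} [Fact p.Prime] {A : Type*} [CommRing A] [Algebra ℚ_[p] A]

local notation "c" => algebraMap ℚ_[p] A

theorem fin_two_congr {R : Type*} {a b e f a' b' e' f' : R} (ha : a = a') (hb : b = b')
    (he : e = e') (hf : f = f') : !![a, b; e, f] = !![a', b'; e', f'] := by
  rw [ha, hb, he, hf]

theorem exists_integralGL {R : Type*} [CommRing R] {O : Subring R} {a b e f d : R}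
    (ha : a ∈ O) (hb : b ∈ O) (he : e ∈ O) (hf : f ∈ O) (hd : d ∈ O) (h : (a * f - b * e) * d = 1) :
    ∃ k ∈ integralGL O, k.1 = !![a, b; e, f] := by
  have hdet : (!![a, b; e, f] : Matrix (Fin 2) (Fin 2) R).det * d = 1 := by
    rwa [Matrix.det_fin_two_of]
  have hu : IsUnit (!![a, b; e, f] : Matrix (Fin 2) (Fin 2) R) :=
    (Matrix.isUnit_iff_isUnit_det _).2 (IsUnit.of_mul_eq_one d hdet)
  obtain ⟨k, hk⟩ := hu
  refine ⟨k, mem_integralGL_of_det ?_ hd (by rw [hk]; exact hdet), hk⟩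
  rw [hk]
  intro i j
  fin_cases i <;> fin_cases j <;> assumption

theorem exists_gl_padic {a b e f : ℚ_[p]} (h : a * f - b * e ≠ 0) :
    ∃ k : GL (Fin 2) ℚ_[p], k.1 = !![a, b; e, f] :=
  ⟨Matrix.GeneralLinearGroup.mkOfDetNeZero !![a, b; e, f] (by rwa [Matrix.det_fin_two_of]), rfl⟩

theorem mem_gl2Zp_of_det {g : GL (Fin 2) ℚ_[p]} (hg : ∀ i j, ‖g.1 i j‖ ≤ 1)
    (h : ‖g.1.det‖ = 1) : g ∈ GL2Zp p := by
  have h0 : g.1.det ≠ 0 := by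
    rw [← norm_ne_zero_iff, h]
    exact one_ne_zero
  refine mem_integralGL_of_det (O := PadicInt.subring p) (d := g.1.det⁻¹) hg ?_
    (mul_inv_cancel₀ h0)
  change ‖g.1.det⁻¹‖ ≤ 1
  rw [norm_inv, h, inv_one]

/-- The embedding `GL₂(ℚ_p) → GL₂(A)`. -/
noncomputable def embGL (p : ℕ) [Fact p.Prime] (A : Type*) [CommRing A] [Algebra ℚ_[p] A] :
    GL (Fin 2) ℚ_[p] →* GL (Fin 2) A :=
  Matrix.GeneralLinearGroup.map (algebraMap ℚ_[p] A)

theorem embGL_apply (γ : GL (Fin 2) ℚ_[p]) (i j : Fin 2) :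
    (embGL p A γ).1 i j = c (γ.1 i j) := rfl

theorem det_embGL (γ : GL (Fin 2) ℚ_[p]) : (embGL p A γ).1.det = c γ.1.det := by
  rw [Matrix.det_fin_two, Matrix.det_fin_two]
  simp only [embGL_apply, map_sub, map_mul]

theorem embGL_mem {O : Subring A} (hO : ∀ a : ℚ_[p], ‖a‖ ≤ 1 → c a ∈ O) {γ : GL (Fin 2) ℚ_[p]}
    (h : γ ∈ GL2Zp p) : embGL p A γ ∈ integralGL O :=
  ⟨fun i j => hO _ (h.1 i j), fun i j => by
    rw [← map_inv]
    exact hO _ (h.2 i j)⟩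

variable (p) in
theorem cast_prime_ne_zero : (p : ℚ_[p]) ≠ 0 := Nat.cast_ne_zero.2 (Fact.out : p.Prime).ne_zero

/-- The matrix `[[p ^ n, ω], [0, 1]]`. -/
noncomputable def orbitRep (V : (Fin 2 → ℚ_[p]) ≃ₗ[ℚ_[p]] A) (n : ℕ) : GL (Fin 2) A where
  val := !![c ((p : ℚ_[p]) ^ n), V ![1, 0]; 0, 1]
  inv := !![c ((p : ℚ_[p]) ^ n)⁻¹, -(c ((p : ℚ_[p]) ^ n)⁻¹ * V ![1, 0]); 0, 1]
  val_inv := by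
    have h : c ((p : ℚ_[p]) ^ n) * c ((p : ℚ_[p]) ^ n)⁻¹ = 1 := by
      rw [← map_mul, mul_inv_cancel₀ (pow_ne_zero _ (cast_prime_ne_zero p)), map_one]
    rw [Matrix.mul_fin_two, Matrix.one_fin_two]
    refine fin_two_congr ?_ ?_ ?_ ?_
    · simpa using h
    · linear_combination (-V ![1, 0]) * h
    · simp
    · simp
  inv_val := by
    have h : c ((p : ℚ_[p]) ^ n)⁻¹ * c ((p : ℚ_[p]) ^ n) = 1 := by
      rw [← map_mul, inv_mul_cancel₀ (pow_ne_zero _ (cast_prime_ne_zero p)), map_one]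
    rw [Matrix.mul_fin_two, Matrix.one_fin_two]
    refine fin_two_congr ?_ ?_ ?_ ?_
    · simpa using h
    · simp
    · simp
    · simp

theorem orbitRep_val (V : (Fin 2 → ℚ_[p]) ≃ₗ[ℚ_[p]] A) (n : ℕ) :
    (orbitRep V n).1 = !![c ((p : ℚ_[p]) ^ n), V ![1, 0]; 0, 1] := rfl

theorem orbitRep_inv_val (V : (Fin 2 → ℚ_[p]) ≃ₗ[ℚ_[p]] A) (n : ℕ) : ((orbitRep V n)⁻¹).1 =
    !![c ((p : ℚ_[p]) ^ n)⁻¹, -(c ((p : ℚ_[p]) ^ n)⁻¹ * V ![1, 0]); 0, 1] := rfl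

/-- The lattice `ℤ_p² δ` corresponds to a fractional ideal `t O` with `p ^ n σ(t O) ⊆ t O`, where
`σ` is the coefficient of `ω`. -/
def GoodLattice (O : Subring A) (V : (Fin 2 → ℚ_[p]) ≃ₗ[ℚ_[p]] A) (n : ℕ)
    (δ : GL (Fin 2) ℚ_[p]) : Prop :=
  ∃ t : Aˣ, (∀ v, v ∈ rowLattice δ ↔ ∃ y ∈ O, V v = t * y) ∧
    ∀ y ∈ O, ∃ y' ∈ O, c ((p : ℚ_[p]) ^ n * V.symm (t * y) 0) = t * y'

theorem mul_integral {R : Type*} [CommRing R] {O : Subring R} {t : R}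
    {B k : Matrix (Fin 2) (Fin 2) R} (hB : ∀ i j, ∃ y ∈ O, B i j = t * y) (hk : ∀ i j, k i j ∈ O)
    (i j : Fin 2) : ∃ y ∈ O, (B * k) i j = t * y := by
  choose y hy hB using hB
  refine ⟨∑ l, y i l * k l j, O.sum_mem fun l _ => O.mul_mem (hy i l) (hk l j), ?_⟩
  rw [Matrix.mul_apply, Finset.mul_sum]
  exact Finset.sum_congr rfl fun l _ => by rw [hB, mul_assoc]

theorem integral_mul {R : Type*} [CommRing R] {O : Subring R} {t : R}
    {B k : Matrix (Fin 2) (Fin 2) R} (hB : ∀ i j, ∃ y ∈ O, B i j = t * y) (hk : ∀ i j, k i j ∈ O)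
    (i j : Fin 2) : ∃ y ∈ O, (k * B) i j = t * y := by
  choose y hy hB using hB
  refine ⟨∑ l, k i l * y l j, O.sum_mem fun l _ => O.mul_mem (hk i l) (hy l j), ?_⟩
  rw [Matrix.mul_apply, Finset.mul_sum]
  exact Finset.sum_congr rfl fun l _ => by rw [hB, mul_left_comm]

namespace QuadBasis

variable {O : Subring A} {V : (Fin 2 → ℚ_[p]) ≃ₗ[ℚ_[p]] A} {T M : ℚ_[p]}

theorem emb_mul_orbitRep_zero (γ : GL (Fin 2) ℚ_[p]) (n : ℕ) (i : Fin 2) :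
    (embGL p A γ * orbitRep V n).1 i 0 = c ((p : ℚ_[p]) ^ n * γ.1 i 0) := by
  rw [Units.val_mul, Matrix.mul_apply, Fin.sum_univ_two, orbitRep_val, embGL_apply, embGL_apply]
  simp [mul_comm]

theorem emb_mul_orbitRep_one (H : QuadBasis O V T M) (γ : GL (Fin 2) ℚ_[p]) (n : ℕ) (i : Fin 2) :
    (embGL p A γ * orbitRep V n).1 i 1 = V (γ.1 i) := by
  rw [Units.val_mul, Matrix.mul_apply, Fin.sum_univ_two, orbitRep_val, embGL_apply, embGL_apply]
  simpa using (H.apply (γ.1 i)).symm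

theorem det_emb_mul_orbitRep (γ : GL (Fin 2) ℚ_[p]) (n : ℕ) :
    (embGL p A γ * orbitRep V n).1.det = c (γ.1.det * (p : ℚ_[p]) ^ n) := by
  rw [Units.val_mul, Matrix.det_mul, det_embGL, orbitRep_val, Matrix.det_fin_two_of, map_mul]
  ring

theorem row_mem_rowLattice (δ : GL (Fin 2) ℚ_[p]) (i : Fin 2) : δ.1 i ∈ rowLattice δ := by
  intro j
  have h : Matrix.vecMul (δ.1 i) (δ⁻¹).1 = (1 : Matrix (Fin 2) (Fin 2) ℚ_[p]) i := by
    rw [← Units.val_one, ← mul_inv_cancel δ, Units.val_mul]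
    rfl
  rw [h, Matrix.one_apply]
  split_ifs <;> simp

/-- When `b ≠ 0`, the ratio `a / b` is the determinant of an integral matrix, hence lies in `ℚ_p ∩ O
= ℤ_p`. -/
theorem norm_det_of_mem (H : QuadBasis O V T M) {k : GL (Fin 2) A} (hk : k ∈ integralGL O)
    {a b : ℚ_[p]} (h : c a = k.1.det * c b) : ‖a‖ ≤ ‖b‖ := by
  by_cases hb : b = 0
  · rw [hb, map_zero, mul_zero, ← map_zero c] at h
    rw [H.injective h, hb]
  · have h1 : c (a / b) = k.1.det := by
      rw [div_eq_mul_inv, map_mul, h, mul_assoc, ← map_mul, mul_inv_cancel₀ hb, map_one, mul_one]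
    have h2 := (H.algebraMap_mem_iff _).1 (h1 ▸ det_mem_of_integral hk.1)
    rwa [norm_div, div_le_one (norm_pos_iff.2 hb)] at h2

theorem norm_pow_le_iff {m n : ℕ} (h : ‖(p : ℚ_[p]) ^ n‖ ≤ ‖(p : ℚ_[p]) ^ m‖) : m ≤ n := by
  by_contra hc
  push Not at hc
  rw [norm_pow, norm_pow] at h
  have hp : ‖(p : ℚ_[p])‖ < 1 := Padic.norm_p_lt_one
  have hp0 : 0 < ‖(p : ℚ_[p])‖ := norm_pos_iff.2 (cast_prime_ne_zero p)
  exact absurd (pow_lt_pow_right_of_lt_one₀ hp0 hp hc) (not_lt.2 h)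

/-- Goodness of the lattice `tO` says that all entries of `δ x_n` are divisible by `t`: the second
column contains the rows of `δ`, the first their `σ` times `p^n`. Multiplication by integral
matrices preserves this, so the rows of `γ` lie in `ℤ_p² δ` and `det(γδ⁻¹)` is integral. The
determinants `p^m det γ` and `p^n det δ` agree up to a unit; hence `m ≤ n`, and for `m = n` the
matrix `γδ⁻¹` is invertible over `ℤ_p`. -/
theorem goodLattice_le (H : QuadBasis O V T M) {n m : ℕ} {δ γ : GL (Fin 2) ℚ_[p]}
    {k₁ k₂ : GL (Fin 2) A} (hδ : GoodLattice O V n δ) (h₁ : k₁ ∈ integralGL O)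
    (h₂ : k₂ ∈ integralGL O)
    (h : embGL p A γ * orbitRep V m = k₁ * (embGL p A δ * orbitRep V n) * k₂) :
    m ≤ n ∧ (m = n → γ * δ⁻¹ ∈ GL2Zp p) := by
  obtain ⟨t, ht, htn⟩ := hδ
  have hB : ∀ i j, ∃ y ∈ O, (embGL p A δ * orbitRep V n).1 i j = t * y := by
    intro i j
    obtain ⟨y, hy, e⟩ := (ht _).1 (row_mem_rowLattice δ i)
    fin_cases j
    · obtain ⟨y', hy', e'⟩ := htn y hy
      refine ⟨y', hy', ?_⟩
      rw [← e', ← e, V.symm_apply_apply]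
      exact emb_mul_orbitRep_zero δ n i
    · exact ⟨y, hy, by rw [← e]; exact H.emb_mul_orbitRep_one δ n i⟩
  have hB' := mul_integral (integral_mul hB h₁.1) h₂.1
  rw [← Units.val_mul, ← Units.val_mul, ← h] at hB'
  have hrow : ∀ i, γ.1 i ∈ rowLattice δ := by
    intro i
    obtain ⟨y, hy, e⟩ := hB' i 1
    rw [H.emb_mul_orbitRep_one] at e
    exact (ht _).2 ⟨y, hy, e⟩
  have hent : ∀ i j, ‖(γ * δ⁻¹).1 i j‖ ≤ 1 := fun i j => hrow i j
  have hdet : ‖(γ * δ⁻¹).1.det‖ ≤ 1 := det_mem_of_integral (O := PadicInt.subring p) hent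
  have hγδ : γ.1.det = (γ * δ⁻¹).1.det * δ.1.det := by
    rw [← Matrix.det_mul, ← Units.val_mul, inv_mul_cancel_right]
  have hδ0 : δ.1.det ≠ 0 := (Matrix.GeneralLinearGroup.det δ).ne_zero
  have e1 : c (γ.1.det * (p : ℚ_[p]) ^ m) = (k₁ * k₂).1.det * c (δ.1.det * (p : ℚ_[p]) ^ n) := by
    rw [← det_emb_mul_orbitRep (V := V), ← det_emb_mul_orbitRep (V := V), h]
    simp only [Units.val_mul, Matrix.det_mul]
    ring
  have e2 : c (δ.1.det * (p : ℚ_[p]) ^ n) =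
      ((k₁ * k₂)⁻¹).1.det * c (γ.1.det * (p : ℚ_[p]) ^ m) := by
    rw [e1, ← mul_assoc, ← Matrix.det_mul, ← Units.val_mul, inv_mul_cancel, Units.val_one,
      Matrix.det_one, one_mul]
  have hk := (integralGL O).mul_mem h₁ h₂
  have hn := (H.norm_det_of_mem ((integralGL O).inv_mem hk) e2)
  have hn' := (H.norm_det_of_mem hk e1)
  have hδn : 0 < ‖δ.1.det‖ := norm_pos_iff.2 hδ0
  rw [hγδ, norm_mul, norm_mul, norm_mul, mul_right_comm, mul_comm ‖δ.1.det‖] at hn hn'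
  have hn := le_of_mul_le_mul_right hn hδn
  have hn' := le_of_mul_le_mul_right hn' hδn
  refine ⟨norm_pow_le_iff (hn.trans (mul_le_of_le_one_left (norm_nonneg _) hdet)), ?_⟩
  rintro rfl
  refine mem_gl2Zp_of_det hent (hdet.antisymm ?_)
  have hpm : 0 < ‖(p : ℚ_[p]) ^ m‖ := norm_pos_iff.2 (pow_ne_zero _ (cast_prime_ne_zero p))
  exact le_of_mul_le_mul_right (by rwa [one_mul]) hpm

/-- The vector is the generator `t` itself: an ideal containing `t` contains `tO`. -/
theorem goodLattice_vec {n : ℕ} {δ : GL (Fin 2) ℚ_[p]} (hδ : GoodLattice O V n δ) :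
    ∃ v ∈ rowLattice δ, ∀ δ', GoodLattice O V n δ' → v ∈ rowLattice δ' →
      rowLattice δ ⊆ rowLattice δ' := by
  obtain ⟨t, ht, -⟩ := hδ
  refine ⟨V.symm t, (ht _).2 ⟨1, O.one_mem, by simp⟩, ?_⟩
  rintro δ' ⟨t', ht', -⟩ hv w hw
  obtain ⟨y, hy, e⟩ := (ht' _).1 hv
  obtain ⟨z, hz, e'⟩ := (ht _).1 hw
  rw [V.apply_symm_apply] at e
  exact (ht' _).2 ⟨y * z, O.mul_mem hy hz, by rw [e', e, mul_assoc]⟩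

/-- Elements of `GL₂(ℤ_p)` stabilising the coset of `orbitRep V n`. -/
theorem stabilizer_mem (H : QuadBasis O V T M) {n : ℕ} {h : GL (Fin 2) ℚ_[p]} (hh : h ∈ GL2Zp p)
    {y : A} (hy : y ∈ O) (e : V (h.1 0) - V ![1, 0] * V (h.1 1) = c ((p : ℚ_[p]) ^ n) * y) :
    (orbitRep V n)⁻¹ * (embGL p A h * orbitRep V n) ∈ integralGL O := by
  have hmem : ∀ a : ℚ_[p], ‖a‖ ≤ 1 → c a ∈ O := fun a => (H.algebraMap_mem_iff a).2
  have hpn : c ((p : ℚ_[p]) ^ n)⁻¹ * c ((p : ℚ_[p]) ^ n) = 1 := by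
    rw [← map_mul, inv_mul_cancel₀ (pow_ne_zero _ (cast_prime_ne_zero p)), map_one]
  have hpO : c ((p : ℚ_[p]) ^ n) ∈ O := hmem _ (by
    rw [norm_pow]
    exact pow_le_one₀ (norm_nonneg _) Padic.norm_p_lt_one.le)
  have hdet : ((orbitRep V n)⁻¹ * (embGL p A h * orbitRep V n)).1.det * c (h⁻¹).1.det = 1 := by
    rw [Units.val_mul, Matrix.det_mul, det_emb_mul_orbitRep, orbitRep_inv_val,
      Matrix.det_fin_two_of, mul_comm (h.1.det), map_mul]
    have h1 : c h.1.det * c (h⁻¹).1.det = 1 := by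
      rw [← map_mul, ← Matrix.det_mul, ← Units.val_mul, mul_inv_cancel, Units.val_one,
        Matrix.det_one, map_one]
    linear_combination (c h.1.det * c (h⁻¹).1.det) * hpn + h1
  refine mem_integralGL_of_det ?_ (hmem _ (det_mem_of_integral (O := PadicInt.subring p) hh.2)) hdet
  -- The conjugate has rows `(h₀₀ - ω h₁₀, y)` and `(p^n h₁₀, V(h₁))`, where `h₁` is the second row
  -- of `h`. Only the upper right entry could fail to be integral, and the congruence `e` is its
  -- integrality.
  intro i j
  rw [Units.val_mul, Matrix.mul_apply, Fin.sum_univ_two, orbitRep_inv_val]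
  fin_cases j
  · change _ * (embGL p A h * orbitRep V n).1 0 0 + _ * (embGL p A h * orbitRep V n).1 1 0 ∈ O
    rw [emb_mul_orbitRep_zero, emb_mul_orbitRep_zero]
    fin_cases i
    · have e1 : c ((p : ℚ_[p]) ^ n)⁻¹ * c ((p : ℚ_[p]) ^ n * h.1 0 0) +
          -(c ((p : ℚ_[p]) ^ n)⁻¹ * V ![1, 0]) * c ((p : ℚ_[p]) ^ n * h.1 1 0) =
          c (h.1 0 0) - V ![1, 0] * c (h.1 1 0) := by
        rw [map_mul, map_mul]
        linear_combination (c (h.1 0 0) - V ![1, 0] * c (h.1 1 0)) * hpn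
      change c ((p : ℚ_[p]) ^ n)⁻¹ * c ((p : ℚ_[p]) ^ n * h.1 0 0) +
        -(c ((p : ℚ_[p]) ^ n)⁻¹ * V ![1, 0]) * c ((p : ℚ_[p]) ^ n * h.1 1 0) ∈ O
      rw [e1]
      exact O.sub_mem (hmem _ (hh.1 0 0)) (O.mul_mem H.omega_mem (hmem _ (hh.1 1 0)))
    · change 0 * c ((p : ℚ_[p]) ^ n * h.1 0 0) + 1 * c ((p : ℚ_[p]) ^ n * h.1 1 0) ∈ O
      rw [zero_mul, zero_add, one_mul, map_mul]
      exact O.mul_mem hpO (hmem _ (hh.1 1 0))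
  · change _ * (embGL p A h * orbitRep V n).1 0 1 + _ * (embGL p A h * orbitRep V n).1 1 1 ∈ O
    rw [H.emb_mul_orbitRep_one, H.emb_mul_orbitRep_one]
    fin_cases i
    · change c ((p : ℚ_[p]) ^ n)⁻¹ * V (h.1 0) +
        -(c ((p : ℚ_[p]) ^ n)⁻¹ * V ![1, 0]) * V (h.1 1) ∈ O
      have e1 : c ((p : ℚ_[p]) ^ n)⁻¹ * V (h.1 0) +
          -(c ((p : ℚ_[p]) ^ n)⁻¹ * V ![1, 0]) * V (h.1 1) = y := by
        linear_combination c ((p : ℚ_[p]) ^ n)⁻¹ * e + y * hpn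
      rw [e1]
      exact hy
    · change 0 * V (h.1 0) + 1 * V (h.1 1) ∈ O
      rw [zero_mul, zero_add, one_mul, H.mem_iff]
      exact hh.1 1

/-- The Cartan decomposition of `GL₂(A)`. -/
theorem exists_cartan (H : QuadBasis O V T M) (g : Matrix (Fin 2) (Fin 2) A) :
    ∃ k₁ ∈ integralGL O, k₁.1.det = 1 ∧ ∃ k₂ ∈ integralGL O, k₂.1.det = 1 ∧
      ∃ t : A, ∃ y ∈ O, g = k₁.1 * !![t, 0; 0, t * y] * k₂.1 := by
  -- A column operation of determinant one replaces the first row by its common divisor and zero.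
  have hcol : ∀ g : Matrix (Fin 2) (Fin 2) A, ∃ k ∈ integralGL O, k.1.det = 1 ∧
      ∃ a e f : A, g = !![a, 0; e, f] * k.1 := by
    intro g
    obtain ⟨x, hx, r, hr, s, hs, -, h2⟩ := H.exists_gcd (g 0 0) (g 0 1)
    obtain ⟨k, hk, hk'⟩ := exists_integralGL (O := O) (a := 1 - s * x) (b := s) (e := -x) (f := 1)
      (d := 1) (O.sub_mem O.one_mem (O.mul_mem hs hx)) hs (O.neg_mem hx) O.one_mem O.one_mem
      (by ring)
    refine ⟨k, hk, by rw [hk', Matrix.det_fin_two_of]; ring, g 0 0 + x * g 0 1,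
      g 1 0 + x * g 1 1, g 1 1 - s * (g 1 0 + x * g 1 1), ?_⟩
    rw [hk', Matrix.mul_fin_two, ← Matrix.ext_iff, Fin.forall_fin_two, Fin.forall_fin_two,
      Fin.forall_fin_two]
    refine ⟨⟨?_, ?_⟩, ?_, ?_⟩
    · change g 0 0 = (g 0 0 + x * g 0 1) * (1 - s * x) + 0 * (-x)
      linear_combination (-x) * h2
    · change g 0 1 = (g 0 0 + x * g 0 1) * s + 0 * 1
      linear_combination h2
    · change g 1 0 = (g 1 0 + x * g 1 1) * (1 - s * x) +
        (g 1 1 - s * (g 1 0 + x * g 1 1)) * (-x)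
      ring
    · change g 1 1 = (g 1 0 + x * g 1 1) * s + (g 1 1 - s * (g 1 0 + x * g 1 1)) * 1
      ring
  obtain ⟨k, hk, hk1, a, e, f, hg⟩ := hcol g
  obtain ⟨x₂, hx₂, r₂, -, s₂, hs₂, he₂, hf₂⟩ := H.exists_gcd e f
  obtain ⟨x₃, hx₃, r₃, hr₃, s₃, hs₃, ha₃, hb₃⟩ := H.exists_gcd a (e + x₂ * f)
  -- Here `b` divides `e` and `f`, and `t` divides `a` and `b`, so `t` divides every entry and
  -- becomes the first elementary divisor. The unipotent products `k₁` and `k₂` undo the operations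
  -- that place it in the corner and clear its row and column.
  set b := e + x₂ * f with hb
  set t := a + x₃ * b with ht
  have hq : x₃ * s₃ * s₂ ∈ O := O.mul_mem (O.mul_mem hx₃ hs₃) hs₂
  obtain ⟨k₁, h₁, e₁⟩ := exists_integralGL (O := O) (a := 1 - x₃ * s₃) (b := -x₃) (e := s₃) (f := 1)
    (d := 1) (O.sub_mem O.one_mem (O.mul_mem hx₃ hs₃)) (O.neg_mem hx₃) hs₃ O.one_mem O.one_mem
    (by ring)
  obtain ⟨k₂, h₂, e₂⟩ := exists_integralGL (O := O) (a := 1 - x₃ * s₃ * s₂ * x₂)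
    (b := x₃ * s₃ * s₂) (e := -x₂) (f := 1)
    (d := 1) (O.sub_mem O.one_mem (O.mul_mem hq hx₂)) hq (O.neg_mem hx₂) O.one_mem O.one_mem
    (by ring)
  refine ⟨k₁, h₁, by rw [e₁, Matrix.det_fin_two_of]; ring, k₂ * k, mul_mem h₂ hk, ?_, t,
    s₃ * s₂ * (1 - s₃ * x₃), O.mul_mem (O.mul_mem hs₃ hs₂)
      (O.sub_mem O.one_mem (O.mul_mem hs₃ hx₃)), ?_⟩
  · rw [Units.val_mul, Matrix.det_mul, hk1, e₂, Matrix.det_fin_two_of]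
    ring
  · rw [hg, Units.val_mul, ← mul_assoc]
    congr 1
    rw [e₁, e₂, Matrix.mul_fin_two, Matrix.mul_fin_two]
    have hft : f = t * s₃ * s₂ := by rw [← hb₃]; exact hf₂
    have hat : a = t - x₃ * (t * s₃) := by rw [← hb₃, ht]; ring
    have het : e = t * s₃ - x₂ * (t * s₃ * s₂) := by rw [← hft, ← hb₃, hb]; ring
    rw [hft, hat, het]
    clear_value t
    refine fin_two_congr ?_ ?_ ?_ ?_ <;> ring

/-- Write `g = κ₁ D κ₂` with `D` diagonal. The matrix `U = diag(det k⁻¹, 1)` commutes with `D`, so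
multiplying `g` by `κ₁Uκ₁⁻¹` on the left equals multiplying it by `κ₂⁻¹Uκ₂` on the right. This moves
the determinant of `k` to the right-hand factor. -/
theorem exists_swap (H : QuadBasis O V T M) {k : GL (Fin 2) A} (hk : k ∈ integralGL O)
    (g : GL (Fin 2) A) : ∃ k₁ ∈ integralGL O, k₁.1.det = 1 ∧ ∃ k₂ ∈ integralGL O,
      k * g = k₁ * g * k₂ := by
  obtain ⟨κ₁, h₁, -, κ₂, h₂, -, t, y, -, hg⟩ := H.exists_cartan g.1
  have hdet : k.1.det * (k⁻¹).1.det = 1 := by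
    rw [← Matrix.det_mul, ← Units.val_mul, mul_inv_cancel, Units.val_one, Matrix.det_one]
  obtain ⟨U, hU, eU⟩ := exists_integralGL (O := O) (a := (k⁻¹).1.det) (b := 0) (e := 0) (f := 1)
    (d := k.1.det) (det_mem_of_integral hk.2) O.zero_mem O.zero_mem O.one_mem
    (det_mem_of_integral hk.1) (by linear_combination hdet)
  obtain ⟨D, hD⟩ : ∃ D, g = κ₁ * D * κ₂ := ⟨κ₁⁻¹ * g * κ₂⁻¹, by group⟩
  have hDm : D.1 = !![t, 0; 0, t * y] := by
    have h3 : κ₁.1 * D.1 * κ₂.1 = κ₁.1 * !![t, 0; 0, t * y] * κ₂.1 := by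
      rw [← hg, hD]
      rfl
    have h4 := κ₁.isUnit.mul_left_cancel (κ₂.isUnit.mul_right_cancel h3)
    exact h4
  have hcomm : U * D = D * U := by
    apply Units.ext
    rw [Units.val_mul, Units.val_mul, eU, hDm, Matrix.mul_fin_two, Matrix.mul_fin_two]
    simp [mul_comm]
  refine ⟨k * κ₁ * U * κ₁⁻¹, mul_mem (mul_mem (mul_mem hk h₁) hU) (inv_mem h₁), ?_,
    κ₂⁻¹ * U⁻¹ * κ₂, mul_mem (mul_mem (inv_mem h₂) (inv_mem hU)) h₂, ?_⟩
  · have h3 : κ₁.1.det * (κ₁⁻¹).1.det = 1 := by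
      rw [← Matrix.det_mul, ← Units.val_mul, mul_inv_cancel, Units.val_one, Matrix.det_one]
    simp only [Units.val_mul, Matrix.det_mul, eU, Matrix.det_fin_two_of]
    linear_combination (k.1.det * (k⁻¹).1.det) * h3 + hdet
  · rw [hD]
    have h5 : k * κ₁ * U * κ₁⁻¹ * (κ₁ * D * κ₂) * (κ₂⁻¹ * U⁻¹ * κ₂) =
        k * κ₁ * (U * D) * U⁻¹ * κ₂ := by group
    rw [h5, hcomm]
    group

end QuadBasis

end Matrices

/-! ### Double cosets of good lattices and orbits of `GL₂(ℚ_p)` -/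

section Orbits

variable {p : ℕ} [Fact p.Prime] {A : Type*} [CommRing A] [Algebra ℚ_[p] A]

local notation "c" => algebraMap ℚ_[p] A

namespace QuadBasis

variable {O : Subring A} {V : (Fin 2 → ℚ_[p]) ≃ₗ[ℚ_[p]] A} {T M : ℚ_[p]}

theorem exists_pow_mul_unit {x : ℚ_[p]} (hx : x ≠ 0) (h1 : ‖x‖ ≤ 1) :
    ∃ (n : ℕ) (u : ℚ_[p]), ‖u‖ = 1 ∧ x = p ^ n * u := by
  let x' : ℤ_[p] := ⟨x, h1⟩
  have hx' : x' ≠ 0 := fun h => hx (congrArg Subtype.val h)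
  refine ⟨x'.valuation, PadicInt.unitCoeff hx', PadicInt.norm_units _, ?_⟩
  have := congrArg Subtype.val (PadicInt.unitCoeff_spec hx')
  rw [mul_comm]
  simpa using this

/-- The matrix of multiplication by `t`, as acting on row vectors. -/
theorem exists_mulMatrix (H : QuadBasis O V T M) {t : A} (ht : H.nrm t ≠ 0) :
    ∃ δ : GL (Fin 2) ℚ_[p], δ.1.det = H.nrm t ∧ V (δ.1 0) = t * V ![1, 0] ∧ V (δ.1 1) = t ∧
      ∀ v, V (Matrix.vecMul v δ.1) = t * V v := by
  set a := V.symm t 0 with ha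
  set b := V.symm t 1 with hb
  have hn : H.nrm t = a ^ 2 * M + a * b * T + b ^ 2 := rfl
  have hd : (a * T + b) * b - (-(a * M)) * a = H.nrm t := by
    rw [hn]
    ring
  -- The rows are the coordinates of `tω` and `t`, computed with `ω² = Tω - M`.
  obtain ⟨δ, hδ⟩ := exists_gl_padic (a := a * T + b) (b := -(a * M)) (e := a) (f := b)
    (by rwa [hd])
  have h0 : V (δ.1 0) = t * V ![1, 0] := by
    rw [hδ]
    change V ![a * T + b, -(a * M)] = _
    rw [H.apply]
    change c (a * T + b) * _ + c (-(a * M)) = _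
    conv_rhs => rw [H.decomp t]
    simp only [map_add, map_mul, map_neg]
    linear_combination (-c a) * H.omega_sq
  have h1 : V (δ.1 1) = t := by
    rw [hδ]
    change V ![a, b] = t
    rw [H.apply]
    exact (H.decomp t).symm
  refine ⟨δ, by rw [hδ, Matrix.det_fin_two_of, hd], h0, h1, fun v => ?_⟩
  have hv : Matrix.vecMul v δ.1 = v 0 • δ.1 0 + v 1 • δ.1 1 := by
    ext j
    simp [Matrix.vecMul, dotProduct, Fin.sum_univ_two]
  rw [hv, map_add, map_smul, map_smul, h0, h1, H.apply v, Algebra.smul_def, Algebra.smul_def]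
  ring

theorem mem_rowLattice_iff (H : QuadBasis O V T M) {t : A} {δ : GL (Fin 2) ℚ_[p]}
    (hδ : ∀ v, V (Matrix.vecMul v δ.1) = t * V v) (v : Fin 2 → ℚ_[p]) :
    v ∈ rowLattice δ ↔ ∃ y ∈ O, V v = t * y := by
  constructor
  · intro hv
    refine ⟨V (Matrix.vecMul v (δ⁻¹).1), (H.mem_iff _).2 hv, ?_⟩
    rw [← hδ, vecMul_vecMul_inv]
  · rintro ⟨y, hy, e⟩
    have h1 : v = Matrix.vecMul (V.symm y) δ.1 := by
      apply V.injective
      rw [e, hδ, V.apply_symm_apply]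
    rw [h1]
    intro i
    rw [vecMul_inv_vecMul]
    exact (H.mem_iff_symm y).1 hy i

/-- Every double coset has a representative attached to a good lattice. -/
theorem exists_goodLattice (H : QuadBasis O V T M) (g : GL (Fin 2) A) {d : ℚ_[p]}
    (hd : g.1.det = c d) : ∃ n δ, GoodLattice O V n δ ∧ ∃ k₁ ∈ integralGL O, k₁.1.det = 1 ∧
      ∃ k₂ ∈ integralGL O, g = k₁ * (embGL p A δ * orbitRep V n) * k₂ := by
  obtain ⟨k₁, h₁, hd₁, k₂, h₂, hd₂, t, y, hy, hg⟩ := H.exists_cartan g.1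
  have hty : t * (t * y) = c d := by
    rw [← hd, hg, Matrix.det_mul, Matrix.det_mul, hd₁, hd₂, Matrix.det_fin_two_of]
    ring
  have hd0 : d ≠ 0 := by
    rintro rfl
    rw [map_zero] at hd
    have h1 : g.1.det * (g⁻¹).1.det = 1 := by
      rw [← Matrix.det_mul, ← Units.val_mul, mul_inv_cancel, Units.val_one, Matrix.det_one]
    rw [hd, zero_mul, ← map_zero c, ← map_one c] at h1
    exact zero_ne_one (H.injective h1)
  have hnd : H.nrm t ^ 2 * H.nrm y = d ^ 2 := by
    rw [← H.nrm_algebraMap d, ← hty, H.nrm_mul, H.nrm_mul]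
    ring
  set ν := H.nrm t with hν
  have hν0 : ν ≠ 0 := by
    intro h0
    rw [h0, zero_pow two_ne_zero, zero_mul] at hnd
    exact hd0 (pow_eq_zero_iff two_ne_zero |>.1 hnd.symm)
  obtain ⟨t', ht'⟩ := H.isUnit_of_nrm_ne_zero hν0
  -- As `d = t²y` and `ν = N(t)`, one has `(d/ν)² = N(y)`, which is integral. The index `n` is the
  -- valuation of `d/ν`.
  have hdν : ‖d / ν‖ ≤ 1 := by
    have h1 : (d / ν) ^ 2 = H.nrm y := by
      rw [div_pow, ← hnd, mul_div_cancel_left₀ _ (pow_ne_zero 2 hν0)]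
    rw [← pow_le_one_iff_of_nonneg (norm_nonneg _) two_ne_zero, ← norm_pow, h1]
    exact H.norm_nrm_le hy
  obtain ⟨n, u, hu, hn⟩ := exists_pow_mul_unit (div_ne_zero hd0 hν0) hdν
  have hu0 : u ≠ 0 := by
    rw [← norm_ne_zero_iff, hu]
    exact one_ne_zero
  have hmem : ∀ a : ℚ_[p], ‖a‖ ≤ 1 → c a ∈ O := fun a => (H.algebraMap_mem_iff a).2
  have huO : c u⁻¹ ∈ O := hmem _ (by rw [norm_inv, hu, inv_one])
  have hpn : (p : ℚ_[p]) ^ n = u⁻¹ * (d / ν) := by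
    rw [hn]
    field_simp
  -- This identity makes `tO` good: up to the unit `u⁻¹`, `p^n σ(tz)` is `(d/ν)(tz - t̄z̄)θ⁻¹ =
  -- t((d/ν)z - yz̄)θ⁻¹`.
  have htν : c (d / ν) * H.conj t = t * y := by
    have h1 : t * H.conj t = c ν := H.mul_conj t
    have h2 : t * (c (d / ν) * H.conj t) = t * (t * y) := by
      rw [hty, mul_left_comm, h1, ← map_mul, div_mul_cancel₀ _ hν0]
    rw [← ht'] at h2 ⊢
    exact t'.isUnit.mul_left_cancel h2
  have hgood : ∀ z ∈ O, ∃ z' ∈ O, c ((p : ℚ_[p]) ^ n * V.symm (t * z) 0) = t * z' := by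
    intro z hz
    refine ⟨c u⁻¹ * (c (d / ν) * z - y * H.conj z) * H.thetaInv,
      O.mul_mem (O.mul_mem huO (O.sub_mem (O.mul_mem (hmem _ hdν) hz)
        (O.mul_mem hy (H.conj_mem hz)))) H.thetaInv_mem, ?_⟩
    rw [hpn, map_mul, map_mul, H.coord_eq, map_mul]
    linear_combination (-c u⁻¹ * H.conj z * H.thetaInv) * htν
  obtain ⟨δ, hδd, hδ0, hδ1, hδ⟩ := H.exists_mulMatrix hν0
  refine ⟨n, δ, ⟨t', fun v => by rw [ht']; exact H.mem_rowLattice_iff hδ v, by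
    rw [ht']
    exact hgood⟩, ?_⟩
  obtain ⟨q, hq, hq'⟩ := hgood 1 O.one_mem
  rw [mul_one] at hq'
  set X := embGL p A δ * orbitRep V n with hX
  have hX01 : X.1 0 1 = t * V ![1, 0] := by rw [hX, H.emb_mul_orbitRep_one, hδ0]
  have hX11 : X.1 1 1 = t := by rw [hX, H.emb_mul_orbitRep_one, hδ1]
  have hX10 : X.1 1 0 = t * q := by
    rw [hX, emb_mul_orbitRep_zero, ← hq']
    conv_rhs => rw [← hδ1]
    rw [V.symm_apply_apply]
  have hX00 : X.1 0 0 = t * y * c u⁻¹ + V ![1, 0] * (t * q) := by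
    have h1 : X.1.det = c (ν * (p : ℚ_[p]) ^ n) := by rw [hX, det_emb_mul_orbitRep, hδd]
    rw [Matrix.det_fin_two, hX01, hX11, hX10, hpn] at h1
    have h2 : c (ν * (u⁻¹ * (d / ν))) = c u⁻¹ * (t * (t * y)) := by
      rw [hty, ← map_mul]
      congr 1
      field_simp
    rw [h2] at h1
    have h3 : t * X.1 0 0 = t * (t * y * c u⁻¹ + V ![1, 0] * (t * q)) := by
      linear_combination h1
    rw [← ht'] at h3 ⊢
    exact t'.isUnit.mul_left_cancel h3
  have hcu : c u * c u⁻¹ = 1 := by rw [← map_mul, mul_inv_cancel₀ hu0, map_one]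
  -- The second column of `X` is `(tω, t)`. The row operation `P` turns `X` into a lower triangular
  -- matrix up to an exchange of columns, with rows `(tq, t)` and `(-tyu⁻¹, 0)`, and `Q` brings this
  -- to `diag(t, ty)`.
  obtain ⟨P, hP, eP⟩ := exists_integralGL (O := O) (a := 0) (b := 1) (e := -1) (f := V ![1, 0])
    (d := 1) O.zero_mem O.one_mem (O.neg_mem O.one_mem) H.omega_mem O.one_mem (by ring)
  obtain ⟨Q, hQ, eQ⟩ := exists_integralGL (O := O) (a := 0) (b := -c u) (e := 1) (f := q * c u)
    (d := c u⁻¹) O.zero_mem (O.neg_mem (hmem _ hu.le)) O.one_mem (O.mul_mem hq (hmem _ hu.le)) huO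
    (by linear_combination hcu)
  refine ⟨k₁ * P, mul_mem h₁ hP, ?_, Q * k₂, mul_mem hQ h₂, ?_⟩
  · rw [Units.val_mul, Matrix.det_mul, hd₁, eP, Matrix.det_fin_two_of]
    ring
  · have hPXQ : P.1 * X.1 * Q.1 = !![t, 0; 0, t * y] := by
      rw [Matrix.eta_fin_two X.1, hX00, hX01, hX10, hX11, eP, eQ, Matrix.mul_fin_two,
        Matrix.mul_fin_two]
      refine fin_two_congr ?_ ?_ ?_ ?_
      · ring
      · ring
      · ring
      · linear_combination (t * y) * hcu
    apply Units.ext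
    rw [hg, ← hPXQ]
    simp only [Units.val_mul, mul_assoc]

/-- The skew-hermitian form `u₀ v̄₁ - u₁ v̄₀`. -/
noncomputable def skew (H : QuadBasis O V T M) (u v : Fin 2 → A) : A :=
  u 0 * H.conj (v 1) - u 1 * H.conj (v 0)

theorem conj_theta (H : QuadBasis O V T M) : H.conj H.theta = -H.theta := by
  simp only [theta, map_sub, map_mul, map_ofNat, H.conj_omega, H.conj_algebraMap]
  ring

theorem add_conj (H : QuadBasis O V T M) (z : A) :
    z + H.conj z = c (V.symm z 0 * T + 2 * V.symm z 1) := by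
  conv_lhs => rw [H.decomp z, H.conj_coord]
  simp only [map_add, map_mul, map_neg, map_ofNat]
  ring

/-- For `u_i = a_i ω + b_i` this is `(a₀b₁ - b₀a₁)(ω - ω̄)`. A column of nonzero length is therefore
`γ(ω, 1)ᵗ` with `γ ∈ GL₂(ℚ_p)`. -/
theorem skew_self (H : QuadBasis O V T M) (u : Fin 2 → A) :
    H.skew u u = c (V.symm (u 0) 0 * V.symm (u 1) 1 - V.symm (u 0) 1 * V.symm (u 1) 0) *
      H.theta := by
  conv_lhs => rw [skew, H.decomp (u 0), H.decomp (u 1), H.conj_coord, H.conj_coord]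
  simp only [theta, map_add, map_mul, map_neg, map_sub]
  ring

theorem norm_add_eq_one {x y : ℚ_[p]} (hx : ‖x‖ < 1) (hy : ‖y‖ = 1) : ‖x + y‖ = 1 := by
  rw [Padic.add_eq_max_of_ne (by rw [hy]; exact hx.ne), hy, max_eq_right hx.le]

/-- The trace form is unimodular. If the traces of `β` and `ωβ` were both divisible by `p`, so would
be both coordinates of `β`, since the determinant of the linear system is the discriminant up to
sign. Hence `y = 1` or `y = ω` works. -/
theorem exists_norm_trace_eq_one (H : QuadBasis O V T M) {β : A} (hβ : β ∈ O) {i : Fin 2}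
    (hi : ‖V.symm β i‖ = 1) : ∃ y ∈ O, ∃ τ : ℚ_[p], ‖τ‖ = 1 ∧ y * β + H.conj (y * β) = c τ := by
  by_contra hcon
  push Not at hcon
  have htr : ∀ z, z ∈ O → ‖V.symm z 0 * T + 2 * V.symm z 1‖ ≤ 1 := by
    intro z hz
    rw [← H.algebraMap_mem_iff, ← H.add_conj]
    exact O.add_mem hz (H.conj_mem hz)
  set a := V.symm β 0 with ha
  set b := V.symm β 1 with hb
  have h1 : ‖a * T + 2 * b‖ < 1 := by
    refine lt_of_le_of_ne (htr β hβ) fun h => hcon 1 O.one_mem _ h ?_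
    rw [one_mul, H.add_conj]
  have hωβ : V.symm (V ![1, 0] * β) = ![a * T + b, -(a * M)] := by
    rw [V.symm_apply_eq, H.apply ![a * T + b, -(a * M)]]
    change _ = c (a * T + b) * _ + c (-(a * M))
    conv_lhs => rw [H.decomp β]
    simp only [map_add, map_mul, map_neg]
    linear_combination c a * H.omega_sq
  have h2 : ‖(a * T + b) * T + 2 * (-(a * M))‖ < 1 := by
    have h3 := H.add_conj (V ![1, 0] * β)
    have h4 := htr _ (O.mul_mem H.omega_mem hβ)
    rw [hωβ] at h3 h4
    exact lt_of_le_of_ne h4 fun h => hcon _ H.omega_mem _ h h3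
  have hsmall : ∀ x y : ℚ_[p], ‖x‖ ≤ 1 → ‖y‖ < 1 → ‖x * y‖ < 1 := fun x y hx hy => by
    rw [norm_mul]
    nlinarith [norm_nonneg x, norm_nonneg y]
  have hT2 : ‖T ^ 2 - 2 * M‖ ≤ 1 := by
    have : T ^ 2 - 2 * M ∈ PadicInt.subring p :=
      sub_mem (pow_mem (show T ∈ PadicInt.subring p from H.norm_T) 2)
        (mul_mem (ofNat_mem _ 2) (show M ∈ PadicInt.subring p from H.norm_M))
    exact this
  have h2' : ‖(-2 : ℚ_[p])‖ ≤ 1 := by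
    have : (-2 : ℚ_[p]) ∈ PadicInt.subring p := neg_mem (ofNat_mem _ 2)
    exact this
  have hadd : ∀ x y : ℚ_[p], ‖x‖ < 1 → ‖y‖ < 1 → ‖x + y‖ < 1 := fun x y hx hy =>
    (Padic.nonarchimedean x y).trans_lt (max_lt hx hy)
  have hD : ∀ x : ℚ_[p], ‖x * (T ^ 2 - 4 * M)‖ = ‖x‖ := fun x => by
    rw [norm_mul, H.norm_disc, mul_one]
  have ha1 : ‖a‖ < 1 := by
    have e : a * (T ^ 2 - 4 * M) = -T * (a * T + 2 * b) +
        (-(-2)) * ((a * T + b) * T + 2 * (-(a * M))) := by ring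
    rw [← hD, e]
    exact hadd _ _ (hsmall _ _ (by rw [norm_neg]; exact H.norm_T) h1)
      (hsmall _ _ (by rw [norm_neg]; exact h2') h2)
  have hb1 : ‖b‖ < 1 := by
    have e : b * (T ^ 2 - 4 * M) = (T ^ 2 - 2 * M) * (a * T + 2 * b) +
        -T * ((a * T + b) * T + 2 * (-(a * M))) := by ring
    rw [← hD, e]
    exact hadd _ _ (hsmall _ _ hT2 h1) (hsmall _ _ (by rw [norm_neg]; exact H.norm_T) h2)
  fin_cases i
  · exact absurd hi ha1.ne
  · exact absurd hi hb1.ne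

/-- The form is nondegenerate: a second column orthogonal to both columns vanishes, which
contradicts invertibility unless the ring is zero. -/
theorem skew_ne_zero (H : QuadBasis O V T M) (g : GL (Fin 2) A)
    (h01 : H.skew (fun i => g.1 i 0) (fun i => g.1 i 1) = 0)
    (h11 : H.skew (fun i => g.1 i 1) (fun i => g.1 i 1) = 0) : (1 : A) = 0 := by
  simp only [skew] at h01 h11
  obtain ⟨d, hd⟩ : ∃ d, g.1.det * d = 1 := ⟨(g⁻¹).1.det, by
    rw [← Matrix.det_mul, ← Units.val_mul, mul_inv_cancel, Units.val_one, Matrix.det_one]⟩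
  have h1 : g.1.det * H.conj (g.1 1 1) = 0 := by
    rw [Matrix.det_fin_two]
    linear_combination g.1 1 1 * h01 - g.1 1 0 * h11
  have h0 : g.1.det * H.conj (g.1 0 1) = 0 := by
    rw [Matrix.det_fin_two]
    linear_combination g.1 0 1 * h01 - g.1 0 0 * h11
  have hconj : ∀ z, g.1.det * H.conj z = 0 → z = 0 := fun z hz => by
    have hz' : H.conj z = 0 := by linear_combination d * hz - H.conj z * hd
    rw [← H.conj_conj z, hz', map_zero]
  have h1' := hconj _ h1
  have h0' := hconj _ h0
  rw [Matrix.det_fin_two, h1', h0'] at hd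
  linear_combination -hd

/-- A column of maximal length for the skew-hermitian form. -/
theorem exists_gram (H : QuadBasis O V T M) (g : GL (Fin 2) A) : ∃ κ ∈ integralGL O,
    κ.1.det = 1 ∧ ∃ D : ℚ_[p], D ≠ 0 ∧
      H.skew (fun i => (g * κ).1 i 1) (fun i => (g * κ).1 i 1) = c D * H.theta ∧
      ∃ x ∈ O, H.skew (fun i => (g * κ).1 i 0) (fun i => (g * κ).1 i 1) = c D * H.theta * x := by
  have hone : (1 : A) ≠ 0 := fun h => by
    rw [← map_one c, ← map_zero c] at h
    exact one_ne_zero (H.injective h)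
  have hmem : ∀ a : ℚ_[p], ‖a‖ ≤ 1 → c a ∈ O := fun a => (H.algebraMap_mem_iff a).2
  -- Divided by `θ`, the Gram matrix of the columns has diagonal `α`, `δ` and off-diagonal entry
  -- `β`, with `l` a largest coordinate of `β`. The second column serves if `δ` dominates `l`, the
  -- first if `α` does; otherwise a combination of the two is needed.
  obtain ⟨α, hα⟩ : ∃ α : ℚ_[p],
    H.skew (fun i => g.1 i 0) (fun i => g.1 i 0) = c α * H.theta := ⟨_, H.skew_self _⟩
  obtain ⟨δ, hδ⟩ : ∃ δ : ℚ_[p],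
    H.skew (fun i => g.1 i 1) (fun i => g.1 i 1) = c δ * H.theta := ⟨_, H.skew_self _⟩
  obtain ⟨β, hβ⟩ : ∃ β : A, H.skew (fun i => g.1 i 0) (fun i => g.1 i 1) = β * H.theta :=
    ⟨H.skew (fun i => g.1 i 0) (fun i => g.1 i 1) * H.thetaInv, by
      rw [mul_assoc, mul_comm H.thetaInv, H.theta_mul_thetaInv, mul_one]⟩
  have hβ' : H.skew (fun i => g.1 i 1) (fun i => g.1 i 0) = H.conj β * H.theta := by
    have h1 := congrArg H.conj hβ
    simp only [skew, map_sub, map_mul, H.conj_conj, H.conj_theta] at h1 ⊢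
    linear_combination -h1
  obtain ⟨i, hmax⟩ : ∃ i, ∀ j, ‖V.symm β j‖ ≤ ‖V.symm β i‖ := by
    rcases le_total ‖V.symm β 0‖ ‖V.symm β 1‖ with h | h
    · exact ⟨1, Fin.forall_fin_two.2 ⟨h, le_rfl⟩⟩
    · exact ⟨0, Fin.forall_fin_two.2 ⟨le_rfl, h⟩⟩
  set l := V.symm β i with hl
  have hdiv : ∀ D : ℚ_[p], D ≠ 0 → ‖l‖ ≤ ‖D‖ → ∃ x ∈ O, β = c D * x := by
    intro D hD hlD
    refine ⟨c D⁻¹ * β, ?_, ?_⟩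
    · rw [H.mem_iff_symm]
      intro j
      rw [← Algebra.smul_def, map_smul, Pi.smul_apply, smul_eq_mul, norm_mul, norm_inv,
        inv_mul_le_one₀ (norm_pos_iff.2 hD)]
      exact (hmax j).trans hlD
    · rw [← mul_assoc, ← map_mul, mul_inv_cancel₀ hD, map_one, one_mul]
  by_cases hcδ : δ ≠ 0 ∧ ‖l‖ ≤ ‖δ‖
  · obtain ⟨x, hx, e⟩ := hdiv δ hcδ.1 hcδ.2
    refine ⟨1, one_mem _, by simp, δ, hcδ.1, by rw [mul_one, hδ], x, hx, ?_⟩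
    rw [mul_one, hβ, e]
    ring
  by_cases hcα : α ≠ 0 ∧ ‖l‖ ≤ ‖α‖
  · obtain ⟨x, hx, e⟩ := hdiv α hcα.1 hcα.2
    obtain ⟨κ, hκ, eκ⟩ := exists_integralGL (O := O) (a := 0) (b := 1) (e := -1) (f := 0)
      (d := 1) O.zero_mem O.one_mem (O.neg_mem O.one_mem) O.zero_mem O.one_mem (by ring)
    have e0 : ∀ j, (g * κ).1 j 0 = -g.1 j 1 := fun j => by
      rw [Units.val_mul, Matrix.mul_apply, Fin.sum_univ_two, eκ]
      simp
    have e1 : ∀ j, (g * κ).1 j 1 = g.1 j 0 := fun j => by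
      rw [Units.val_mul, Matrix.mul_apply, Fin.sum_univ_two, eκ]
      simp
    refine ⟨κ, hκ, by rw [eκ, Matrix.det_fin_two_of]; ring, α, hcα.1, ?_, -H.conj x,
      O.neg_mem (H.conj_mem hx), ?_⟩
    · simp only [e1]
      exact hα
    · simp only [e0, e1]
      have h1 : H.conj β = c α * H.conj x := by rw [e, map_mul, H.conj_algebraMap]
      simp only [skew] at hβ' ⊢
      linear_combination -hβ' - H.theta * h1
  · have hl0 : l ≠ 0 := by
      intro h0
      have hβ0 : β = 0 := by
        apply V.symm.map_eq_zero_iff.1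
        ext j
        exact norm_le_zero_iff.1 ((hmax j).trans (by rw [h0, norm_zero]))
      have hδ0 : δ = 0 := by
        by_contra h
        exact hcδ ⟨h, by rw [h0, norm_zero]; exact norm_nonneg _⟩
      exact hone (H.skew_ne_zero g (by rw [hβ, hβ0, zero_mul])
        (by rw [hδ, hδ0, map_zero, zero_mul]))
    have hlt : ∀ D : ℚ_[p], ¬ (D ≠ 0 ∧ ‖l‖ ≤ ‖D‖) → ‖D / l‖ < 1 := by
      intro D h
      rw [norm_div, div_lt_one (norm_pos_iff.2 hl0)]
      by_contra hc
      push Not at hc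
      refine h ⟨?_, hc⟩
      rintro rfl
      rw [norm_zero] at hc
      exact hl0 (norm_le_zero_iff.1 hc)
    have hδl := hlt δ hcδ
    have hαl := hlt α hcα
    obtain ⟨β₀, hβ₀, eβ⟩ := hdiv l hl0 le_rfl
    have hβi : ‖V.symm β₀ i‖ = 1 := by
      have h1 : l = l * V.symm β₀ i := by
        conv_lhs => rw [hl, eβ]
        rw [← Algebra.smul_def, map_smul]
        rfl
      rw [← mul_left_cancel₀ hl0 ((mul_one l).trans h1), norm_one]
    -- Adding `y` times the first column to the second gives the length `δ + N(y)α + tr(yβ)`. Both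
    -- `α` and `δ` are smaller than `l`, so it suffices that the trace of `yβ₀`, with `β = lβ₀`, be
    -- a unit.
    obtain ⟨y, hy, τ, hτ, eτ⟩ := H.exists_norm_trace_eq_one hβ₀ hβi
    set η := δ / l + H.nrm y * (α / l) + τ with hη
    have hη1 : ‖η‖ = 1 := by
      refine norm_add_eq_one ((Padic.nonarchimedean _ _).trans_lt (max_lt hδl ?_)) hτ
      rw [norm_mul]
      have := H.norm_nrm_le hy
      nlinarith [norm_nonneg (H.nrm y), norm_nonneg (α / l)]
    have hη0 : η ≠ 0 := by
      rw [← norm_ne_zero_iff, hη1]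
      exact one_ne_zero
    obtain ⟨κ, hκ, eκ⟩ := exists_integralGL (O := O) (a := 1) (b := y) (e := 0) (f := 1)
      (d := 1) O.one_mem hy O.zero_mem O.one_mem O.one_mem (by ring)
    have e0 : ∀ j, (g * κ).1 j 0 = g.1 j 0 := fun j => by
      rw [Units.val_mul, Matrix.mul_apply, Fin.sum_univ_two, eκ]
      simp
    have e1 : ∀ j, (g * κ).1 j 1 = g.1 j 0 * y + g.1 j 1 := fun j => by
      rw [Units.val_mul, Matrix.mul_apply, Fin.sum_univ_two, eκ]
      simp
    have hlη : c (l * η) = c δ + c (H.nrm y) * c α + c l * c τ := by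
      rw [← map_mul, ← map_mul, ← map_add, ← map_add]
      congr 1
      rw [hη]
      field_simp
    have hcη : c η * c η⁻¹ = 1 := by rw [← map_mul, mul_inv_cancel₀ hη0, map_one]
    have hcl : c l * c (α / l) = c α := by rw [← map_mul, mul_div_cancel₀ _ hl0]
    have hny := H.mul_conj y
    refine ⟨κ, hκ, by rw [eκ, Matrix.det_fin_two_of]; ring, l * η, mul_ne_zero hl0 hη0, ?_,
      c η⁻¹ * (β₀ + H.conj y * c (α / l)), O.mul_mem (hmem _ (by rw [norm_inv, hη1, inv_one]))
        (O.add_mem hβ₀ (O.mul_mem (H.conj_mem hy) (hmem _ hαl.le))), ?_⟩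
    · simp only [e1]
      rw [hlη, ← eτ, ← hny]
      rw [eβ] at hβ hβ'
      simp only [skew, map_add, map_mul, H.conj_algebraMap] at hα hβ hβ' hδ ⊢
      linear_combination y * H.conj y * hα + y * hβ + H.conj y * hβ' + hδ
    · simp only [e0, e1]
      rw [eβ] at hβ
      rw [map_mul]
      simp only [skew, map_add, map_mul] at hα hβ ⊢
      linear_combination H.conj y * hα + hβ - (c l * H.theta * (β₀ + H.conj y * c (α / l))) * hcη -
        (H.theta * H.conj y) * hcl

/-- Every element of `GL₂(A)` with determinant in `ℚ_p` lies in `GL₂(ℚ_p) x_n GL₂(O)` for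
some `n`. -/
theorem exists_orbit (H : QuadBasis O V T M) (g : GL (Fin 2) A) {d : ℚ_[p]}
    (hd : g.1.det = c d) :
    ∃ γ n, ∃ k ∈ integralGL O, g = embGL p A γ * orbitRep V n * k := by
  obtain ⟨κ, hκ, hκ1, D, hD0, hD, x, hx, hDx⟩ := H.exists_gram g
  have hmem : ∀ a : ℚ_[p], ‖a‖ ≤ 1 → c a ∈ O := fun a => (H.algebraMap_mem_iff a).2
  -- Subtracting `x` times the second column makes the first column orthogonal to it; integrality of
  -- `x` is the purpose of choosing a column of maximal length.
  obtain ⟨κ', hκ', eκ'⟩ := exists_integralGL (O := O) (a := 1) (b := 0) (e := -x) (f := 1)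
    (d := 1) O.one_mem O.zero_mem (O.neg_mem hx) O.one_mem O.one_mem (by ring)
  have hd0 : d ≠ 0 := by
    rintro rfl
    rw [map_zero] at hd
    have h1 : g.1.det * (g⁻¹).1.det = 1 := by
      rw [← Matrix.det_mul, ← Units.val_mul, mul_inv_cancel, Units.val_one, Matrix.det_one]
    rw [hd, zero_mul, ← map_zero c, ← map_one c] at h1
    exact zero_ne_one (H.injective h1)
  obtain ⟨g', hg'⟩ : ∃ g', g' = g * κ * κ' := ⟨_, rfl⟩
  have e0 : ∀ j, g'.1 j 0 = (g * κ).1 j 0 - (g * κ).1 j 1 * x := fun j => by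
    rw [hg', Units.val_mul, Matrix.mul_apply, Fin.sum_univ_two, eκ']
    simp
    ring
  have e1 : ∀ j, g'.1 j 1 = (g * κ).1 j 1 := fun j => by
    rw [hg', Units.val_mul, Matrix.mul_apply, Fin.sum_univ_two, eκ']
    simp
  have hdet : g'.1 0 0 * g'.1 1 1 - g'.1 0 1 * g'.1 1 0 = c d := by
    rw [← Matrix.det_fin_two, hg', Units.val_mul, Units.val_mul, Matrix.det_mul, Matrix.det_mul,
      hd, hκ1, eκ', Matrix.det_fin_two_of]
    ring
  simp only [← e1] at hD
  have hS : g'.1 0 0 * H.conj (g'.1 1 1) - g'.1 1 0 * H.conj (g'.1 0 1) = 0 := by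
    rw [e0, e0, e1, e1]
    simp only [skew, e1] at hD hDx
    linear_combination hDx - x * hD
  set w₀ := g'.1 0 1 with hw₀
  set w₁ := g'.1 1 1 with hw₁
  have hself := H.skew_self (fun i => g'.1 i 1)
  have hDγ : D = V.symm w₀ 0 * V.symm w₁ 1 - V.symm w₀ 1 * V.symm w₁ 0 := by
    apply H.injective
    have h1 : c D * H.theta = c (V.symm w₀ 0 * V.symm w₁ 1 - V.symm w₀ 1 * V.symm w₁ 0) *
      H.theta := hD.symm.trans hself
    have h2 := congrArg (· * H.thetaInv) h1
    simpa only [mul_assoc, H.theta_mul_thetaInv, mul_one] using h2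
  obtain ⟨γ, hγ⟩ := exists_gl_padic (a := V.symm w₀ 0) (b := V.symm w₀ 1) (e := V.symm w₁ 0)
    (f := V.symm w₁ 1) (by rwa [← hDγ])
  -- The orthogonal complement of `w` consists of the multiples of `w̄`. The first column is thus `b
  -- w̄`, and comparison of determinants gives `-bθ = d/D`.
  set b := -(c (d / D) * H.thetaInv) with hb
  have hθ := H.theta_mul_thetaInv
  have hθb : H.theta * b = -c (d / D) := by
    rw [hb]
    linear_combination (-c (d / D)) * hθ
  have hDd : c D * c (d / D) = c d := by rw [← map_mul, mul_div_cancel₀ _ hD0]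
  have hDi : c D⁻¹ * c D = 1 := by rw [← map_mul, inv_mul_cancel₀ hD0, map_one]
  simp only [skew, ← hw₀, ← hw₁] at hD
  have hcol : ∀ z w : A, z * (c D * H.theta) = -(H.conj w * c d) → z = b * H.conj w := by
    intro z w h
    rw [hb]
    linear_combination (-z * H.theta * H.thetaInv) * hDi - z * hθ + c D⁻¹ * H.thetaInv * h +
      (c D⁻¹ * H.thetaInv * H.conj w) * hDd - (H.thetaInv * H.conj w * c (d / D)) * hDi
  have hcol0 : g'.1 0 0 = b * H.conj w₀ := by
    apply hcol
    rw [← hD]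
    linear_combination (-H.conj w₀) * hdet + w₀ * hS
  have hcol1 : g'.1 1 0 = b * H.conj w₁ := by
    apply hcol
    rw [← hD]
    linear_combination (-H.conj w₁) * hdet + w₁ * hS
  have hω : H.conj (V ![1, 0]) = V ![1, 0] - H.theta := by
    rw [H.conj_omega, theta]
    ring
  -- With `γ` the coordinate matrix of `w`, one has `w = γ(ω, 1)ᵗ`, and also `w̄ = γ(ω̄, 1)ᵗ` since
  -- `γ` has entries in `ℚ_p`; here `ω̄ = ω - θ`.
  have hg'Y : g'.1 = (embGL p A γ).1 *
      !![b * (V ![1, 0] - H.theta), V ![1, 0]; b, 1] := by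
    have eγ : (embGL p A γ).1 = !![c (V.symm w₀ 0), c (V.symm w₀ 1); c (V.symm w₁ 0),
        c (V.symm w₁ 1)] := by
      ext i j
      rw [embGL_apply, hγ]
      fin_cases i <;> fin_cases j <;> rfl
    rw [Matrix.eta_fin_two g'.1, eγ, Matrix.mul_fin_two, hcol0, hcol1]
    have hc : ∀ w, H.conj w = c (V.symm w 0) * (V ![1, 0] - H.theta) + c (V.symm w 1) := by
      intro w
      conv_lhs => rw [H.decomp w]
      rw [map_add, map_mul, H.conj_algebraMap, H.conj_algebraMap, hω]
    refine fin_two_congr ?_ ?_ ?_ ?_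
    · rw [hc]
      ring
    · rw [mul_one, ← H.decomp]
    · rw [hc]
      ring
    · rw [mul_one, ← H.decomp]
  have hgg' : g = g' * (κ * κ')⁻¹ := by
    rw [hg']
    group
  have hκκ : (κ * κ')⁻¹ ∈ integralGL O := inv_mem (mul_mem hκ hκ')
  rcases le_total ‖d / D‖ 1 with hle | hle
  · obtain ⟨n, u, hu, hn⟩ := exists_pow_mul_unit (div_ne_zero hd0 hD0) hle
    have hu0 : u ≠ 0 := by
      rw [← norm_ne_zero_iff, hu]
      exact one_ne_zero
    have hbO : b ∈ O := O.neg_mem (O.mul_mem (hmem _ hle) H.thetaInv_mem)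
    -- Here `b` is integral, so adding a multiple of the second column clears the entry `b`; the
    -- corner left is `-bθ = p^n u`.
    obtain ⟨k, hk, ek⟩ := exists_integralGL (O := O) (a := c u) (b := 0) (e := b) (f := 1)
      (d := c u⁻¹) (hmem _ hu.le) O.zero_mem hbO O.one_mem
      (hmem _ (by rw [norm_inv, hu, inv_one])) (by
        rw [zero_mul, sub_zero, mul_one, ← map_mul, mul_inv_cancel₀ hu0, map_one])
    refine ⟨γ, n, k * (κ * κ')⁻¹, mul_mem hk hκκ, ?_⟩
    rw [hgg', ← mul_assoc]
    congr 1
    apply Units.ext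
    rw [hg'Y, Units.val_mul, Units.val_mul, ek, orbitRep_val, mul_assoc, Matrix.mul_fin_two]
    congr 1
    rw [hn, map_mul] at hθb
    refine fin_two_congr ?_ ?_ ?_ ?_
    · linear_combination -hθb
    · ring
    · ring
    · ring
  · have hinv : ‖(d / D)⁻¹‖ ≤ 1 := by
      rw [norm_inv]
      exact inv_le_one_of_one_le₀ hle
    obtain ⟨n, u, hu, hn⟩ := exists_pow_mul_unit (inv_ne_zero (div_ne_zero hd0 hD0)) hinv
    have hu0 : u ≠ 0 := by
      rw [← norm_ne_zero_iff, hu]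
      exact one_ne_zero
    have hp0 := pow_ne_zero n (cast_prime_ne_zero p)
    have hdD : d / D = ((p : ℚ_[p]) ^ n)⁻¹ * u⁻¹ := by
      rw [← mul_inv, ← hn, inv_inv]
    have hpp : c ((p : ℚ_[p]) ^ n) * c ((p : ℚ_[p]) ^ n)⁻¹ = 1 := by
      rw [← map_mul, mul_inv_cancel₀ hp0, map_one]
    have huu : c u⁻¹ * c u = 1 := by rw [← map_mul, inv_mul_cancel₀ hu0, map_one]
    have hpn : ‖(p : ℚ_[p]) ^ n‖ ≤ 1 := by
      rw [norm_pow]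
      exact pow_le_one₀ (norm_nonneg _) Padic.norm_p_lt_one.le
    set β := c ((p : ℚ_[p]) ^ n) * b with hβ
    have hβ' : β = -(c u⁻¹ * H.thetaInv) := by
      rw [hβ, hb, hdD, map_mul]
      linear_combination (-c u⁻¹ * H.thetaInv) * hpp
    have hβO : β ∈ O := by
      rw [hβ']
      exact O.neg_mem (O.mul_mem (hmem _ (by rw [norm_inv, hu, inv_one])) H.thetaInv_mem)
    obtain ⟨k, hk, ek⟩ := exists_integralGL (O := O) (a := 0) (b := -H.theta) (e := β)
      (f := c ((p : ℚ_[p]) ^ n)) (d := -c u) O.zero_mem (O.neg_mem H.theta_mem) hβO (hmem _ hpn)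
      (O.neg_mem (hmem _ hu.le)) (by
        rw [hβ']
        linear_combination c u⁻¹ * c u * hθ + huu)
    -- When `d/D` has negative valuation `-n`, the columns exchange their roles and `ω` is replaced
    -- by its conjugate: `γ' = p⁻ⁿ [[-1, T], [0, 1]]` sends `(ω, 1)ᵗ` to `p⁻ⁿ (T - ω, 1)ᵗ`, and `T -
    -- ω = ω̄`.
    obtain ⟨γ', hγ'⟩ := exists_gl_padic (a := -((p : ℚ_[p]) ^ n)⁻¹) (b := ((p : ℚ_[p]) ^ n)⁻¹ * T)
      (e := 0) (f := ((p : ℚ_[p]) ^ n)⁻¹) (by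
        rw [mul_zero, sub_zero]
        exact mul_ne_zero (neg_ne_zero.2 (inv_ne_zero hp0)) (inv_ne_zero hp0))
    have eγ' : (embGL p A γ').1 = !![-c ((p : ℚ_[p]) ^ n)⁻¹, c ((p : ℚ_[p]) ^ n)⁻¹ * c T; 0,
        c ((p : ℚ_[p]) ^ n)⁻¹] := by
      ext i j
      rw [embGL_apply, hγ']
      fin_cases i <;> fin_cases j <;> simp
    refine ⟨γ * γ', n, k * (κ * κ')⁻¹, mul_mem hk hκκ, ?_⟩
    rw [hgg', ← mul_assoc]
    congr 1
    apply Units.ext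
    rw [hg'Y, map_mul, Units.val_mul, Units.val_mul, Units.val_mul, ek, orbitRep_val, eγ',
      mul_assoc, mul_assoc, Matrix.mul_fin_two, Matrix.mul_fin_two]
    congr 1
    have hθ' : H.theta = 2 * V ![1, 0] - c T := rfl
    rw [hβ, hθ']
    refine fin_two_congr ?_ ?_ ?_ ?_
    · linear_combination (b * V ![1, 0] - b * c T) * hpp
    · linear_combination (-V ![1, 0]) * hpp
    · linear_combination (-b) * hpp
    · linear_combination -hpp

end QuadBasis

end Orbits

/-! ### Schwartz functions as combinations of balls -/

section Balls

variable (p : ℕ) [Fact p.Prime]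

/-- The lattice `p ^ N ℤ_p²`. -/
def ballSubgroup (N : ℕ) : AddSubgroup (Fin 2 → ℚ_[p]) where
  carrier := {w | ∀ i, ‖w i‖ ≤ ‖(p : ℚ_[p]) ^ N‖}
  zero_mem' i := by simp
  add_mem' ha hb i := (Padic.nonarchimedean _ _).trans (max_le (ha i) (hb i))
  neg_mem' ha i := by simpa using ha i

variable {p}

theorem mem_ballSubgroup {N : ℕ} {w : Fin 2 → ℚ_[p]} :
    w ∈ ballSubgroup p N ↔ ∀ i, ‖w i‖ ≤ ‖(p : ℚ_[p]) ^ N‖ := Iff.rfl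

theorem ballSubgroup_eq_pi (N : ℕ) : (ballSubgroup p N : Set (Fin 2 → ℚ_[p])) =
    Set.univ.pi (fun _ => Metric.closedBall (0 : ℚ_[p]) ‖(p : ℚ_[p]) ^ N‖) := by
  ext w
  simp only [SetLike.mem_coe, mem_ballSubgroup, Set.mem_pi, Set.mem_univ, true_imp_iff,
    mem_closedBall_zero_iff]

theorem isOpen_ballSubgroup (N : ℕ) : IsOpen (ballSubgroup p N : Set (Fin 2 → ℚ_[p])) := by
  rw [ballSubgroup_eq_pi]
  exact isOpen_set_pi Set.finite_univ (fun _ _ => IsUltrametricDist.isOpen_closedBall _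
    (norm_ne_zero_iff.2 (pow_ne_zero _ (cast_prime_ne_zero p))))

theorem isCompact_ballSubgroup (N : ℕ) : IsCompact (ballSubgroup p N : Set (Fin 2 → ℚ_[p])) := by
  rw [ballSubgroup_eq_pi]
  exact isCompact_univ_pi (fun _ => isCompact_closedBall _ _)

theorem isLocallyConstant_of_ball {N : ℕ} {f : (Fin 2 → ℚ_[p]) → ℂ}
    (hf : ∀ v, ∀ w ∈ ballSubgroup p N, f (v + w) = f v) : IsLocallyConstant f := by
  rw [IsLocallyConstant.iff_exists_open]
  intro x
  refine ⟨(fun y => y - x) ⁻¹' (ballSubgroup p N : Set _),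
    (isOpen_ballSubgroup N).preimage (by fun_prop), by simp, fun y hy => ?_⟩
  have := hf x _ hy
  rwa [add_sub_cancel] at this

/-- The characteristic function of `v + p ^ N ℤ_p²`. -/
noncomputable def chBall (N : ℕ) (v : Fin 2 → ℚ_[p]) : Schwartz p :=
  ⟨{w | w - v ∈ ballSubgroup p N}.indicator (fun _ => 1), by
    classical
    refine ⟨isLocallyConstant_of_ball (N := N) fun x w hw => ?_, ?_⟩
    · simp only [Set.indicator_apply, Set.mem_ofPred_eq, add_sub_right_comm,
        AddSubgroup.add_mem_cancel_right _ hw]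
    · exact HasCompactSupport.of_support_subset_isCompact
        (((Homeomorph.subRight v).isCompact_preimage).2 (isCompact_ballSubgroup N))
        Set.support_indicator_subset⟩

theorem chBall_apply_of_mem {N : ℕ} {v w : Fin 2 → ℚ_[p]} (h : w - v ∈ ballSubgroup p N) :
    (chBall N v).toFun w = 1 :=
  Set.indicator_of_mem (s := {w | w - v ∈ ballSubgroup p N}) (a := w) h (fun _ => (1 : ℂ))

theorem chBall_apply_of_notMem {N : ℕ} {v w : Fin 2 → ℚ_[p]} (h : w - v ∉ ballSubgroup p N) :
    (chBall N v).toFun w = 0 :=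
  Set.indicator_of_notMem (s := {w | w - v ∈ ballSubgroup p N}) (a := w) h (fun _ => (1 : ℂ))

theorem chBall_eq_of_mem {N : ℕ} {v w : Fin 2 → ℚ_[p]} (h : w - v ∈ ballSubgroup p N) :
    chBall N w = chBall N v := by
  apply Schwartz.ext
  ext x
  have e : x - v = (x - w) + (w - v) := by abel
  by_cases hx : x - w ∈ ballSubgroup p N
  · rw [chBall_apply_of_mem hx, chBall_apply_of_mem (e ▸ add_mem hx h)]
  · rw [chBall_apply_of_notMem hx, chBall_apply_of_notMem]
    rwa [e, AddSubgroup.add_mem_cancel_right _ h]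

theorem out_sub_mem (N : ℕ) (v : Fin 2 → ℚ_[p]) :
    (v : (Fin 2 → ℚ_[p]) ⧸ ballSubgroup p N).out - v ∈ ballSubgroup p N := by
  have h : -v + (v : (Fin 2 → ℚ_[p]) ⧸ ballSubgroup p N).out ∈ ballSubgroup p N :=
    QuotientAddGroup.eq.1 (QuotientAddGroup.out_eq' _).symm
  rwa [neg_add_eq_sub] at h

theorem Schwartz.apply_of_sub_mem {N : ℕ} {φ : Schwartz p}
    (hφ : ∀ v, ∀ w ∈ ballSubgroup p N, φ.toFun (v + w) = φ.toFun v) {v w : Fin 2 → ℚ_[p]}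
    (h : w - v ∈ ballSubgroup p N) : φ.toFun w = φ.toFun v := by
  have := hφ v _ h
  rwa [add_sub_cancel] at this

theorem Schwartz.toFun_sum {ι : Type*} (s : Finset ι) (f : ι → Schwartz p) (x : Fin 2 → ℚ_[p]) :
    (∑ i ∈ s, f i).toFun x = ∑ i ∈ s, (f i).toFun x := by
  let ev : Schwartz p →+ ℂ :=
    { toFun := fun ξ => ξ.toFun x, map_zero' := rfl, map_add' := fun _ _ => rfl }
  exact map_sum ev f s

theorem Schwartz.toFun_smul (a : ℂ) (φ : Schwartz p) (x : Fin 2 → ℚ_[p]) :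
    (a • φ).toFun x = a * φ.toFun x := rfl

/-- A Schwartz function is invariant under translation by a small lattice. -/
theorem Schwartz.exists_invariant (φ : Schwartz p) :
    ∃ N, ∀ v, ∀ w ∈ ballSubgroup p N, φ.toFun (v + w) = φ.toFun v := by
  obtain ⟨ε, hε, h⟩ := lebesgue_number_lemma_of_metric (s := tsupport φ.toFun)
    (c := fun a : ℂ => φ.toFun ⁻¹' {a}) φ.2.2.isCompact
    (fun a => φ.2.1.isOpen_fiber a) (fun x _ => Set.mem_iUnion.2 ⟨φ.toFun x, rfl⟩)
  obtain ⟨N, hN⟩ := exists_pow_lt_of_lt_one hε (Padic.norm_p_lt_one (p := p))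
  have key : ∀ v ∈ tsupport φ.toFun, ∀ w, dist w v < ε → φ.toFun w = φ.toFun v := by
    intro v hv w hw
    obtain ⟨a, ha⟩ := h v hv
    have h1 : φ.toFun w = a := ha hw
    have h2 : φ.toFun v = a := ha (Metric.mem_ball_self hε)
    rw [h1, h2]
  refine ⟨N, fun v w hw => ?_⟩
  have hwn : ‖w‖ < ε := by
    refine lt_of_le_of_lt ((pi_norm_le_iff_of_nonneg (norm_nonneg _)).2 hw) ?_
    rwa [norm_pow]
  by_cases h1 : v ∈ tsupport φ.toFun
  · exact key v h1 _ (by rwa [dist_eq_norm, add_sub_cancel_left])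
  by_cases h2 : v + w ∈ tsupport φ.toFun
  · refine (key _ h2 v ?_).symm
    rwa [dist_eq_norm, sub_add_cancel_left, norm_neg]
  · rw [image_eq_zero_of_notMem_tsupport h1, image_eq_zero_of_notMem_tsupport h2]

/-- A Schwartz function invariant under `p ^ N ℤ_p²` is a finite combination of characteristic
functions of balls. -/
theorem Schwartz.exists_eq_sum {N : ℕ} {φ : Schwartz p}
    (hφ : ∀ v, ∀ w ∈ ballSubgroup p N, φ.toFun (v + w) = φ.toFun v) :
    ∃ s : Finset ((Fin 2 → ℚ_[p]) ⧸ ballSubgroup p N),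
      (∀ q, q ∈ s ↔ φ.toFun q.out ≠ 0) ∧ φ = ∑ q ∈ s, φ.toFun q.out • chBall N q.out := by
  classical
  have : DiscreteTopology ((Fin 2 → ℚ_[p]) ⧸ ballSubgroup p N) :=
    QuotientAddGroup.discreteTopology (isOpen_ballSubgroup N)
  have hc := φ.2.2.isCompact.image
    (f := ((↑) : (Fin 2 → ℚ_[p]) → (Fin 2 → ℚ_[p]) ⧸ ballSubgroup p N))
      QuotientAddGroup.continuous_mk
  have hfin : {q : (Fin 2 → ℚ_[p]) ⧸ ballSubgroup p N | φ.toFun q.out ≠ 0}.Finite := by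
    refine hc.finite_of_discrete.subset fun q hq => ⟨q.out, subset_tsupport _ hq, ?_⟩
    exact QuotientAddGroup.out_eq' q
  have hmem : ∀ q, q ∈ hfin.toFinset ↔ φ.toFun q.out ≠ 0 := fun q => by
    rw [Set.Finite.mem_toFinset]
    rfl
  refine ⟨hfin.toFinset, hmem, ?_⟩
  apply Schwartz.ext
  ext x
  rw [Schwartz.toFun_sum]
  simp only [Schwartz.toFun_smul]
  have hx := out_sub_mem N x
  rw [Finset.sum_eq_single (x : (Fin 2 → ℚ_[p]) ⧸ ballSubgroup p N), chBall_eq_of_mem hx,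
    Schwartz.apply_of_sub_mem hφ hx, chBall_apply_of_mem (by simp), mul_one]
  · intro q _ hq
    rw [chBall_apply_of_notMem, mul_zero]
    intro h
    apply hq
    rw [← QuotientAddGroup.out_eq' q]
    refine QuotientAddGroup.eq.2 ?_
    rwa [neg_add_eq_sub]
  · intro h
    rw [hmem, not_not] at h
    rw [h, zero_mul]

theorem vecMul_mem_ballSubgroup {N : ℕ} {h : GL (Fin 2) ℚ_[p]} (hh : h ∈ GL2Zp p)
    {w : Fin 2 → ℚ_[p]} (hw : w ∈ ballSubgroup p N) : Matrix.vecMul w h.1 ∈ ballSubgroup p N := by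
  intro j
  have key : ∀ i, ‖w i * h.1 i j‖ ≤ ‖(p : ℚ_[p]) ^ N‖ := fun i => by
    rw [norm_mul]
    exact (mul_le_of_le_one_right (norm_nonneg _) (hh.1 i j)).trans (hw i)
  rw [Matrix.vecMul, dotProduct, Fin.sum_univ_two]
  exact (Padic.nonarchimedean _ _).trans (max_le (key 0) (key 1))

theorem schwartzRep_chBall {N : ℕ} {h : GL (Fin 2) ℚ_[p]} (hh : h ∈ GL2Zp p)
    (v : Fin 2 → ℚ_[p]) : schwartzRep p h (chBall N (Matrix.vecMul v h.1)) = chBall N v := by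
  apply Schwartz.ext
  ext w
  rw [schwartzRep_apply]
  by_cases hw : w - v ∈ ballSubgroup p N
  · rw [chBall_apply_of_mem hw, chBall_apply_of_mem]
    rw [← Matrix.sub_vecMul]
    exact vecMul_mem_ballSubgroup hh hw
  · rw [chBall_apply_of_notMem hw, chBall_apply_of_notMem]
    rw [← Matrix.sub_vecMul]
    intro h'
    apply hw
    have := vecMul_mem_ballSubgroup ((GL2Zp p).inv_mem hh) h'
    rwa [vecMul_inv_vecMul] at this

/-- If a finite sum of vectors lies in a subspace, and each of them either lies in it or equals
the vector `x`, which occurs, then `x` lies in the subspace. -/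
theorem mem_of_sum_mem {ι W : Type*} [AddCommGroup W] [Module ℂ W] {S : Submodule ℂ W}
    {s : Finset ι} {F : ι → W} {x : W} (hs : ∑ i ∈ s, F i ∈ S) {i₀ : ι} (hi₀ : i₀ ∈ s)
    (h₀ : F i₀ = x) (h : ∀ i ∈ s, F i = x ∨ F i ∈ S) : x ∈ S := by
  classical
  rw [← Finset.sum_filter_add_sum_filter_not s (fun i => F i = x)] at hs
  have h1 : ∑ i ∈ s with ¬ F i = x, F i ∈ S := S.sum_mem fun i hi => by
    rw [Finset.mem_filter] at hi
    exact (h i hi.1).resolve_left hi.2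
  have h2 := (S.add_mem_iff_left h1).1 hs
  rw [Finset.sum_congr rfl (g := fun _ => x) (fun i hi => (Finset.mem_filter.1 hi).2),
    Finset.sum_const, ← Nat.cast_smul_eq_nsmul ℂ] at h2
  refine (S.smul_mem_iff ?_).1 h2
  rw [Nat.cast_ne_zero]
  exact (Finset.card_pos.2 ⟨i₀, Finset.mem_filter.2 ⟨hi₀, h₀⟩⟩).ne'

end Balls

/-! ### Content of a vector and primitive vectors -/

section Primitive

variable {p : ℕ} [Fact p.Prime]

/-- A primitive vector of `ℤ_p²`. -/
def IsPrimitive (z : Fin 2 → ℚ_[p]) : Prop := (∀ i, ‖z i‖ ≤ 1) ∧ ∃ i, ‖z i‖ = 1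

theorem norm_prime_pow_le (n : ℕ) : ‖(p : ℚ_[p]) ^ n‖ ≤ 1 := by
  rw [norm_pow]
  exact pow_le_one₀ (norm_nonneg _) Padic.norm_p_lt_one.le

/-- The power of `p` dividing `v`, truncated at `N`: the vector matters only modulo `p^N ℤ_p²`.
Below the truncation the quotient `z` is primitive. -/
theorem exists_content (N : ℕ) (v : Fin 2 → ℚ_[p]) : ∃ (k : ℤ) (z : Fin 2 → ℚ_[p]), k ≤ N ∧
    (∀ i, ‖z i‖ ≤ 1) ∧ v = (p : ℚ_[p]) ^ k • z ∧ (k = N ∨ IsPrimitive z) := by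
  have hp0 : (p : ℚ_[p]) ≠ 0 := cast_prime_ne_zero p
  have hsmul : ∀ k : ℤ, v = (p : ℚ_[p]) ^ k • ((p : ℚ_[p]) ^ (-k) • v) := fun k => by
    rw [smul_smul, ← zpow_add₀ hp0, add_neg_cancel, zpow_zero, one_smul]
  have hnorm : ∀ (k : ℤ) i, ‖((p : ℚ_[p]) ^ (-k) • v) i‖ = ‖v i‖ / ‖(p : ℚ_[p]) ^ k‖ :=
    fun k i => by
      rw [Pi.smul_apply, smul_eq_mul, zpow_neg, norm_mul, norm_inv, inv_mul_eq_div]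
  have hpos : ∀ k : ℤ, 0 < ‖(p : ℚ_[p]) ^ k‖ := fun k => norm_pos_iff.2 (zpow_ne_zero k hp0)
  by_cases hv : v ∈ ballSubgroup p N
  · refine ⟨N, _, le_rfl, fun i => ?_, hsmul N, Or.inl rfl⟩
    rw [hnorm, div_le_one (hpos _), zpow_natCast]
    exact hv i
  · obtain ⟨j, hj⟩ : ∃ j, ‖(p : ℚ_[p]) ^ N‖ < ‖v j‖ := by
      by_contra hc
      push Not at hc
      exact hv hc
    obtain ⟨i, hi⟩ : ∃ i, ∀ j, ‖v j‖ ≤ ‖v i‖ := Finite.exists_max _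
    have hvi : v i ≠ 0 := by
      intro h0
      have := hj.trans_le (hi j)
      rw [h0, norm_zero] at this
      exact absurd this (not_lt.2 (norm_nonneg _))
    have hval : ‖v i‖ = ‖(p : ℚ_[p]) ^ (v i).valuation‖ := by
      rw [Padic.norm_eq_zpow_neg_valuation hvi, Padic.norm_p_zpow]
    have hz : ∀ j, ‖((p : ℚ_[p]) ^ (-(v i).valuation) • v) j‖ ≤ 1 := fun j => by
      rw [hnorm, div_le_one (hpos _), ← hval]
      exact hi j
    refine ⟨(v i).valuation, _, ?_, hz, hsmul _, Or.inr ⟨hz, i, ?_⟩⟩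
    · by_contra hc
      push Not at hc
      have h1 := hj.trans_le (hi j)
      rw [hval, ← zpow_natCast, Padic.norm_p_zpow, Padic.norm_p_zpow] at h1
      have hp1 : (1 : ℝ) < p := by exact_mod_cast (Fact.out : p.Prime).one_lt
      rw [zpow_lt_zpow_iff_right₀ hp1] at h1
      omega
    · rw [hnorm, ← hval, div_self (norm_ne_zero_iff.2 hvi)]

/-- The exponent found by `exists_content` is the largest one, not exceeding `N`, whose power of `p`
divides the vector. -/
theorem content_le {N : ℕ} {k j : ℤ} {z w : Fin 2 → ℚ_[p]} (hk : k = N ∨ IsPrimitive z)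
    (hj : j ≤ N) (hw : ∀ i, ‖w i‖ ≤ 1) (h : (p : ℚ_[p]) ^ k • z = (p : ℚ_[p]) ^ j • w) :
    j ≤ k := by
  rcases hk with rfl | ⟨-, i, hi⟩
  · exact hj
  · have h1 := congrArg norm (congrFun h i)
    rw [Pi.smul_apply, Pi.smul_apply, smul_eq_mul, smul_eq_mul, norm_mul, norm_mul, hi, mul_one,
      Padic.norm_p_zpow, Padic.norm_p_zpow] at h1
    have hp1 : (1 : ℝ) < p := by exact_mod_cast (Fact.out : p.Prime).one_lt
    have h2 : (p : ℝ) ^ (-k) ≤ (p : ℝ) ^ (-j) := by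
      rw [h1]
      exact mul_le_of_le_one_right (zpow_nonneg (Nat.cast_nonneg p) _) (hw i)
    rw [zpow_le_zpow_iff_right₀ hp1] at h2
    omega

theorem exists_completion {z : Fin 2 → ℚ_[p]} (hz : IsPrimitive z) :
    ∃ h ∈ GL2Zp p, Matrix.vecMul ![1, 0] h.1 = z := by
  obtain ⟨hz1, i, hi⟩ := hz
  have h0 : z i ≠ 0 := norm_ne_zero_iff.1 (by rw [hi]; exact one_ne_zero)
  fin_cases i
  · obtain ⟨h, hh, e⟩ := exists_integralGL (O := PadicInt.subring p) (a := z 0) (b := z 1)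
      (e := 0) (f := 1) (d := (z 0)⁻¹) (hz1 0) (hz1 1) (zero_mem _) (one_mem _)
      (show ‖(z 0)⁻¹‖ ≤ 1 by rw [norm_inv, show ‖z 0‖ = 1 from hi, inv_one])
      (by rw [mul_one, mul_zero, sub_zero]; exact mul_inv_cancel₀ h0)
    refine ⟨h, hh, ?_⟩
    ext j
    rw [e]
    fin_cases j <;> simp [Matrix.vecMul, dotProduct, Fin.sum_univ_two]
  · obtain ⟨h, hh, e⟩ := exists_integralGL (O := PadicInt.subring p) (a := z 0) (b := z 1)
      (e := -1) (f := 0) (d := (z 1)⁻¹) (hz1 0) (hz1 1) (neg_mem (one_mem _)) (zero_mem _)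
      (show ‖(z 1)⁻¹‖ ≤ 1 by rw [norm_inv, show ‖z 1‖ = 1 from hi, inv_one])
      (by rw [mul_zero, zero_sub, mul_neg, mul_one, neg_neg]; exact mul_inv_cancel₀ h0)
    refine ⟨h, hh, ?_⟩
    ext j
    rw [e]
    fin_cases j <;> simp [Matrix.vecMul, dotProduct, Fin.sum_univ_two]

theorem exists_vecMul_eq {z w : Fin 2 → ℚ_[p]} (hz : IsPrimitive z) (hw : IsPrimitive w) :
    ∃ h ∈ GL2Zp p, Matrix.vecMul z h.1 = w := by
  obtain ⟨a, ha, ea⟩ := exists_completion hz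
  obtain ⟨b, hb, eb⟩ := exists_completion hw
  refine ⟨a⁻¹ * b, mul_mem (inv_mem ha) hb, ?_⟩
  rw [Units.val_mul, ← Matrix.vecMul_vecMul, ← ea, vecMul_inv_vecMul, eb]

theorem exists_dot_eq_one {z : Fin 2 → ℚ_[p]} (hz : IsPrimitive z) :
    ∃ a : Fin 2 → ℚ_[p], (∀ i, ‖a i‖ ≤ 1) ∧ z 0 * a 0 + z 1 * a 1 = 1 := by
  obtain ⟨-, i, hi⟩ := hz
  have h0 : z i ≠ 0 := norm_ne_zero_iff.1 (by rw [hi]; exact one_ne_zero)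
  have h1 : ‖(z i)⁻¹‖ ≤ 1 := by rw [norm_inv, hi, inv_one]
  fin_cases i
  · refine ⟨![(z 0)⁻¹, 0], Fin.forall_fin_two.2 ⟨h1, by simp⟩, ?_⟩
    change z 0 * (z 0)⁻¹ + z 1 * 0 = 1
    rw [mul_zero, add_zero]
    exact mul_inv_cancel₀ h0
  · refine ⟨![0, (z 1)⁻¹], Fin.forall_fin_two.2 ⟨by simp, h1⟩, ?_⟩
    change z 0 * 0 + z 1 * (z 1)⁻¹ = 1
    rw [mul_zero, zero_add]
    exact mul_inv_cancel₀ h0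

end Primitive

/-! ### Ideals attached to balls, and lifting of units -/

section Span

variable {p : ℕ} [Fact p.Prime] {A : Type*} [CommRing A] [Algebra ℚ_[p] A]

local notation "c" => algebraMap ℚ_[p] A

/-- Divisibility in `A` with respect to the subring `O`. -/
def OrderDvd (O : Subring A) (t a : A) : Prop := ∃ y ∈ O, a = t * y

variable {O : Subring A} {V : (Fin 2 → ℚ_[p]) ≃ₗ[ℚ_[p]] A} {T M : ℚ_[p]}

theorem OrderDvd.trans {a b d : A} (h : OrderDvd O a b) (h' : OrderDvd O b d) :
    OrderDvd O a d := by
  obtain ⟨y, hy, rfl⟩ := h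
  obtain ⟨z, hz, rfl⟩ := h'
  exact ⟨y * z, O.mul_mem hy hz, mul_assoc _ _ _⟩

theorem OrderDvd.add {a b d : A} (h : OrderDvd O a b) (h' : OrderDvd O a d) :
    OrderDvd O a (b + d) := by
  obtain ⟨y, hy, rfl⟩ := h
  obtain ⟨z, hz, rfl⟩ := h'
  exact ⟨y + z, O.add_mem hy hz, (mul_add _ _ _).symm⟩

theorem OrderDvd.mul_left {a b d : A} (hd : d ∈ O) (h : OrderDvd O a b) : OrderDvd O a (d * b) := by
  obtain ⟨y, hy, rfl⟩ := h
  exact ⟨d * y, O.mul_mem hd hy, mul_left_comm _ _ _⟩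

namespace QuadBasis

theorem smul_eq (H : QuadBasis O V T M) (a : ℚ_[p]) (v : Fin 2 → ℚ_[p]) :
    V (a • v) = c a * V v := by
  have := H
  rw [map_smul, Algebra.smul_def]

theorem pow_dvd_iff (H : QuadBasis O V T M) (k : ℤ) (v : Fin 2 → ℚ_[p]) :
    OrderDvd O (c ((p : ℚ_[p]) ^ k)) (V v) ↔ ∃ w, (∀ i, ‖w i‖ ≤ 1) ∧ v = (p : ℚ_[p]) ^ k • w := by
  constructor
  · rintro ⟨y, hy, e⟩
    refine ⟨V.symm y, (H.mem_iff_symm y).1 hy, ?_⟩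
    apply V.injective
    rw [H.smul_eq, V.apply_symm_apply, e]
  · rintro ⟨w, hw, rfl⟩
    exact ⟨V w, (H.mem_iff w).2 hw, H.smul_eq _ _⟩

theorem pow_dvd_pow (H : QuadBasis O V T M) {j k : ℤ} (h : j ≤ k) :
    OrderDvd O (c ((p : ℚ_[p]) ^ j)) (c ((p : ℚ_[p]) ^ k)) := by
  obtain ⟨n, hn⟩ := Int.le.dest h
  refine ⟨c ((p : ℚ_[p]) ^ n), (H.algebraMap_mem_iff _).2 (norm_prime_pow_le n), ?_⟩
  rw [← map_mul, ← zpow_natCast, ← zpow_add₀ (cast_prime_ne_zero p), hn]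

theorem mem_ballSubgroup_iff (H : QuadBasis O V T M) {N : ℕ} {v : Fin 2 → ℚ_[p]} :
    v ∈ ballSubgroup p N ↔ OrderDvd O (c ((p : ℚ_[p]) ^ (N : ℤ))) (V v) := by
  have hp0 : (p : ℚ_[p]) ^ N ≠ 0 := pow_ne_zero _ (cast_prime_ne_zero p)
  rw [H.pow_dvd_iff, zpow_natCast]
  constructor
  · intro h
    refine ⟨((p : ℚ_[p]) ^ N)⁻¹ • v, fun i => ?_, by rw [smul_smul, mul_inv_cancel₀ hp0, one_smul]⟩
    rw [Pi.smul_apply, smul_eq_mul, norm_mul, norm_inv, inv_mul_le_one₀ (norm_pos_iff.2 hp0)]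
    exact h i
  · rintro ⟨w, hw, rfl⟩ i
    rw [Pi.smul_apply, smul_eq_mul, norm_mul]
    exact mul_le_of_le_one_right (norm_nonneg _) (hw i)

/-- Attaches to the ball `v + p^N ℤ_p²` the ideal `tO` generated by `v` and `p^(min (k+n) N)`.
Truncation at `N` makes `tO` a union of balls; truncation at `k + n` gives `p^k ∣ t ∣ p^(k+n)`,
which makes `tO` good. -/
theorem exists_gcd_content (H : QuadBasis O V T M) (n N : ℕ) (v : Fin 2 → ℚ_[p]) :
    ∃ (k : ℤ) (z : Fin 2 → ℚ_[p]) (t x : A), k ≤ N ∧ v = (p : ℚ_[p]) ^ k • z ∧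
      (∀ i, ‖z i‖ ≤ 1) ∧ (k = N ∨ IsPrimitive z) ∧ x ∈ O ∧
      t = V v + x * c ((p : ℚ_[p]) ^ (min (k + n) N)) ∧ OrderDvd O t (V v) ∧
      OrderDvd O t (c ((p : ℚ_[p]) ^ (min (k + n) N))) := by
  obtain ⟨k, z, hk, hz, hv, h⟩ := exists_content N v
  obtain ⟨x, hx, r, hr, s, hs, e₁, e₂⟩ := H.exists_gcd (V v) (c ((p : ℚ_[p]) ^ (min (k + n) (N : ℤ))))
  exact ⟨k, z, _, x, hk, hv, hz, h, hx, rfl, ⟨r, hr, e₁⟩, s, hs, e₂⟩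

/-- The elements `u` of the order with `z ≡ u w` modulo `t` can be chosen to be units if `w` and `z`
generate the same ideal modulo `t`. -/
theorem exists_unit_mul (H : QuadBasis O V T M) {z w t a b y y' : A} (ha : a ∈ O) (hb : b ∈ O)
    (hy : y ∈ O) (hy' : y' ∈ O) (e : w = z * a + t * y) (e' : z = w * b + t * y') :
    ∃ u ∈ O, ‖H.nrm u‖ = 1 ∧ ∃ y'' ∈ O, w = u * z + t * y'' := by
  -- Since `ab + (1 - ab) = 1`, the common divisor `a + x(1 - ab)` is a unit. It acts on `z` as `a`
  -- does modulo `t`, because `(1 - ab)z ≡ z - bw ≡ 0`.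
  obtain ⟨x, hx, r, hr, s, hs, e₁, e₂⟩ := H.exists_gcd a (1 - a * b)
  have hu : a + x * (1 - a * b) ∈ O :=
    O.add_mem ha (O.mul_mem hx (O.sub_mem O.one_mem (O.mul_mem ha hb)))
  have h1 : (a + x * (1 - a * b)) * (r * b + s) = 1 := by
    linear_combination (-b) * e₁ - e₂
  refine ⟨_, hu, ?_, y - x * (y * b + y'), O.sub_mem hy (O.mul_mem hx (O.add_mem
    (O.mul_mem hy hb) hy')), ?_⟩
  · have h2 := congrArg (fun a => ‖H.nrm a‖) h1
    simp only [H.nrm_mul, H.nrm_one, norm_mul, norm_one] at h2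
    have h3 := H.norm_nrm_le hu
    have h4 := H.norm_nrm_le (O.add_mem (O.mul_mem hr hb) hs)
    nlinarith [norm_nonneg (H.nrm (a + x * (1 - a * b)))]
  · linear_combination (1 - x * b) * e - x * e'

/-- Take the matrix of multiplication by `u` and add `p^n` times the matrix with rows `a_i y`, where
`z₀a₀ + z₁a₁ = 1`. This moves the image of `z` by `p^n y` and preserves the congruence modulo `p^n`;
as `n ≠ 0`, the determinant remains a unit. -/
theorem exists_stabilizer_vecMul (H : QuadBasis O V T M) {n : ℕ} (hn : n ≠ 0) {z : Fin 2 → ℚ_[p]}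
    (hz : IsPrimitive z) {u y : A} (hu : u ∈ O) (hu1 : ‖H.nrm u‖ = 1) (hy : y ∈ O) :
    ∃ h ∈ GL2Zp p, OrderDvd O (c ((p : ℚ_[p]) ^ n)) (V (h.1 0) - V ![1, 0] * V (h.1 1)) ∧
      V (Matrix.vecMul z h.1) = u * V z + c ((p : ℚ_[p]) ^ n) * y := by
  have hu0 : H.nrm u ≠ 0 := norm_ne_zero_iff.1 (by rw [hu1]; exact one_ne_zero)
  obtain ⟨δ, hδd, hδ0, hδ1, hδ⟩ := H.exists_mulMatrix hu0
  obtain ⟨a, ha, ha1⟩ := exists_dot_eq_one hz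
  have hδi : ∀ i j, ‖δ.1 i j‖ ≤ 1 := by
    intro i
    apply (H.mem_iff (δ.1 i)).1
    fin_cases i
    · exact hδ0 ▸ O.mul_mem hu H.omega_mem
    · exact hδ1 ▸ hu
  have hyi := (H.mem_iff_symm y).1 hy
  set q := (p : ℚ_[p]) ^ n with hq
  set B : Matrix (Fin 2) (Fin 2) ℚ_[p] := fun i => δ.1 i + (q * a i) • V.symm y with hB
  have hBi : ∀ i j, B i j = δ.1 i j + q * (a i * V.symm y j) := fun i j => by
    simp [hB, mul_assoc]
  have hqlt : ‖q‖ < 1 := by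
    rw [hq, norm_pow]
    exact pow_lt_one₀ (norm_nonneg _) Padic.norm_p_lt_one hn
  have hai : ∀ i j, a i * V.symm y j ∈ PadicInt.subring p := fun i j =>
    mul_mem (show a i ∈ PadicInt.subring p from ha i)
      (show V.symm y j ∈ PadicInt.subring p from hyi j)
  have hBmem : ∀ i j, ‖B i j‖ ≤ 1 := fun i j => by
    rw [hBi]
    exact add_mem (show δ.1 i j ∈ PadicInt.subring p from hδi i j)
      (mul_mem (show q ∈ PadicInt.subring p from hqlt.le) (hai i j))
  have hdet : ‖B.det‖ = 1 := by
    have e : B.det = q * (a 0 * V.symm y 0 * δ.1 1 1 + a 1 * V.symm y 1 * δ.1 0 0 -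
        a 0 * V.symm y 1 * δ.1 1 0 - a 1 * V.symm y 0 * δ.1 0 1) + H.nrm u := by
      rw [← hδd, Matrix.det_fin_two, Matrix.det_fin_two, hBi, hBi, hBi, hBi]
      ring
    rw [e]
    refine norm_add_eq_one ?_ hu1
    rw [norm_mul]
    have h1 : ‖a 0 * V.symm y 0 * δ.1 1 1 + a 1 * V.symm y 1 * δ.1 0 0 -
        a 0 * V.symm y 1 * δ.1 1 0 - a 1 * V.symm y 0 * δ.1 0 1‖ ≤ 1 := by
      have hm : ∀ i j k l, a i * V.symm y j * δ.1 k l ∈ PadicInt.subring p := fun i j k l =>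
        mul_mem (hai i j) (show δ.1 k l ∈ PadicInt.subring p from hδi k l)
      exact sub_mem (sub_mem (add_mem (hm _ _ _ _) (hm _ _ _ _)) (hm _ _ _ _)) (hm _ _ _ _)
    exact (mul_le_of_le_one_right (norm_nonneg _) h1).trans_lt hqlt
  have hB0 : B.det ≠ 0 := norm_ne_zero_iff.1 (by rw [hdet]; exact one_ne_zero)
  have hV : ∀ i, V (B i) = V (δ.1 i) + c q * (c (a i) * y) := fun i => by
    rw [hB, map_add, H.smul_eq, V.apply_symm_apply, map_mul, mul_assoc]
  refine ⟨Matrix.GeneralLinearGroup.mkOfDetNeZero B hB0, mem_gl2Zp_of_det hBmem hdet, ?_, ?_⟩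
  · change OrderDvd O (c q) (V (B 0) - V ![1, 0] * V (B 1))
    have hm : ∀ i, c (a i) ∈ O := fun i => (H.algebraMap_mem_iff _).2 (ha i)
    refine ⟨c (a 0) * y - V ![1, 0] * (c (a 1) * y), O.sub_mem (O.mul_mem (hm 0) hy)
      (O.mul_mem H.omega_mem (O.mul_mem (hm 1) hy)), ?_⟩
    rw [hV, hV, hδ0, hδ1]
    ring
  · change V (Matrix.vecMul z B) = _
    have hv : Matrix.vecMul z B = z 0 • B 0 + z 1 • B 1 := by
      ext j
      simp [Matrix.vecMul, dotProduct, Fin.sum_univ_two]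
    have ha1' : c (z 0) * c (a 0) + c (z 1) * c (a 1) = 1 := by
      rw [← map_mul, ← map_mul, ← map_add, ha1, map_one]
    rw [hv, map_add, H.smul_eq, H.smul_eq, hV, hV, hδ0, hδ1, H.apply z]
    linear_combination c q * y * ha1'

end QuadBasis

end Span

/-! ### Good lattices span the invariants of the stabiliser -/

section Span

variable {p : ℕ} [Fact p.Prime] {A : Type*} [CommRing A] [Algebra ℚ_[p] A]

local notation "c" => algebraMap ℚ_[p] A

variable {O : Subring A} {V : (Fin 2 → ℚ_[p]) ≃ₗ[ℚ_[p]] A} {T M : ℚ_[p]}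
variable {W : Type*} [AddCommGroup W] [Module ℂ W]

/-- Elements of `GL₂(ℤ_p)` whose image in `GL₂(A)` stabilises the coset of `orbitRep V n`. -/
def OrbitStabilizer (O : Subring A) (V : (Fin 2 → ℚ_[p]) ≃ₗ[ℚ_[p]] A) (n : ℕ)
    (h : GL (Fin 2) ℚ_[p]) : Prop :=
  h ∈ GL2Zp p ∧ OrderDvd O (c ((p : ℚ_[p]) ^ n)) (V (h.1 0) - V ![1, 0] * V (h.1 1))

namespace QuadBasis

/-- For `n ≠ 0`, `w` is congruent modulo `p^(m-k)` to a unit times `z`. If `m = k + n`, the error is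
absorbed by a stabiliser element; if `m = N`, after scaling by `p^k` it lies in the ball. For `n =
0` the stabiliser is all of `GL₂(ℤ_p)`, which is transitive on primitive vectors. -/
theorem exists_orbitStabilizer (H : QuadBasis O V T M) {n : ℕ} {m : ℤ} {N : ℕ} {k : ℤ}
    (hm : m = min (k + n) N) {z w : Fin 2 → ℚ_[p]} (hz : IsPrimitive z) (hw : IsPrimitive w)
    {a b y y' : A} (ha : a ∈ O) (hb : b ∈ O) (hy : y ∈ O) (hy' : y' ∈ O)
    (e : V w = V z * a + c ((p : ℚ_[p]) ^ (m - k)) * y)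
    (e' : V z = V w * b + c ((p : ℚ_[p]) ^ (m - k)) * y') :
    ∃ h, OrbitStabilizer O V n h ∧
      (p : ℚ_[p]) ^ k • w - Matrix.vecMul ((p : ℚ_[p]) ^ k • z) h.1 ∈ ballSubgroup p N := by
  have hp0 : (p : ℚ_[p]) ≠ 0 := cast_prime_ne_zero p
  have hsub : ∀ x : Fin 2 → ℚ_[p], ∀ h : GL (Fin 2) ℚ_[p],
      V ((p : ℚ_[p]) ^ k • x - Matrix.vecMul ((p : ℚ_[p]) ^ k • z) h.1) =
        c ((p : ℚ_[p]) ^ k) * (V x - V (Matrix.vecMul z h.1)) := fun x h => by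
    rw [map_sub, Matrix.smul_vecMul, H.smul_eq, H.smul_eq, mul_sub]
  rcases Nat.eq_zero_or_pos n with rfl | hn
  · obtain ⟨h, hh, hzw⟩ := exists_vecMul_eq hz hw
    refine ⟨h, ⟨hh, V (h.1 0) - V ![1, 0] * V (h.1 1), ?_, by simp⟩, ?_⟩
    · exact O.sub_mem ((H.mem_iff _).2 (hh.1 0)) (O.mul_mem H.omega_mem ((H.mem_iff _).2 (hh.1 1)))
    · rw [Matrix.smul_vecMul, hzw, sub_self]
      exact zero_mem _
  obtain ⟨u, hu, hu1, y'', hy'', ew⟩ := H.exists_unit_mul ha hb hy hy' e e'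
  rcases le_total (k + n) (N : ℤ) with hle | hle
  · have hmk : m - k = n := by
      rw [hm, min_eq_left hle]
      ring
    rw [hmk, zpow_natCast] at ew
    obtain ⟨h, hh, hs, hzh⟩ := H.exists_stabilizer_vecMul hn.ne' hz hu hu1 hy''
    refine ⟨h, ⟨hh, hs⟩, ?_⟩
    rw [H.mem_ballSubgroup_iff, hsub, hzh, ew, sub_self, mul_zero]
    exact ⟨0, O.zero_mem, (mul_zero _).symm⟩
  · have hmk : m - k = N - k := by rw [hm, min_eq_right hle]
    obtain ⟨h, hh, hs, hzh⟩ := H.exists_stabilizer_vecMul hn.ne' hz hu hu1 O.zero_mem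
    refine ⟨h, ⟨hh, hs⟩, ?_⟩
    rw [H.mem_ballSubgroup_iff, hsub, hzh, ew, hmk]
    refine ⟨y'', hy'', ?_⟩
    rw [mul_zero, add_zero, add_sub_cancel_left, ← mul_assoc, ← map_mul, ← zpow_add₀ hp0,
      add_sub_cancel]

/-- The ideal `tO` attached to the ball is good, and its characteristic function is the sum of those
of the balls it contains. Such a ball has attached ideal `t'O ⊆ tO`. If the ideals are equal, the
value of `f` is that of the given ball, by `exists_orbitStabilizer` or because both balls are `p^N
ℤ_p²`; if not, induction applies. A positive multiple of the value sought is then in `S`. -/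
theorem map_chBall_mem (H : QuadBasis O V T M) {n : ℕ} (f : Schwartz p →ₗ[ℂ] W)
    (hf : ∀ h φ, OrbitStabilizer O V n h → f (schwartzRep p h φ) = f φ) {S : Submodule ℂ W}
    (hS : ∀ δ, GoodLattice O V n δ → f (chLattice δ) ∈ S) (N : ℕ) (v : Fin 2 → ℚ_[p]) :
    f (chBall N v) ∈ S := by
  have hp0 : (p : ℚ_[p]) ≠ 0 := cast_prime_ne_zero p
  choose k z t x hkN hv hz hprim hx htx htv htm using H.exists_gcd_content n N
  have hVv : ∀ v, V v = c ((p : ℚ_[p]) ^ (k v)) * V (z v) := fun v => by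
    conv_lhs => rw [hv v, H.smul_eq]
  have hkm : ∀ v, k v ≤ min (k v + n) N := fun v => le_min (by omega) (hkN v)
  have hkt : ∀ v, OrderDvd O (c ((p : ℚ_[p]) ^ (k v))) (t v) := fun v => by
    rw [htx]
    exact OrderDvd.add ⟨_, (H.mem_iff _).2 (hz v), hVv v⟩
      ((H.pow_dvd_pow (hkm v)).mul_left (hx v))
  have htN : ∀ v, OrderDvd O (t v) (c ((p : ℚ_[p]) ^ (N : ℤ))) := fun v =>
    (htm v).trans (H.pow_dvd_pow (min_le_right _ _))
  have hkk : ∀ v q, OrderDvd O (t v) (V q) → k v ≤ k q := fun v q h => by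
    obtain ⟨w, hw, e⟩ := (H.pow_dvd_iff (k v) q).1 ((hkt v).trans h)
    exact content_le (hprim q) (hkN v) hw ((hv q).symm.trans e)
  have htt : ∀ v q, OrderDvd O (t v) (V q) → OrderDvd O (t v) (t q) := fun v q h => by
    rw [htx q]
    refine h.add (((htm v).trans (H.pow_dvd_pow ?_)).mul_left (hx q))
    have := hkk v q h
    omega
  -- Since `t` divides `p^N`, its norm divides `p^(2N)`; the induction runs on the distance of the
  -- valuation of the norm to this bound.
  have hnrm : ∀ v, H.nrm (t v) ≠ 0 ∧ (H.nrm (t v)).valuation ≤ 2 * N := fun v => by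
    obtain ⟨s, hs, e⟩ := htN v
    have h1 := congrArg H.nrm e
    rw [H.nrm_mul, H.nrm_algebraMap] at h1
    have h2 : H.nrm (t v) * H.nrm s ≠ 0 := by
      rw [← h1]
      exact pow_ne_zero _ (zpow_ne_zero _ hp0)
    refine ⟨left_ne_zero_of_mul h2, ?_⟩
    have h3 := congrArg Padic.valuation h1
    rw [Padic.valuation_mul (left_ne_zero_of_mul h2) (right_ne_zero_of_mul h2),
      zpow_natCast, Padic.valuation_pow, Padic.valuation_pow, Padic.valuation_p] at h3
    have h4 := (Padic.norm_le_one_iff_val_nonneg _).1 (H.norm_nrm_le hs)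
    push_cast at h3
    omega
  -- Goodness: for `y ∈ O` the coefficient of `ω` in `ty` is divisible by `p^k`, so `p^n` times it
  -- is divisible by `p^(k+n)`, hence by `t`.
  have hlat : ∀ v, ∃ δ, GoodLattice O V n δ ∧ ∀ w, w ∈ rowLattice δ ↔ OrderDvd O (t v) (V w) := by
    intro v
    obtain ⟨δ, -, -, -, hδ⟩ := H.exists_mulMatrix (hnrm v).1
    have hmem := H.mem_rowLattice_iff hδ
    obtain ⟨t', ht'⟩ := H.isUnit_of_nrm_ne_zero (hnrm v).1
    refine ⟨δ, ⟨t', by rwa [ht'], fun y hy => ?_⟩, hmem⟩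
    rw [ht']
    change OrderDvd O _ _
    obtain ⟨w, hw, e⟩ := (H.pow_dvd_iff (k v) (V.symm (t v * y))).1 (by
      rw [V.apply_symm_apply]
      exact (hkt v).trans ⟨y, hy, rfl⟩)
    rw [e, Pi.smul_apply, smul_eq_mul, ← mul_assoc, mul_comm, map_mul]
    refine ((htm v).trans ?_).mul_left ((H.algebraMap_mem_iff _).2 (hw 0))
    rw [← zpow_natCast, ← zpow_add₀ hp0, add_comm]
    exact H.pow_dvd_pow (min_le_left _ _)
  have heq : ∀ v q, OrderDvd O (t v) (t q) → OrderDvd O (t q) (t v) →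
      f (chBall N q) = f (chBall N v) := by
    intro v q h₁ h₂
    have hkeq : k v = k q := (hkk v q (h₁.trans (htv q))).antisymm (hkk q v (h₂.trans (htv v)))
    by_cases hkv : k v = N
    · rw [chBall_eq_of_mem]
      refine sub_mem ?_ ?_
      · rw [H.mem_ballSubgroup_iff, ← hkv, hkeq]
        exact ⟨_, (H.mem_iff _).2 (hz q), hVv q⟩
      · rw [H.mem_ballSubgroup_iff, ← hkv]
        exact ⟨_, (H.mem_iff _).2 (hz v), hVv v⟩
    · have hmod : ∀ v q, k v = k q → OrderDvd O (t v) (V q) → ∃ a ∈ O, ∃ y ∈ O, V (z q) =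
          V (z v) * a + c ((p : ℚ_[p]) ^ (min (k v + n) N - k v)) * y := by
        intro v q hkeq ⟨y, hy, e⟩
        refine ⟨y, hy, x v * y, O.mul_mem (hx v) hy, ?_⟩
        have hcc : c ((p : ℚ_[p]) ^ (-k v)) * c ((p : ℚ_[p]) ^ (k v)) = 1 := by
          rw [← map_mul, ← zpow_add₀ hp0, neg_add_cancel, zpow_zero, map_one]
        have hcm : c ((p : ℚ_[p]) ^ (min (k v + n) (N : ℤ) - k v)) =
            c ((p : ℚ_[p]) ^ (min (k v + n) (N : ℤ))) * c ((p : ℚ_[p]) ^ (-k v)) := by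
          rw [← map_mul, ← zpow_add₀ hp0, sub_eq_add_neg]
        rw [htx v, hVv q, hVv v, ← hkeq] at e
        rw [hcm]
        linear_combination c ((p : ℚ_[p]) ^ (-k v)) * e + (V (z v) * y - V (z q)) * hcc
      obtain ⟨a, ha, y, hy, e⟩ := hmod v q hkeq (h₁.trans (htv q))
      obtain ⟨b, hb, y', hy', e'⟩ := hmod q v hkeq.symm (h₂.trans (htv v))
      rw [← hkeq] at e'
      obtain ⟨h, hh, hmem⟩ := H.exists_orbitStabilizer rfl ((hprim v).resolve_left hkv)
        ((hprim q).resolve_left (hkeq ▸ hkv)) ha hb hy hy' e e'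
      rw [← hv v, hkeq, ← hv q] at hmem
      rw [chBall_eq_of_mem hmem, ← hf h _ hh, schwartzRep_chBall hh.1]
  induction hd : (2 * N - (H.nrm (t v)).valuation).toNat using Nat.strong_induction_on
    generalizing v with
  | _ d ih =>
    obtain ⟨δ, hgood, hδ⟩ := hlat v
    have hinv : ∀ v, ∀ w ∈ ballSubgroup p N, (chLattice δ).toFun (v + w) = (chLattice δ).toFun v := by
      intro a w hw
      have hw' : w ∈ rowLattice δ := (hδ w).2 ((htN v).trans (H.mem_ballSubgroup_iff.1 hw))
      have hiff : a + w ∈ rowLattice δ ↔ a ∈ rowLattice δ := by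
        simp only [rowLattice, Set.mem_ofPred_eq] at hw' ⊢
        rw [Matrix.add_vecMul]
        constructor
        · intro h i
          have := sub_mem (show _ ∈ PadicInt.subring p from h i)
            (show _ ∈ PadicInt.subring p from hw' i)
          rwa [Pi.add_apply, add_sub_cancel_right] at this
        · intro h i
          exact add_mem (show _ ∈ PadicInt.subring p from h i)
            (show _ ∈ PadicInt.subring p from hw' i)
      rw [chLattice_toFun]
      by_cases ha : a ∈ rowLattice δ
      · rw [Set.indicator_of_mem ha, Set.indicator_of_mem (hiff.2 ha)]
      · rw [Set.indicator_of_notMem ha, Set.indicator_of_notMem (fun h => ha (hiff.1 h))]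
    obtain ⟨s, hs, hsum⟩ := Schwartz.exists_eq_sum hinv
    have hs' : ∀ q, q ∈ s ↔ q.out ∈ rowLattice δ := fun q => by
      rw [hs, chLattice_toFun, Set.indicator_apply_ne_zero]
      simp
    have hsum' : ∑ q ∈ s, f (chBall N q.out) ∈ S := by
      have h1 := hS δ hgood
      rw [hsum, map_sum] at h1
      rwa [Finset.sum_congr rfl fun q hq => by
        rw [chLattice_toFun, Set.indicator_of_mem ((hs' q).1 hq), one_smul]] at h1
    have hout := out_sub_mem N v
    refine mem_of_sum_mem hsum' (i₀ := (v : (Fin 2 → ℚ_[p]) ⧸ ballSubgroup p N)) ?_ ?_ ?_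
    · rw [hs', hδ]
      have e : V (v : (Fin 2 → ℚ_[p]) ⧸ ballSubgroup p N).out =
          V v + V ((v : (Fin 2 → ℚ_[p]) ⧸ ballSubgroup p N).out - v) := by
        rw [← map_add, add_sub_cancel]
      rw [e]
      exact (htv v).add ((htN v).trans (H.mem_ballSubgroup_iff.1 hout))
    · rw [chBall_eq_of_mem hout]
    · intro q hq
      rw [hs', hδ] at hq
      -- The ratio `y` of the two generators decides: if its norm is a unit the ideals coincide, and
      -- otherwise the valuation of the norm has strictly increased.
      obtain ⟨y, hy, e⟩ := htt v _ hq
      have hny : H.nrm y ≠ 0 := by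
        intro h0
        apply (hnrm q.out).1
        rw [e, H.nrm_mul, h0, mul_zero]
      by_cases hy1 : ‖H.nrm y‖ = 1
      · left
        refine heq v q.out ⟨y, hy, e⟩ ⟨c (H.nrm y)⁻¹ * H.conj y, O.mul_mem
          ((H.algebraMap_mem_iff _).2 (by rw [norm_inv, hy1, inv_one])) (H.conj_mem hy), ?_⟩
        have h1 : c (H.nrm y) * c (H.nrm y)⁻¹ = 1 := by
          rw [← map_mul, mul_inv_cancel₀ hny, map_one]
        have h2 := H.mul_conj y
        rw [e]
        linear_combination (-t v) * h1 - t v * c (H.nrm y)⁻¹ * h2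
      · right
        refine ih _ ?_ q.out rfl
        have h1 : (H.nrm (t q.out)).valuation = (H.nrm (t v)).valuation + (H.nrm y).valuation := by
          rw [e, H.nrm_mul, Padic.valuation_mul (hnrm v).1 hny]
        have h2 : 0 ≤ (H.nrm y).valuation :=
          (Padic.norm_le_one_iff_val_nonneg _).1 (H.norm_nrm_le hy)
        have h3 : (H.nrm y).valuation ≠ 0 := fun h0 => hy1 (by
          rw [Padic.norm_eq_zpow_neg_valuation hny, h0, neg_zero, zpow_zero])
        have h4 := (hnrm q.out).2
        omega

/-- The values on Schwartz functions of a functional invariant under the stabiliser of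
`orbitRep V n` are spanned by its values on good lattices. -/
theorem map_mem_of_goodLattice (H : QuadBasis O V T M) {n : ℕ} (f : Schwartz p →ₗ[ℂ] W)
    (hf : ∀ h φ, OrbitStabilizer O V n h → f (schwartzRep p h φ) = f φ) {S : Submodule ℂ W}
    (hS : ∀ δ, GoodLattice O V n δ → f (chLattice δ) ∈ S) (φ : Schwartz p) : f φ ∈ S := by
  obtain ⟨N, hN⟩ := φ.exists_invariant
  obtain ⟨s, -, hs⟩ := Schwartz.exists_eq_sum hN
  rw [hs, map_sum]
  refine S.sum_mem fun q _ => ?_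
  rw [map_smul]
  exact S.smul_mem _ (H.map_chBall_mem f hf hS N _)

end QuadBasis

end Span

/-! ### Discriminants of quadratic rings over `ℤ` -/

section QuadraticRing

variable {S : Type*} [CommRing S] (b : Module.Basis (Fin 2) ℤ S)

-- Cayley–Hamilton for the matrix of multiplication by `x`, whose trace and determinant are those of
-- `x`.
include b in
theorem sq_eq_trace_sub_norm (x : S) :
    x * x = Algebra.trace ℤ S x • x - Algebra.norm ℤ x • (1 : S) := by
  have h := Matrix.aeval_self_charpoly (Algebra.leftMulMatrix b x)
  rw [Matrix.charpoly_fin_two, ← Algebra.trace_eq_matrix_trace b,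
    ← Algebra.norm_eq_matrix_det b] at h
  have h2 : Algebra.leftMulMatrix b (x * x - Algebra.trace ℤ S x • x + Algebra.norm ℤ x • 1) = 0 := by
    rw [← h]
    simp [pow_two, Algebra.smul_def]
  have h3 := Algebra.leftMulMatrix_injective b (h2.trans (map_zero _).symm)
  linear_combination h3

include b in
theorem discr_pair (x : S) : Algebra.discr ℤ ![x, 1] =
    Algebra.trace ℤ S x ^ 2 - 4 * Algebra.norm ℤ x := by
  have h1 : Algebra.trace ℤ S 1 = 2 := by
    have := Algebra.trace_algebraMap_of_basis b (1 : ℤ)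
    simpa using this
  have h2 : Algebra.trace ℤ S (x * x) = Algebra.trace ℤ S x * Algebra.trace ℤ S x -
      Algebra.norm ℤ x * 2 := by
    conv_lhs => rw [sq_eq_trace_sub_norm b x]
    rw [map_sub, map_smul, map_smul, h1, smul_eq_mul, smul_eq_mul]
  rw [Algebra.discr_def, Matrix.det_fin_two]
  simp only [Algebra.traceMatrix_apply, Algebra.traceForm_apply, Matrix.cons_val_zero,
    Matrix.cons_val_one, mul_one, one_mul, h1, h2]
  ring

/-- The determinant of the passage from `b` to `(b i, 1)` is, up to sign, the coordinate of `1`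
along `b j`, and the discriminant changes by its square. -/
theorem discr_pair_basis (i j : Fin 2) (hij : i ≠ j) :
    Algebra.discr ℤ ![b i, 1] = b.repr 1 j ^ 2 * Algebra.discr ℤ b := by
  have h1 := b.sum_repr 1
  rw [Fin.sum_univ_two] at h1
  have key := fun P => Algebra.discr_of_matrix_mulVec (b : Fin 2 → S) (P : Matrix (Fin 2) (Fin 2) ℤ)
  have hd : ∀ P : Matrix (Fin 2) (Fin 2) ℤ, P.det ^ 2 = b.repr 1 j ^ 2 →
      Matrix.mulVec (P.map (algebraMap ℤ S)) b = ![b i, 1] →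
      Algebra.discr ℤ ![b i, 1] = b.repr 1 j ^ 2 * Algebra.discr ℤ b := fun P hP hb => by
    rw [← hP, ← key, hb]
  refine hd (Matrix.of ![Pi.single i 1, fun l => b.repr 1 l]) ?_ ?_
  · rw [Matrix.det_fin_two]
    fin_cases i <;> fin_cases j <;> simp_all
  · ext l
    fin_cases l
    · fin_cases i <;> simp [Matrix.mulVec, dotProduct, Fin.sum_univ_two]
    · simpa [Matrix.mulVec, dotProduct, Fin.sum_univ_two, Algebra.smul_def] using h1

end QuadraticRing

/-! ### The local order of an unramified quadratic field -/

section NumberFields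

variable (p : ℕ) [Fact p.Prime] (E : Type*) [Field E] [NumberField E]

theorem norm_intCast_eq_one {a : ℤ} (h : ¬ (p : ℤ) ∣ a) : ‖(a : ℚ_[p])‖ = 1 :=
  (Padic.norm_int_le_one a).antisymm
    (not_lt.1 fun hlt => h ((Padic.norm_intCast_lt_one_iff).1 hlt))

/-- Some coordinate of `1` in an integral basis is prime to `p`. Over `ℤ_p` that basis vector can be
replaced by `1`, and the other one is `ω`. The discriminant of `(ω, 1)` is that of `E` times the
square of a number prime to `p`, hence prime to `p` because `p` is unramified. -/
theorem exists_quadBasis (hE : Module.finrank ℚ E = 2)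
    (hp : Algebra.IsUnramifiedIn (NumberField.RingOfIntegers E) (Ideal.span {(p : ℤ)})) :
    ∃ (V : (Fin 2 → ℚ_[p]) ≃ₗ[ℚ_[p]] LocalAlg p E) (T M : ℚ_[p]),
      QuadBasis (LocalInt p E) V T M := by
  classical
  have hpp : Prime (p : ℤ) := Nat.prime_iff_prime_int.1 Fact.out
  have hdisc := (NumberField.not_dvd_discr_iff_isUnramifiedIn E
    (NumberField.RingOfIntegers E) hpp).2 hp
  have hcard : Fintype.card (Module.Free.ChooseBasisIndex ℤ (NumberField.RingOfIntegers E)) = 2 := by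
    rw [← Module.finrank_eq_card_chooseBasisIndex, NumberField.RingOfIntegers.rank, hE]
  let e := Fintype.equivFinOfCardEq hcard
  set b := (NumberField.RingOfIntegers.basis E).reindex e with hb
  set B := (localBasis p E).reindex e with hB
  have hmem : ∀ x, x ∈ LocalInt p E ↔ ∀ l, ‖B.repr x l‖ ≤ 1 := fun x => by
    rw [mem_localInt_iff]
    constructor
    · intro h l
      rw [hB, Module.Basis.repr_reindex_apply]
      exact h _
    · intro h l
      have := h (e l)
      rwa [hB, Module.Basis.repr_reindex_apply, Equiv.symm_apply_apply] at this
  let ψ : NumberField.RingOfIntegers E →+* LocalAlg p E :=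
    (Algebra.TensorProduct.includeRight : E →ₐ[ℚ] LocalAlg p E).toRingHom.comp
      (algebraMap (NumberField.RingOfIntegers E) E)
  have hBb : ∀ l, B l = ψ (b l) := fun l => by
    simp [hB, hb, ψ, localBasis]
  have hψ : ∀ a : ℤ, ∀ x, ψ (a • x) = (a : ℚ_[p]) • ψ x := fun a x => by
    rw [map_zsmul, Int.cast_smul_eq_zsmul]
  have hd : Algebra.discr ℤ b = NumberField.discr E := NumberField.discr_eq_discr E b
  obtain ⟨i, j, hij, hall, hj⟩ : ∃ i j : Fin 2, i ≠ j ∧ (∀ l, l = i ∨ l = j) ∧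
      ¬ (p : ℤ) ∣ b.repr 1 j := by
    -- If `p` divided both coordinates, `1` would be `p` times an algebraic integer, and taking
    -- norms would make `p²` divide `1`.
    by_contra hc
    push Not at hc
    have h0 := hc 1 0 (by decide) (by decide)
    have h1 := hc 0 1 (by decide) (by decide)
    obtain ⟨y, hy⟩ := h0
    obtain ⟨z, hz⟩ := h1
    have h2 := b.sum_repr 1
    rw [Fin.sum_univ_two, hy, hz, mul_smul, mul_smul, ← smul_add] at h2
    have h3 := congrArg (Algebra.norm ℤ) h2
    rw [Algebra.smul_def, map_mul, map_one (Algebra.norm ℤ), Algebra.norm_algebraMap,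
      NumberField.RingOfIntegers.rank, hE] at h3
    rw [pow_two, mul_assoc] at h3
    exact hpp.not_isUnit (IsUnit.of_mul_eq_one _ h3)
  set T := Algebra.trace ℤ (NumberField.RingOfIntegers E) (b i) with hT
  set M := Algebra.norm ℤ (b i) with hM
  have hsq := sq_eq_trace_sub_norm b (b i)
  have hTM : ¬ (p : ℤ) ∣ T ^ 2 - 4 * M := by
    rw [← discr_pair b, discr_pair_basis b i j hij, hd]
    intro h
    rcases hpp.dvd_or_dvd h with h | h
    · exact hj (hpp.dvd_of_dvd_pow h)
    · exact hdisc h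
  set x : Fin 2 → ℚ_[p] := fun l => ((b.repr 1 l : ℤ) : ℚ_[p]) with hx
  have hxj : ‖x j‖ = 1 := norm_intCast_eq_one p hj
  have hxj0 : x j ≠ 0 := norm_ne_zero_iff.1 (by rw [hxj]; exact one_ne_zero)
  have hxi : ‖x i‖ ≤ 1 := Padic.norm_int_le_one _
  have hone : ∀ l, B.repr 1 l = x l := by
    have h1 : (1 : LocalAlg p E) = ∑ l, x l • B l := by
      rw [← map_one ψ, ← b.sum_repr 1, map_sum]
      exact Finset.sum_congr rfl fun l _ => by rw [hψ, hBb]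
    intro l
    rw [h1, B.repr_sum_self]
  let f : (Fin 2 → ℚ_[p]) →ₗ[ℚ_[p]] LocalAlg p E :=
    (LinearMap.proj 0).smulRight (B i) + (LinearMap.proj 1).smulRight 1
  have hf : ∀ v, f v = v 0 • B i + v 1 • 1 := fun v => rfl
  have hfi : ∀ v, B.repr (f v) i = v 0 + v 1 * x i := fun v => by
    rw [hf, map_add, map_smul, map_smul, Finsupp.add_apply, Finsupp.smul_apply, Finsupp.smul_apply,
      hone, B.repr_self, Finsupp.single_eq_same, smul_eq_mul, smul_eq_mul, mul_one]
  have hfj : ∀ v, B.repr (f v) j = v 1 * x j := fun v => by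
    rw [hf, map_add, map_smul, map_smul, Finsupp.add_apply, Finsupp.smul_apply, Finsupp.smul_apply,
      hone, B.repr_self, Finsupp.single_eq_of_ne hij.symm, smul_eq_mul, smul_eq_mul, mul_zero,
      zero_add]
  have hinj : Function.Injective f := by
    rw [← LinearMap.ker_eq_bot, LinearMap.ker_eq_bot']
    intro v hv
    have h1 := hfj v
    have h0 := hfi v
    rw [hv, map_zero, Finsupp.zero_apply] at h1 h0
    have h1' : v 1 = 0 := (mul_eq_zero.1 h1.symm).resolve_right hxj0
    rw [h1', zero_mul, add_zero] at h0
    ext l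
    fin_cases l
    · exact h0.symm
    · exact h1'
  have : FiniteDimensional ℚ_[p] (LocalAlg p E) := B.finiteDimensional_of_finite
  let V : (Fin 2 → ℚ_[p]) ≃ₗ[ℚ_[p]] LocalAlg p E :=
    LinearEquiv.ofInjectiveOfFinrankEq f hinj (by rw [Module.finrank_eq_card_basis B]; simp)
  have hV : ∀ v, V v = f v := fun v => rfl
  refine ⟨V, T, M, Padic.norm_int_le_one _, Padic.norm_int_le_one _, ?_, ?_, ?_, ?_⟩
  · have := norm_intCast_eq_one p hTM
    push_cast at this
    exact this
  · rw [hV, hf]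
    simp
  · rw [hV, hf]
    have h1 := congrArg ψ hsq
    rw [map_mul, map_sub, hψ, hψ, map_one, ← hBb] at h1
    simpa using h1
  · intro v
    rw [hV, hmem]
    have hsplit : (∀ l, ‖B.repr (f v) l‖ ≤ 1) ↔ ‖B.repr (f v) i‖ ≤ 1 ∧ ‖B.repr (f v) j‖ ≤ 1 := by
      constructor
      · exact fun h => ⟨h i, h j⟩
      · rintro ⟨h₁, h₂⟩ l
        rcases hall l with rfl | rfl
        · exact h₁
        · exact h₂
    -- The coordinates of `V v` are `v₀ + v₁ x_i` and `v₁ x_j`, with `x_j` a unit and `x_i`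
    -- integral; their integrality is thus that of `v₀` and `v₁`.
    rw [hsplit, hfi, hfj, norm_mul, hxj, mul_one, Fin.forall_fin_two]
    refine and_congr_left fun h1 => ?_
    have hm : v 1 * x i ∈ PadicInt.subring p :=
      mul_mem (show v 1 ∈ PadicInt.subring p from h1) (show x i ∈ PadicInt.subring p from hxi)
    exact (PadicInt.subring p).toAddSubgroup.add_mem_cancel_right hm

end NumberFields

/-! ### The orbit system and the Hecke pair of `𝒢*` -/

section Assembly

variable (p : ℕ) [Fact p.Prime] (E : Type*) [Field E] [NumberField E]

theorem isClosedEmbedding_matrixMap : Topology.IsClosedEmbedding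
    (fun B : Matrix (Fin 2) (Fin 2) ℚ_[p] => B.map (algebraMap ℚ_[p] (LocalAlg p E))) := by
  let f : Matrix (Fin 2) (Fin 2) ℚ_[p] →ₗ[ℚ_[p]] (Fin 2 → Fin 2 → LocalAlg p E) :=
    (Algebra.linearMap ℚ_[p] (LocalAlg p E)).mapMatrix
  have hf : LinearMap.ker f = ⊥ := by
    rw [LinearMap.ker_eq_bot']
    intro B hB
    ext i j
    have h : algebraMap ℚ_[p] (LocalAlg p E) (B i j) = 0 := congrFun (congrFun hB i) j
    exact (map_eq_zero_iff _ (algebraMap ℚ_[p] (LocalAlg p E)).injective).1 h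
  exact LinearMap.isClosedEmbedding_of_injective hf

/-- On matrices the map is linear and injective between finite-dimensional spaces, hence a closed
embedding. Units are closed in the product of the matrix ring with its opposite, so the property
passes to the groups. -/
theorem isClosedEmbedding_embG : Topology.IsClosedEmbedding (embG p E) := by
  have hm := isClosedEmbedding_matrixMap p E
  refine (Topology.IsClosedEmbedding.of_comp_iff
    (Units.isClosedEmbedding_embedProduct (α := Matrix (Fin 2) (Fin 2) (LocalAlg p E)))).1 ?_
  have ho := (MulOpposite.opHomeomorph.isClosedEmbedding.comp hm).comp
    (MulOpposite.opHomeomorph (M := Matrix (Fin 2) (Fin 2) ℚ_[p])).symm.isClosedEmbedding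
  exact (hm.prodMap ho).comp
    (Units.isClosedEmbedding_embedProduct (α := Matrix (Fin 2) (Fin 2) ℚ_[p]))

theorem isClosedEmbedding_embGStar : Topology.IsClosedEmbedding (embGStar p E) :=
  (Topology.IsClosedEmbedding.of_comp_iff
    (isClosed_gStarQp p E).isClosedEmbedding_subtypeVal).1 (isClosedEmbedding_embG p E)

variable {p E}

theorem coe_embGStar (γ : GL (Fin 2) ℚ_[p]) : (embGStar p E γ : GQp p E) = embG p E γ := rfl

theorem mem_gStarZp_iff (g : GStarQp p E) : g ∈ GStarZp p E ↔ (g : GQp p E) ∈ GZp p E := by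
  rw [gStarZp_eq, Subgroup.mem_subgroupOf]

theorem mem_gStarQp_of_det {g : GQp p E} {d : ℚ_[p]} (hd : d ≠ 0)
    (h : g.1.det = algebraMap ℚ_[p] (LocalAlg p E) d) : g ∈ GStarQp p E :=
  ⟨Units.mk0 d hd, Units.ext h.symm⟩

theorem exists_det_eq (g : GStarQp p E) :
    ∃ d : ℚ_[p], (g : GQp p E).1.det = algebraMap ℚ_[p] (LocalAlg p E) d := by
  obtain ⟨u, hu⟩ := g.2
  exact ⟨u, (congrArg Units.val hu).symm⟩

variable {V : (Fin 2 → ℚ_[p]) ≃ₗ[ℚ_[p]] LocalAlg p E} {T M : ℚ_[p]}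

theorem QuadBasis.isHeckePair (H : QuadBasis (LocalInt p E) V T M) :
    IsHeckePair (GZp p E) (GStarQp p E) (GStarZp p E) where
  mem_iff := mem_gStarZp_iff
  isClosed := isClosed_gStarQp p E
  exists_swap k hk g := by
    -- Determinant one is what places `k₁` in `𝒢*`; no such condition is needed on `k₂`.
    obtain ⟨k₁, h₁, hd, k₂, h₂, e⟩ := H.exists_swap (O := LocalInt p E) (k := k) hk g
    exact ⟨⟨k₁, mem_gStarQp_of_det one_ne_zero (by rw [hd, map_one])⟩,
      (mem_gStarZp_iff _).2 h₁, k₂, h₂, e⟩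

theorem orbitRep_mem_gStarQp (V : (Fin 2 → ℚ_[p]) ≃ₗ[ℚ_[p]] LocalAlg p E) (n : ℕ) :
    orbitRep V n ∈ GStarQp p E :=
  mem_gStarQp_of_det (pow_ne_zero n (cast_prime_ne_zero p)) (by
    rw [orbitRep_val, Matrix.det_fin_two_of, mul_one, mul_zero, sub_zero])

theorem QuadBasis.orbitSystem (H : QuadBasis (LocalInt p E) V T M) :
    OrbitSystem (GStarZp p E) (embGStar p E) (fun n => ⟨orbitRep V n, orbitRep_mem_gStarQp V n⟩)
      (GoodLattice (LocalInt p E) V) where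
  isClosedEmbedding := isClosedEmbedding_embGStar p E
  map_mem γ hγ := (mem_gStarZp_iff _).2
    (embGL_mem (fun a => (H.algebraMap_mem_iff a).2) hγ)
  exists_orbit g := by
    obtain ⟨d, hd⟩ := exists_det_eq g
    obtain ⟨γ, n, k, hk, e⟩ := H.exists_orbit g.1 hd
    -- All the other factors have determinant in `ℚ_pˣ`, hence so has `k`.
    have hk' : k ∈ GStarQp p E := by
      have h1 : k = ((embGStar p E γ : GQp p E) * orbitRep V n)⁻¹ * g := by
        rw [e]
        exact (inv_mul_cancel_left _ _).symm
      rw [h1]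
      exact mul_mem (inv_mem (mul_mem (embGStar p E γ).2 (orbitRep_mem_gStarQp V n))) g.2
    exact ⟨γ, n, ⟨k, hk'⟩, (mem_gStarZp_iff _).2 hk, Subtype.ext e⟩
  mk_mem_span n φ := by
    refine H.map_mem_of_goodLattice (n := n) ((CoinvModule.mkBilin (GStarZp p E) (embGStar p E)).flip
      (chCoset (GStarZp p E) ⟨orbitRep V n, orbitRep_mem_gStarQp V n⟩)) ?_ ?_ φ
    · rintro h φ ⟨hh, y, hy, e⟩
      have h1 := H.stabilizer_mem hh hy e
      change CoinvModule.mk _ _ (schwartzRep p h φ) _ = CoinvModule.mk _ _ φ _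
      set x : GStarQp p E := ⟨orbitRep V n, orbitRep_mem_gStarQp V n⟩
      -- Thus `hxK = xK`, and the coinvariance relation lets `h` act on `φ` without changing the
      -- class.
      have h2 : x⁻¹ * (embGStar p E h * x) ∈ GStarZp p E := (mem_gStarZp_iff _).2 h1
      conv_lhs => rw [← chCoset_eq_of_mem h2, CoinvModule.mk_chCoset_mul, ← Module.End.mul_apply,
        ← map_mul, inv_mul_cancel, map_one, Module.End.one_apply]
    · intro δ hδ
      exact Submodule.subset_span ⟨δ, hδ, rfl⟩
  le_of_mem hδ h₁ h₂ e := H.goodLattice_le hδ ((mem_gStarZp_iff _).1 h₁)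
    ((mem_gStarZp_iff _).1 h₂) (congrArg Subtype.val e)
  exists_double g := by
    obtain ⟨d, hd⟩ := exists_det_eq g
    obtain ⟨n, δ, hδ, k₁, h₁, hd₁, k₂, h₂, e⟩ := H.exists_goodLattice g.1 hd
    have hk₁ : k₁ ∈ GStarQp p E := mem_gStarQp_of_det one_ne_zero (by rw [hd₁, map_one])
    have hk₂ : k₂ ∈ GStarQp p E := by
      have h1 : k₂ = (k₁ * ((embGStar p E δ : GQp p E) * orbitRep V n))⁻¹ * g := by
        rw [e]
        exact (inv_mul_cancel_left _ _).symm
      rw [h1]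
      exact mul_mem (inv_mem (mul_mem hk₁ (mul_mem (embGStar p E δ).2
        (orbitRep_mem_gStarQp V n)))) g.2
    exact ⟨n, δ, hδ, ⟨k₁, hk₁⟩, (mem_gStarZp_iff _).2 h₁, ⟨k₂, hk₂⟩, (mem_gStarZp_iff _).2 h₂,
      Subtype.ext e⟩
  exists_vec hδ := QuadBasis.goodLattice_vec hδ

end Assembly

end AsaiHecke

theorem proposition5 (E : Type*) [Field E] [NumberField E] [NumberField.IsTotallyReal E]
    (hE : Module.finrank ℚ E = 2) (p : ℕ) [Fact p.Prime]
    (hp : Algebra.IsUnramifiedIn (NumberField.RingOfIntegers E) (Ideal.span {(p : ℤ)})) :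
    -- `ℐ(𝒢*(ℚ_p)/𝒢*(ℤ_p))` is cyclic, generated by `ch(ℤ_p²) ⊗ ch(𝒢*(ℤ_p))`,
    Submodule.span (AsaiHecke.Hecke (AsaiHecke.GStarZp p E))
        {AsaiHecke.CoinvModule.mk (AsaiHecke.GStarZp p E) (AsaiHecke.embGStar p E)
          (AsaiHecke.chZp2 p) (AsaiHecke.chCoset (AsaiHecke.GStarZp p E) 1)} = ⊤ ∧
    -- and free, with this generator as a basis;
    Module.Free (AsaiHecke.Hecke (AsaiHecke.GStarZp p E))
      (AsaiHecke.CoinvModule (AsaiHecke.GStarZp p E) (AsaiHecke.embGStar p E)) ∧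
    (∀ δ : AsaiHecke.CoinvModule (AsaiHecke.GStarZp p E) (AsaiHecke.embGStar p E),
      ∃! P : AsaiHecke.Hecke (AsaiHecke.GStarZp p E),
        P • AsaiHecke.CoinvModule.mk (AsaiHecke.GStarZp p E) (AsaiHecke.embGStar p E)
          (AsaiHecke.chZp2 p) (AsaiHecke.chCoset (AsaiHecke.GStarZp p E) 1) = δ) ∧
    -- there is an injective algebra homomorphism `ι_p` with `ch(K*gK*) ↦ ch(KgK)`,
    ∃ ι : AsaiHecke.Hecke (AsaiHecke.GStarZp p E) →ₐ[ℂ] AsaiHecke.Hecke (AsaiHecke.GZp p E),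
      Function.Injective ι ∧
      (∀ g : AsaiHecke.GStarQp p E,
        ι (AsaiHecke.chDoubleCoset (AsaiHecke.GStarZp p E) g) =
          AsaiHecke.chDoubleCoset (AsaiHecke.GZp p E) (g : AsaiHecke.GQp p E)) ∧
      -- and an injective `i_p` with `φ ⊗ ch(gK*) ↦ φ ⊗ ch(gK)`, Hecke equivariant through `ι_p`.
      ∃ i : AsaiHecke.CoinvModule (AsaiHecke.GStarZp p E) (AsaiHecke.embGStar p E) →ₗ[ℂ]
          AsaiHecke.CoinvModule (AsaiHecke.GZp p E) (AsaiHecke.embG p E),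
        Function.Injective i ∧
        (∀ (φ : AsaiHecke.Schwartz p) (g : AsaiHecke.GStarQp p E),
          i (AsaiHecke.CoinvModule.mk (AsaiHecke.GStarZp p E) (AsaiHecke.embGStar p E) φ
              (AsaiHecke.chCoset (AsaiHecke.GStarZp p E) g)) =
            AsaiHecke.CoinvModule.mk (AsaiHecke.GZp p E) (AsaiHecke.embG p E) φ
              (AsaiHecke.chCoset (AsaiHecke.GZp p E) (g : AsaiHecke.GQp p E))) ∧
        ∀ (θ : AsaiHecke.Hecke (AsaiHecke.GStarZp p E))
          (x : AsaiHecke.CoinvModule (AsaiHecke.GStarZp p E) (AsaiHecke.embGStar p E)),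
          i (θ • x) = ι θ • i x := by
  obtain ⟨V, T, M, H⟩ := AsaiHecke.exists_quadBasis p E hE hp
  have hj : ∀ γ, (AsaiHecke.embGStar p E γ : AsaiHecke.GQp p E) = AsaiHecke.embG p E γ :=
    AsaiHecke.coe_embGStar
  refine ⟨H.orbitSystem.span_eq_top, H.orbitSystem.free, H.orbitSystem.existsUnique_smul,
    H.isHeckePair.heckeExtAlgHom, H.isHeckePair.heckeExt_injective,
    H.isHeckePair.heckeExt_chDoubleCoset, H.isHeckePair.coinvExt hj,
    H.isHeckePair.coinvExt_injective hj, fun φ g => ?_, H.isHeckePair.coinvExt_smul hj⟩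
  rw [H.isHeckePair.coinvExt_mk hj, H.isHeckePair.ext_chCoset]
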